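/- **Definitions.** A 0-1 matrix is a *partial pattern* if every row and every column contains at most one $1$. A permutation matrix $M$ *contains* a 0-1 matrix $K$ if $K$ is obtained from $M$ by deleting some (possibly no) rows and columns; otherwise $M$ *avoids* $K$. For a set $\mathcal F$ of partial patterns, $C_n(\mathcal F)$ is the number of $n\times n$ permutation matrices avoiding every element of $\mathcal F$. Let $X=\{x_i\}$, $X^{-1}=\{x_i^{-1}\}$, $Y=\{y_i\}$, $Y^{-1}=\{y_i^{-1}\}$ ($i\in\mathbb Z$) be sets of labels. Write $a\sim b$ if $a,b\in X\cup X^{-1}$ or $a,b\in Y\cup Y^{-1}$. A *two-stack automaton* $\Gamma$ is a finite directed graph (loops allowed) with vertices $v_1,\dots,v_m$, $m\ge 2$, whose vertices carry labels $\rho(v)\in X\cup X^{-1}\cup Y\cup Y^{-1}\cup\{\varepsilon\}$, such that $\rho(v_1)=\rho(v_2)=\varepsilon$ and there is no edge $v_i\to v_j$ with $\rho(v_i)\sim\rho(v_j)$. A path of length $n$ is a sequence of $n$ vertices $\gamma_1\dots\gamma_n$ with $\gamma_i\to\gamma_{i+1}$. Traversing a path, one keeps two words $w_X,w_Y$, initially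 empty: on entering a vertex (the first one included) with label $x_i$, append $x_i$ to $w_X$; with label $x_i^{-1}$, remove $x_i$ from the end of $w_X$ (undefined if $w_X$ does not end in $x_i$); similarly for $y_i^{\pm1}$ and $w_Y$; with label $\varepsilon$, do nothing. The path is *balanced* if every step is defined and both words are empty at the end. $G(\Gamma,n)$ is the number of balanced paths of length $n$ from $v_1$ to $v_2$. A $g\times g$ permutation matrix is *simple* if no $k\times k$ submatrix on consecutive rows and consecutive columns, $1<k<g$, is a permutation matrix. Let $\mathcal A_g$ be the set of simple $g\times g$ permutation matrices containing the $7\times7$ permutation matrix whose ones in rows $1,\dots,7$ are in columns $5,6,7,4,1,2,3$, respectively. **Construction.** Let $\Gamma$ be a two-stack automaton with $m$ vertices and let $r$ be the number of distinct labels in $X\cup Y$ on its vertices. Choose $5+m+r$ distinct matrices $P,Q,B,B',E,T_1,\dots,T_m,Z_1,\dots,Z_r$ in $\mathcal A_g$, where $T_i$ corresponds to $v_i$ and $Z_p$ corresponds to the label $s(Z_p)\in X\cup Y$, the $s(Z_p)$ being the $r$ distinct labels. Below $\circ$ is the $g\times g$ zero block and $L,R$ range over $\{B,B'\}$. * $\mathcal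 F_1$: all $(g+1)\times g$ and $g\times(g+1)$ matrices obtained by inserting a zero row or a zero column strictly inside a matrix of $\mathcal A_g$. * $\mathcal F_2$: all $(2g+1)\times(5g+1)$ and $(5g+1)\times(2g+1)$ partial patterns whose bottom left consecutive $g\times g$ submatrix is $B$ or $B'$ and whose top right consecutive $g\times g$ submatrix is some $T_j$. * $\mathcal F_3$: the four matrices given by $Q$ with $g+1$ zero rows below it, $P$ with $g+1$ zero rows above it, $Q$ with $g+1$ zero columns to its right, $P$ with $g+1$ zero columns to its left. * $\mathcal F_4=\mathcal W_1\cup\dots\cup\mathcal W_5$, where $\mathcal W_1,\mathcal W_2,\mathcal W_3$ consist of all matrices of the form, respectively, $$\begin{pmatrix}\circ&\circ&T_i&\circ&\circ&\circ&\circ&\circ\\ \circ&\circ&\circ&\circ&\circ&T_j&\circ&\circ\\ L&\circ&\circ&\circ&\circ&\circ&\circ&\circ\\ \circ&\circ&\circ&\circ&\circ&\circ&\circ&Z_p\\ \circ&\circ&\circ&\circ&\circ&\circ&T_k&\circ\\ \circ&B'&\circ&\circ&\circ&\circ&\circ&\circ\\ \circ&\circ&\circ&\circ&R&\circ&\circ&\circ\\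 \circ&\circ&\circ&Z_p&\circ&\circ&\circ&\circ\end{pmatrix},\quad \begin{pmatrix}\circ&\circ&\circ&\circ&Z_p&\circ&\circ&\circ\\ \circ&\circ&\circ&T_i&\circ&\circ&\circ&\circ\\ \circ&\circ&\circ&\circ&\circ&\circ&T_j&\circ\\ \circ&L&\circ&\circ&\circ&\circ&\circ&\circ\\ Z_p&\circ&\circ&\circ&\circ&\circ&\circ&\circ\\ \circ&\circ&\circ&\circ&\circ&\circ&\circ&T_k\\ \circ&\circ&B'&\circ&\circ&\circ&\circ&\circ\\ \circ&\circ&\circ&\circ&\circ&R&\circ&\circ\end{pmatrix},\quad \begin{pmatrix}\circ&\circ&T_i&\circ&\circ&\circ&\circ\\ \circ&\circ&\circ&\circ&\circ&T_j&\circ\\ L&\circ&\circ&\circ&\circ&\circ&\circ\\ \circ&\circ&\circ&E&\circ&\circ&\circ\\ \circ&\circ&\circ&\circ&\circ&\circ&T_k\\ \circ&B'&\circ&\circ&\circ&\circ&\circ\\ \circ&\circ&\circ&\circ&R&\circ&\circ\end{pmatrix}$$ with $v_i\to v_j\to v_k$ and, respectively, $\rho(v_j)=s(Z_p)$, $\rho(v_j)=s(Z_p)^{-1}$,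 $\rho(v_j)=\varepsilon$; and $\mathcal W_4,\mathcal W_5$ consist of all matrices of the form, respectively, $$\begin{pmatrix}\circ&\circ&\circ&\circ&T_1&\circ\\ \circ&P&\circ&\circ&\circ&\circ\\ \circ&\circ&E&\circ&\circ&\circ\\ \circ&\circ&\circ&\circ&\circ&T_k\\ B'&\circ&\circ&\circ&\circ&\circ\\ \circ&\circ&\circ&R&\circ&\circ\end{pmatrix}\ (v_1\to v_k),\qquad \begin{pmatrix}\circ&\circ&T_i&\circ&\circ&\circ\\ \circ&\circ&\circ&\circ&\circ&T_2\\ L&\circ&\circ&\circ&\circ&\circ\\ \circ&\circ&\circ&E&\circ&\circ\\ \circ&\circ&\circ&\circ&Q&\circ\\ \circ&B'&\circ&\circ&\circ&\circ\end{pmatrix}\ (v_i\to v_2).$$ * $\mathcal F_5$: all matrices of the form $$\begin{pmatrix}\circ&Z_p&\circ\\ \circ&\circ&Z_q\\ B&\circ&\circ\end{pmatrix},\quad \begin{pmatrix}\circ&Z_p&\circ\\ \circ&\circ&Z_q\\ B'&\circ&\circ\end{pmatrix},\quad \begin{pmatrix}\circ&\circ&T_j\\ Z_p&\circ&\circ\\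 \circ&Z_q&\circ\end{pmatrix}\qquad\text{with } s(Z_p)\sim s(Z_q)\ (p=q\text{ allowed}).$$ Put $\mathcal F=\mathcal F_1\cup\dots\cup\mathcal F_5$ and $\mathcal F'=\mathcal F\cup\{B,B'\}$. **Lemma.** Let $\Gamma$ be a two-stack automaton. 1. (Main Lemma) There are finite sets $\mathcal F,\mathcal F'$ of partial patterns and integers $c,d\ge1$ such that $C_{cn+d}(\mathcal F)-C_{cn+d}(\mathcal F')\equiv G(\Gamma,n)\pmod 2$ for all integers $n\ge 0$. 2. There is $g$ with $|\mathcal A_g|>5+m+r$, so that the choice in the construction is possible for this $g$. 3. (Explicit construction) For every $g$ and every choice of distinct matrices $P,Q,B,B',E,T_1,\dots,T_m,Z_1,\dots,Z_r\in\mathcal A_g$, the sets $\mathcal F$ and $\mathcal F'$ constructed above are finite sets of partial patterns, and $C_{(3n+2)g}(\mathcal F)-C_{(3n+2)g}(\mathcal F')\equiv G(\Gamma,n)\pmod 2$ for all integers $n\ge0$; that is, one may take $c=3g$ and $d=2g$. -/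

import Mathlib

namespace PatAvoid

/-! ### Matrices with entries 0 and 1, partial patterns, containment

The entry `1` is `true`, the entry `0` is `false`. -/

/-- A 0-1 matrix of arbitrary size. -/
structure ZeroOneMatrix where
  rows : ℕ
  cols : ℕ
  entry : Matrix (Fin rows) (Fin cols) Bool

/-- A partial pattern: every row and every column contains at most one `1`. -/
def ZeroOneMatrix.IsPartialPattern (K : ZeroOneMatrix) : Prop :=
  (∀ i j j', K.entry i j = true → K.entry i j' = true → j = j') ∧
  (∀ i i' j, K.entry i j = true → K.entry i' j = true → i = i')

/-- A permutation matrix: every row and every column contains exactly one `1`. -/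
def IsPermutationMatrix {n : ℕ} (M : Matrix (Fin n) (Fin n) Bool) : Prop :=
  (∀ i, ∃! j, M i j = true) ∧ (∀ j, ∃! i, M i j = true)

/-- `M` contains `K` if `K` can be obtained from `M` by deleting some rows and columns. -/
def Contains {n : ℕ} (M : Matrix (Fin n) (Fin n) Bool) (K : ZeroOneMatrix) : Prop :=
  ∃ (r : Fin K.rows ↪o Fin n) (c : Fin K.cols ↪o Fin n), M.submatrix r c = K.entry

/-- The number `C_n(F)` of `n × n` permutation matrices that avoid all elements of `F`. -/
noncomputable def avoidCount (F : Set ZeroOneMatrix) (n : ℕ) : ℕ :=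
  Set.ncard {M : Matrix (Fin n) (Fin n) Bool |
    IsPermutationMatrix M ∧ ∀ K ∈ F, ¬ Contains M K}

/-! ### Two-stack automata -/

inductive Stack
  | X
  | Y

/-- A vertex label: `push X i` is `x_i`, `push Y i` is `y_i`, `pop X i` is `x_i⁻¹`,
`pop Y i` is `y_i⁻¹`, and `eps` is the empty label. -/
inductive Label
  | eps
  | push (s : Stack) (i : ℤ)
  | pop (s : Stack) (i : ℤ)

/-- The stack on which a label acts. -/
def Label.stack : Label → Option Stack
  | .eps => none
  | .push s _ => some s
  | .pop s _ => some s

/-- `a ∼ b`: both labels lie in `X ∪ X⁻¹` or both lie in `Y ∪ Y⁻¹`. -/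
def Label.Similar (a b : Label) : Prop :=
  ∃ s : Stack, a.stack = some s ∧ b.stack = some s

/-- A two-stack automaton on the vertex set `V` (assumed finite where it is used), with the two
distinguished vertices `v₁ = start` and `v₂ = accept`. -/
structure TwoStackAutomaton (V : Type*) extends Digraph V where
  label : V → Label
  start : V
  accept : V
  start_ne_accept : start ≠ accept
  label_start : label start = .eps
  label_accept : label accept = .eps
  not_similar_of_adj : ∀ v w, Adj v w → ¬ (label v).Similar (label w)

/-- One step of the process that keeps track of the two words `(w_X, w_Y)`, upon entering a vertex
with the given label; `none` means that the step is not defined. A word is stored in reverse: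
the head of the list is the last letter of the word. -/
def stackStep : List ℤ × List ℤ → Label → Option (List ℤ × List ℤ)
  | w, .eps => some w
  | w, .push .X i => some (i :: w.1, w.2)
  | w, .push .Y i => some (w.1, i :: w.2)
  | w, .pop .X i => if w.1.head? = some i then some (w.1.tail, w.2) else none
  | w, .pop .Y i => if w.2.head? = some i then some (w.1, w.2.tail) else none

/-- A word of labels is balanced if, starting with two empty words, every step of the process is
defined and both words are empty at the end. -/
def IsBalanced (l : List Label) : Prop :=
  l.foldlM stackStep ([], []) = some ([], [])

/-- `G(Γ, n)`: the number of balanced paths `γ₁ … γₙ` (with `n` vertices) from `v₁` to `v₂`. -/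
noncomputable def TwoStackAutomaton.balancedCount {V : Type*} (Γ : TwoStackAutomaton V) (n : ℕ) :
    ℕ :=
  Set.ncard {γ : List V |
    γ.length = n ∧ γ.IsChain Γ.Adj ∧ γ.head? = some Γ.start ∧ γ.getLast? = some Γ.accept ∧
      IsBalanced (γ.map Γ.label)}

/-- The letters of `X ∪ Y` that occur as labels of vertices of `Γ`; their number is `r`. -/
def TwoStackAutomaton.Letter {V : Type*} (Γ : TwoStackAutomaton V) : Type :=
  {a : Stack × ℤ // ∃ v, Γ.label v = .push a.1 a.2}

/-! ### The alphabet -/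

/-- A permutation matrix is simple if no submatrix consisting of `k` consecutive rows and `k`
consecutive columns, with `1 < k < g`, is a permutation matrix. -/
def IsSimple {g : ℕ} (A : Matrix (Fin g) (Fin g) Bool) : Prop :=
  IsPermutationMatrix A ∧
  ∀ (k a b : ℕ) (ha : a + k ≤ g) (hb : b + k ≤ g), 1 < k → k < g →
    ¬ IsPermutationMatrix (fun i j : Fin k =>
        A ⟨a + i, by have := i.2; omega⟩ ⟨b + j, by have := j.2; omega⟩)

/-- The 7 × 7 matrix
```
0 0 0 0 1 0 0
0 0 0 0 0 1 0
0 0 0 0 0 0 1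
0 0 0 1 0 0 0
1 0 0 0 0 0 0
0 1 0 0 0 0 0
0 0 1 0 0 0 0
```
given by the positions of the ones in its rows, counted from `0`. -/
def matrixL : ZeroOneMatrix where
  rows := 7
  cols := 7
  entry := fun i j => decide (j = (![4, 5, 6, 3, 0, 1, 2] : Fin 7 → Fin 7) i)

/-- The alphabet `𝒜_g`: all `g × g` simple permutation matrices that contain `matrixL`. -/
def alphabet (g : ℕ) : Set (Matrix (Fin g) (Fin g) Bool) :=
  {A | IsSimple A ∧ Contains A matrixL}

/-- The names of the `5 + m + r` matrices to be chosen from the alphabet: `P, Q, B, B', E`, one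
`T v` for every vertex `v`, and one `Z p` for every letter `p`. -/
inductive Block (V ι : Type*)
  | P
  | Q
  | B
  | B'
  | E
  | T (v : V)
  | Z (p : ι)

/-- The name is `B` or `B'`. -/
def Block.IsB {V ι : Type*} (s : Block V ι) : Prop := s = .B ∨ s = .B'

/-! ### The forbidden patterns -/

/-- The `g × g` zero block. -/
def O {g : ℕ} : Matrix (Fin g) (Fin g) Bool := fun _ _ => false

/-- The matrix made of `k × l` blocks of size `g × g`. -/
def blockMatrix {g k l : ℕ} (t : Matrix (Fin k) (Fin l) (Matrix (Fin g) (Fin g) Bool)) :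
    ZeroOneMatrix where
  rows := k * g
  cols := l * g
  entry := fun i j => t i.divNat j.divNat i.modNat j.modNat

/-- The block `A` occurs in `K` in consecutive rows and columns, the first of which have the
indices `a` and `b` (counted from `0`). -/
def ZeroOneMatrix.HasBlockAt (K : ZeroOneMatrix) (a b : ℕ) {g : ℕ}
    (A : Matrix (Fin g) (Fin g) Bool) : Prop :=
  ∀ i j : Fin g, ∃ (hi : a + i < K.rows) (hj : b + j < K.cols),
    K.entry ⟨a + i, hi⟩ ⟨b + j, hj⟩ = A i j

/-- `F₁`: a zero row or a zero column is inserted strictly inside a matrix of the alphabet. -/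
def F1 (g : ℕ) : Set ZeroOneMatrix :=
  {K | ∃ A ∈ alphabet g, ∃ a : Fin (g + 1), 0 < (a : ℕ) ∧ (a : ℕ) < g ∧
    (K = ⟨g + 1, g, Fin.insertNth (α := fun _ => Fin g → Bool) a (fun _ => false) A⟩ ∨
     K = ⟨g, g + 1, fun i => Fin.insertNth (α := fun _ => Bool) a false (A i)⟩)}

section

variable {V : Type*} (Γ : TwoStackAutomaton V) {g : ℕ}
  (A : Block V Γ.Letter → Matrix (Fin g) (Fin g) Bool)

/-- `F₂`: partial patterns of the two given sizes with `B` or `B'` in the bottom left corner and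
some `T v` in the top right corner. -/
def F2 : Set ZeroOneMatrix :=
  {K | K.IsPartialPattern ∧
    ((K.rows = 2 * g + 1 ∧ K.cols = 5 * g + 1) ∨ (K.rows = 5 * g + 1 ∧ K.cols = 2 * g + 1)) ∧
    (∃ s : Block V Γ.Letter, s.IsB ∧ K.HasBlockAt (K.rows - g) 0 (A s)) ∧
    (∃ v : V, K.HasBlockAt 0 (K.cols - g) (A (.T v)))}

/-- `F₃`: `g + 1` zero rows below `Q`, `g + 1` zero rows above `P`, `g + 1` zero columns to the
right of `Q`, `g + 1` zero columns to the left of `P`. -/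
def F3 : Set ZeroOneMatrix :=
  {⟨g + (g + 1), g, Fin.append (A .Q) (fun _ _ => false)⟩,
   ⟨(g + 1) + g, g, Fin.append (fun _ _ => false) (A .P)⟩,
   ⟨g, g + (g + 1), fun i => Fin.append (A .Q i) (fun _ => false)⟩,
   ⟨g, (g + 1) + g, fun i => Fin.append (fun _ => false) (A .P i)⟩}

open Block in
/-- `W₁`: a path `i → j → k` in which `j` is labelled by a letter `p` of `X ∪ Y`. -/
def W1 : Set ZeroOneMatrix :=
  {K | ∃ (i j k : V) (p : Γ.Letter) (L R : Block V Γ.Letter), L.IsB ∧ R.IsB ∧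
    Γ.Adj i j ∧ Γ.Adj j k ∧ Γ.label j = .push p.1.1 p.1.2 ∧
    K = blockMatrix !![
      O, O, A (T i), O, O, O, O, O;
      O, O, O, O, O, A (T j), O, O;
      A L, O, O, O, O, O, O, O;
      O, O, O, O, O, O, O, A (Z p);
      O, O, O, O, O, O, A (T k), O;
      O, A B', O, O, O, O, O, O;
      O, O, O, O, A R, O, O, O;
      O, O, O, A (Z p), O, O, O, O]}

open Block in
/-- `W₂`: a path `i → j → k` in which `j` is labelled by the inverse of a letter `p`. -/
def W2 : Set ZeroOneMatrix :=
  {K | ∃ (i j k : V) (p : Γ.Letter) (L R : Block V Γ.Letter), L.IsB ∧ R.IsB ∧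
    Γ.Adj i j ∧ Γ.Adj j k ∧ Γ.label j = .pop p.1.1 p.1.2 ∧
    K = blockMatrix !![
      O, O, O, O, A (Z p), O, O, O;
      O, O, O, A (T i), O, O, O, O;
      O, O, O, O, O, O, A (T j), O;
      O, A L, O, O, O, O, O, O;
      A (Z p), O, O, O, O, O, O, O;
      O, O, O, O, O, O, O, A (T k);
      O, O, A B', O, O, O, O, O;
      O, O, O, O, O, A R, O, O]}

open Block in
/-- `W₃`: a path `i → j → k` in which `j` has the empty label. -/
def W3 : Set ZeroOneMatrix :=
  {K | ∃ (i j k : V) (L R : Block V Γ.Letter), L.IsB ∧ R.IsB ∧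
    Γ.Adj i j ∧ Γ.Adj j k ∧ Γ.label j = .eps ∧
    K = blockMatrix !![
      O, O, A (T i), O, O, O, O;
      O, O, O, O, O, A (T j), O;
      A L, O, O, O, O, O, O;
      O, O, O, A E, O, O, O;
      O, O, O, O, O, O, A (T k);
      O, A B', O, O, O, O, O;
      O, O, O, O, A R, O, O]}

open Block in
/-- `W₄`: an edge `v₁ → k`. -/
def W4 : Set ZeroOneMatrix :=
  {K | ∃ (k : V) (R : Block V Γ.Letter), R.IsB ∧ Γ.Adj Γ.start k ∧
    K = blockMatrix !![
      O, O, O, O, A (T Γ.start), O;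
      O, A P, O, O, O, O;
      O, O, A E, O, O, O;
      O, O, O, O, O, A (T k);
      A B', O, O, O, O, O;
      O, O, O, A R, O, O]}

open Block in
/-- `W₅`: an edge `i → v₂`. -/
def W5 : Set ZeroOneMatrix :=
  {K | ∃ (i : V) (L : Block V Γ.Letter), L.IsB ∧ Γ.Adj i Γ.accept ∧
    K = blockMatrix !![
      O, O, A (T i), O, O, O;
      O, O, O, O, O, A (T Γ.accept);
      A L, O, O, O, O, O;
      O, O, O, A E, O, O;
      O, O, O, O, A Q, O;
      O, A B', O, O, O, O]}

/-- `F₄ = W₁ ∪ W₂ ∪ W₃ ∪ W₄ ∪ W₅`. -/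
def F4 : Set ZeroOneMatrix := W1 Γ A ∪ W2 Γ A ∪ W3 Γ A ∪ W4 Γ A ∪ W5 Γ A

open Block in
/-- `F₅`; two letters are similar exactly when they belong to the same stack. -/
def F5 : Set ZeroOneMatrix :=
  {K | ∃ p q : Γ.Letter, (Label.push p.1.1 p.1.2).Similar (Label.push q.1.1 q.1.2) ∧
    ((∃ s : Block V Γ.Letter, s.IsB ∧
        K = blockMatrix !![
          O, A (Z p), O;
          O, O, A (Z q);
          A s, O, O]) ∨
     (∃ j : V,
        K = blockMatrix !![
          O, O, A (T j);
          A (Z p), O, O;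
          O, A (Z q), O]))}

/-- `F = F₁ ∪ F₂ ∪ F₃ ∪ F₄ ∪ F₅`. -/
def forbidden : Set ZeroOneMatrix := F1 g ∪ F2 Γ A ∪ F3 Γ A ∪ F4 Γ A ∪ F5 Γ A

/-- `F' = F ∪ {B, B'}`. -/
def forbidden' : Set ZeroOneMatrix :=
  forbidden Γ A ∪ {⟨g, g, A .B⟩, ⟨g, g, A .B'⟩}

end

end PatAvoid

/-!
The forbidden set `F` forces a permutation matrix to be organized in `g × g` blocks taken from the
chosen matrices of the alphabet. Since these matrices are simple and `F₁` forbids every occurrence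
of them that is spread out, a matrix of the alphabet occurs in consecutive rows and columns only,
and two such blocks never share a row or a column. The other conditions therefore only concern the
positions of the blocks (`avoids_forbidden_iff`).

*Parity.* The difference of the two numbers counts the matrices that avoid `F` and contain a block
`B` or `B'`. In `F₄` only one block is required to be `B'`; the other blocks that may be `B` or `B'`
can be either. Hence a block `B` or `B'` which is not the distinguished one of a configuration from
`F₄`, disregarding the difference between `B` and `B'`, may be exchanged freely, while a
distinguished one (a *blocked* one) has to be `B`. Exchanging one of the free blocks, chosen by a
rule that only depends on the set of the free blocks, is an involution without fixed points on the
matrices that have free blocks. So modulo 2 only the matrices count in which every block `B` is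
blocked (`ncard_valid_modEq`).

*From matrices to paths.* In such a matrix the leftmost block `B` can only be blocked by a
configuration from `W₄`. The conditions on `P` and the distance condition of `F₂` leave no space
between its blocks, so they occupy the beginning of the matrix, and they contain the block `B` of
the next step, which is blocked in turn by a configuration from `W₁`, `W₂`, `W₃` or `W₅`. Reading
the matrix in this manner gives a path that ends with `W₅`, where the conditions on `Q` fix the size
of the matrix to `(3n + 2)g`. The blocks `Z p` and `E` define a permutation of the steps that maps
pushes to later pops and pops to earlier pushes of the same letter, and `F₅` says that it has no
crossings (`BlockSystem.exists_layout`). Such a permutation exists exactly for the balanced paths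
and is unique (`isBalanced_iff`, `Pairing.unique`).

*From paths to matrices.* Conversely the block matrix of a balanced path contains a matrix of the
alphabet only in its blocks: any other occurrence would meet every block in at most one entry, so
that the permutation of the blocks would contain `matrixL`, which is impossible since on either
side of the diagonal there are only the blocks of two stacks and one diagonal of further blocks
(`Pairing.no_three_upper`, `occ_layoutMatrix`). It avoids `F`, and all its blocks `B` are blocked
(`valid_layoutMatrix`).

*The size of the alphabet.* Inserting a new first column with its one in a new row keeps a simple
matrix simple, except for at most four choices of the row. The number of simple matrices that
contain `matrixL` is therefore unbounded (`le_ncard_alphabet_succ`).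
-/

namespace PatAvoid

/-! ### Permutation matrices as relations on the natural numbers -/

/-- The entry of `M` in row `a` and column `b` is a `1`. Indices are natural numbers, so that
rows and columns can be shifted freely; outside of the matrix there are no ones. -/
def One {m n : ℕ} (M : Matrix (Fin m) (Fin n) Bool) (a b : ℕ) : Prop :=
  ∃ (ha : a < m) (hb : b < n), M ⟨a, ha⟩ ⟨b, hb⟩ = true

/-- `R` is the graph of a permutation of `{0, …, N - 1}`. -/
structure IsPermRel (N : ℕ) (R : ℕ → ℕ → Prop) : Prop where
  lt_row : ∀ {a b}, R a b → a < N
  lt_col : ∀ {a b}, R a b → b < N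
  exists_col : ∀ {a}, a < N → ∃ b, R a b
  exists_row : ∀ {b}, b < N → ∃ a, R a b
  col_unique : ∀ {a b b'}, R a b → R a b' → b = b'
  row_unique : ∀ {a a' b}, R a b → R a' b → a = a'

theorem IsPermRel.transpose {N : ℕ} {R : ℕ → ℕ → Prop} (h : IsPermRel N R) :
    IsPermRel N (fun a b => R b a) :=
  ⟨h.lt_col, h.lt_row, h.exists_row, h.exists_col, h.row_unique, h.col_unique⟩

theorem one_fin {m n : ℕ} {M : Matrix (Fin m) (Fin n) Bool} {i : Fin m} {j : Fin n} :
    One M i j ↔ M i j = true :=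
  ⟨fun ⟨_, _, h⟩ => h, fun h => ⟨i.2, j.2, h⟩⟩

theorem one_mk {m n i j : ℕ} {M : Matrix (Fin m) (Fin n) Bool} (hi : i < m) (hj : j < n) :
    One M i j ↔ M ⟨i, hi⟩ ⟨j, hj⟩ = true :=
  ⟨fun ⟨_, _, h⟩ => h, fun h => ⟨hi, hj, h⟩⟩

theorem isPermutationMatrix_iff {n : ℕ} {M : Matrix (Fin n) (Fin n) Bool} :
    IsPermutationMatrix M ↔ IsPermRel n (One M) := by
  constructor
  · rintro ⟨h1, h2⟩
    refine ⟨fun ⟨h, _, _⟩ => h, fun ⟨_, h, _⟩ => h, ?_, ?_, ?_, ?_⟩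
    · intro a ha
      obtain ⟨b, hb, _⟩ := h1 ⟨a, ha⟩
      exact ⟨b, ha, b.2, hb⟩
    · intro b hb
      obtain ⟨a, ha, _⟩ := h2 ⟨b, hb⟩
      exact ⟨a, a.2, hb, ha⟩
    · rintro a b b' ⟨ha, hb, h⟩ ⟨_, hb', h'⟩
      exact congrArg Fin.val ((h1 ⟨a, ha⟩).unique h h')
    · rintro a a' b ⟨ha, hb, h⟩ ⟨ha', _, h'⟩
      exact congrArg Fin.val ((h2 ⟨b, hb⟩).unique h h')
  · intro h
    refine ⟨fun i => ?_, fun j => ?_⟩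
    · obtain ⟨b, hb⟩ := h.exists_col i.2
      refine ⟨⟨b, h.lt_col hb⟩, hb.2.2, fun j hj => ?_⟩
      exact Fin.ext (h.col_unique (one_fin.2 hj) hb)
    · obtain ⟨b, hb⟩ := h.exists_row j.2
      refine ⟨⟨b, h.lt_row hb⟩, hb.2.2, fun i hi => ?_⟩
      exact Fin.ext (h.row_unique (one_fin.2 hi) hb)

theorem matrix_ext_one {m n : ℕ} {M M' : Matrix (Fin m) (Fin n) Bool}
    (h : ∀ a b, One M a b ↔ One M' a b) : M = M' := by
  ext i j
  have := h i j
  rw [one_fin, one_fin] at this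
  exact Bool.eq_iff_iff.2 this

/-- `f` is strictly increasing on `{0, …, n - 1}`. -/
def IncrOn (n : ℕ) (f : ℕ → ℕ) : Prop := ∀ i j, i < j → j < n → f i < f j

theorem IncrOn.lt_iff {n : ℕ} {f : ℕ → ℕ} (h : IncrOn n f) {i j : ℕ} (hi : i < n) (hj : j < n) :
    f i < f j ↔ i < j := by
  constructor
  · intro hf
    by_contra hc
    rcases Nat.eq_or_lt_of_le (not_lt.1 hc) with rfl | h'
    · omega
    · have := h j i h' hi; omega
  · exact fun h' => h i j h' hj

theorem IncrOn.inj {n : ℕ} {f : ℕ → ℕ} (h : IncrOn n f) {i j : ℕ} (hi : i < n) (hj : j < n)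
    (hf : f i = f j) : i = j := by
  rcases lt_trichotomy i j with h' | h' | h'
  · have := h i j h' hj; omega
  · exact h'
  · have := h j i h' hi; omega

theorem IncrOn.add_le {n : ℕ} {f : ℕ → ℕ} (h : IncrOn n f) {i j : ℕ} (hij : i ≤ j) (hj : j < n) :
    f i + (j - i) ≤ f j := by
  induction j, hij using Nat.le_induction with
  | base => simp
  | succ k hk ih =>
    have := ih (by omega)
    have := h k (k + 1) (by omega) hj
    omega

theorem IncrOn.threshold {n : ℕ} {f : ℕ → ℕ} (h : IncrOn n f) (a : ℕ) :
    ∃ p ≤ n, ∀ i < n, f i < a ↔ i < p := by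
  induction n with
  | zero => exact ⟨0, le_rfl, by simp⟩
  | succ n ih =>
    obtain ⟨p, hp, hq⟩ := ih (fun i j hij hj => h i j hij (by omega))
    by_cases hn : f n < a
    · refine ⟨n + 1, le_rfl, fun i hi => ⟨fun _ => hi, fun _ => ?_⟩⟩
      have := h.add_le (i := i) (j := n) (by omega) (by omega)
      omega
    · refine ⟨p, by omega, fun i hi => ?_⟩
      rcases Nat.lt_succ_iff_lt_or_eq.1 hi with hi | rfl
      · exact hq i hi
      · constructor
        · intro; omega
        · intro; omega

/-- `X` is the submatrix of the relation `R` with rows `r 0 < r 1 < ⋯` and columns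
`c 0 < c 1 < ⋯`. -/
structure Occ (R : ℕ → ℕ → Prop) {m n : ℕ} (X : Matrix (Fin m) (Fin n) Bool) (r c : ℕ → ℕ) :
    Prop where
  incr_row : IncrOn m r
  incr_col : IncrOn n c
  iff : ∀ i < m, ∀ j < n, R (r i) (c j) ↔ One X i j

/-- The matrix `X` occurs in the relation `R` in consecutive rows and columns, starting with row
`a` and column `b`. -/
def Blk (R : ℕ → ℕ → Prop) {m n : ℕ} (a b : ℕ) (X : Matrix (Fin m) (Fin n) Bool) : Prop :=
  ∀ i < m, ∀ j < n, R (a + i) (b + j) ↔ One X i j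

theorem Blk.occ {R : ℕ → ℕ → Prop} {m n a b : ℕ} {X : Matrix (Fin m) (Fin n) Bool}
    (h : Blk R a b X) : Occ R X (a + ·) (b + ·) :=
  ⟨fun i j hij _ => by simpa using hij, fun i j hij _ => by simpa using hij, h⟩

theorem Occ.blk {R : ℕ → ℕ → Prop} {m n : ℕ} {X : Matrix (Fin m) (Fin n) Bool} {r c : ℕ → ℕ}
    (h : Occ R X r c) (hr : ∀ i < m, r i = r 0 + i) (hc : ∀ j < n, c j = c 0 + j) :
    Blk R (r 0) (c 0) X := by
  intro i hi j hj
  rw [← hr i hi, ← hc j hj]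
  exact h.iff i hi j hj

theorem contains_iff {n : ℕ} {M : Matrix (Fin n) (Fin n) Bool} {K : ZeroOneMatrix} :
    Contains M K ↔ ∃ r c : ℕ → ℕ, Occ (One M) K.entry r c ∧ (∀ i < K.rows, r i < n) ∧
      (∀ j < K.cols, c j < n) := by
  constructor
  · rintro ⟨r, c, h⟩
    refine ⟨fun i => if hi : i < K.rows then r ⟨i, hi⟩ else 0,
      fun j => if hj : j < K.cols then c ⟨j, hj⟩ else 0, ⟨?_, ?_, ?_⟩, ?_, ?_⟩
    · intro i j hij hj
      simp only [hj, hij.trans hj, dif_pos]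
      exact r.strictMono hij
    · intro i j hij hj
      simp only [hj, hij.trans hj, dif_pos]
      exact c.strictMono hij
    · intro i hi j hj
      simp only [hi, hj, dif_pos, one_fin]
      rw [← Matrix.submatrix_apply M r c, h]
      exact (one_mk hi hj).symm
    · intro i hi
      simp [hi]
    · intro i hi
      simp [hi]
  · rintro ⟨r, c, ⟨hr, hc, h⟩, hr', hc'⟩
    refine ⟨OrderEmbedding.ofStrictMono (fun i => ⟨r i, hr' i i.2⟩) (fun i j hij => hr i j hij j.2),
      OrderEmbedding.ofStrictMono (fun i => ⟨c i, hc' i i.2⟩) (fun i j hij => hc i j hij j.2), ?_⟩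
    ext i j
    have := h i i.2 j j.2
    rw [one_fin] at this
    rw [Bool.eq_iff_iff, ← this]
    exact (one_mk (hr' i i.2) (hc' j j.2)).symm

theorem Occ.row_lt {N g : ℕ} {R : ℕ → ℕ → Prop} {X : Matrix (Fin g) (Fin g) Bool} {r c : ℕ → ℕ}
    (hR : IsPermRel N R) (hX : IsPermRel g (One X)) (h : Occ R X r c) {i : ℕ} (hi : i < g) :
    r i < N := by
  obtain ⟨j, hj⟩ := hX.exists_col hi
  exact hR.lt_row ((h.iff i hi j (hX.lt_col hj)).2 hj)

theorem Occ.col_lt {N g : ℕ} {R : ℕ → ℕ → Prop} {X : Matrix (Fin g) (Fin g) Bool} {r c : ℕ → ℕ}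
    (hR : IsPermRel N R) (hX : IsPermRel g (One X)) (h : Occ R X r c) {i : ℕ} (hi : i < g) :
    c i < N := by
  obtain ⟨j, hj⟩ := hX.exists_row hi
  exact hR.lt_col ((h.iff j (hX.lt_row hj) i hi).2 hj)

/-- By injectivity, an interval of rows is not mapped into a shorter interval of columns. -/
theorem IsPermRel.interval_le {N p k q l : ℕ} {R : ℕ → ℕ → Prop} (hR : IsPermRel N R)
    (hp : p + k ≤ N) (h : ∀ i j, R i j → p ≤ i → i < p + k → q ≤ j ∧ j < q + l) : k ≤ l := by
  choose! f hf using fun a (ha : a < N) => hR.exists_col ha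
  have := Finset.card_le_card_of_injOn (s := Finset.Ico p (p + k)) (t := Finset.Ico q (q + l)) f
    (fun i hi => by
      simp only [Finset.coe_Ico, Set.mem_Ico] at hi ⊢
      exact h i (f i) (hf i (by omega)) hi.1 hi.2)
    (fun i hi j hj hij => by
      simp only [Finset.coe_Ico, Set.mem_Ico] at hi hj
      exact hR.row_unique (hf i (by omega)) (hij ▸ hf j (by omega)))
  simpa using this

/-! ### Simple permutation matrices -/

theorem IsSimple.permRel {g : ℕ} {X : Matrix (Fin g) (Fin g) Bool} (h : IsSimple X) :
    IsPermRel g (One X) := isPermutationMatrix_iff.1 h.1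

/-- A simple permutation matrix maps no interval of rows onto an interval of columns, except for
the trivial ones. -/
theorem IsSimple.interval {g : ℕ} {X : Matrix (Fin g) (Fin g) Bool} (h : IsSimple X)
    {p q k : ℕ} (hp : p + k ≤ g) (hq : q + k ≤ g)
    (hX : ∀ i j, One X i j → (p ≤ i ∧ i < p + k ↔ q ≤ j ∧ j < q + k)) : k ≤ 1 ∨ k = g := by
  by_contra hc
  push Not at hc
  refine h.2 k p q hp hq (by omega) (by omega) ?_
  have hP := h.permRel
  refine ⟨fun i => ?_, fun j => ?_⟩
  · obtain ⟨b, hb⟩ := hP.exists_col (a := p + i) (by omega)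
    have := (hX _ _ hb).1 (by omega)
    refine ⟨⟨b - q, by omega⟩, ?_, fun j hj => ?_⟩
    · have hb' : One X (p + i) (q + (b - q)) := by
        rwa [show q + (b - q) = b by omega]
      exact hb'.2.2
    · have : q + j = b := hP.col_unique (a := p + i) ⟨by omega, by omega, hj⟩ hb
      exact Fin.ext (by simp; omega)
  · obtain ⟨b, hb⟩ := hP.exists_row (b := q + j) (by omega)
    have := (hX _ _ hb).2 (by omega)
    refine ⟨⟨b - p, by omega⟩, ?_, fun i hi => ?_⟩
    · have hb' : One X (p + (b - p)) (q + j) := by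
        rwa [show p + (b - p) = b by omega]
      exact hb'.2.2
    · have : p + i = b := hP.row_unique (b := q + j) ⟨by omega, by omega, hi⟩ hb
      exact Fin.ext (by simp; omega)

/-- A one in a corner would leave an interval of length `g - 1`. -/
theorem IsSimple.no_corner {g : ℕ} {X : Matrix (Fin g) (Fin g) Bool} (h : IsSimple X)
    (hg : 3 ≤ g) {i j : ℕ} (hi : i = 0 ∨ i = g - 1) (hj : j = 0 ∨ j = g - 1) : ¬ One X i j := by
  intro h1
  have hP := h.permRel
  have key := h.interval (p := if i = 0 then 1 else 0) (q := if j = 0 then 1 else 0) (k := g - 1)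
    (by split_ifs <;> omega) (by split_ifs <;> omega) (by
      intro i' j' h'
      have h1' := hP.lt_row h'
      have h2' := hP.lt_col h'
      have : i' = i ↔ j' = j := by
        constructor
        · rintro rfl; exact hP.col_unique h' h1
        · rintro rfl; exact hP.row_unique h' h1
      split_ifs <;> omega)
  omega

/-- An occurrence of a simple matrix meets a square block that is a permutation matrix in at most
one entry, unless it is that block: the rows of the occurrence that meet the block form an interval,
which the simple matrix maps onto the interval of the columns that meet the block. -/
theorem Occ.inter_block {g a b : ℕ} {R : ℕ → ℕ → Prop} {X : Matrix (Fin g) (Fin g) Bool}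
    {r c : ℕ → ℕ} (hX : IsSimple X) (h : Occ R X r c)
    (hb : ∀ i j, R i j → (a ≤ i ∧ i < a + g ↔ b ≤ j ∧ j < b + g)) :
    ((∀ i < g, ∀ i' < g, a ≤ r i → r i < a + g → a ≤ r i' → r i' < a + g → i = i') ∧
      (∀ i < g, ∀ i' < g, b ≤ c i → c i < b + g → b ≤ c i' → c i' < b + g → i = i')) ∨
    (∀ i < g, r i = a + i ∧ c i = b + i) := by
  have hP := hX.permRel
  obtain ⟨p, hp, hp'⟩ := h.incr_row.threshold a
  obtain ⟨p1, hp1, hp1'⟩ := h.incr_row.threshold (a + g)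
  obtain ⟨q, hq, hq'⟩ := h.incr_col.threshold b
  obtain ⟨q1, hq1, hq1'⟩ := h.incr_col.threshold (b + g)
  have hpp : p ≤ p1 := by
    by_contra hc
    have := hp' p1 (by omega); have := hp1' p1 (by omega); omega
  have hqq : q ≤ q1 := by
    by_contra hc
    have := hq' q1 (by omega); have := hq1' q1 (by omega); omega
  have hI : ∀ i j, One X i j → (p ≤ i ∧ i < p + (p1 - p) ↔ q ≤ j ∧ j < q + (q1 - q)) := by
    intro i j hij
    have hi := hP.lt_row hij
    have hj := hP.lt_col hij
    have := hb _ _ ((h.iff i hi j hj).2 hij)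
    have := hp' i hi; have := hp1' i hi; have := hq' j hj; have := hq1' j hj
    omega
  have e : p1 - p = q1 - q := by
    apply le_antisymm
    · exact hP.interval_le (p := p) (q := q) (by omega) (fun i j hij h1 h2 => (hI i j hij).1 ⟨h1, h2⟩)
    · exact hP.transpose.interval_le (p := q) (q := p) (by omega)
        (fun i j hij h1 h2 => (hI j i hij).2 ⟨h1, h2⟩)
  rcases hX.interval (p := p) (q := q) (k := p1 - p) (by omega) (by omega)
    (by rw [e] at hI ⊢; exact hI) with hk | hk
  · left
    constructor
    · intro i hi i' hi' _ _ _ _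
      have := hp' i hi; have := hp1' i hi; have := hp' i' hi'; have := hp1' i' hi'
      omega
    · intro i hi i' hi' _ _ _ _
      have := hq' i hi; have := hq1' i hi; have := hq' i' hi'; have := hq1' i' hi'
      omega
  · right
    intro i hi
    have e1 := h.incr_row.add_le (i := 0) (j := i) (by omega) hi
    have e2 := h.incr_row.add_le (i := i) (j := g - 1) (by omega) (by omega)
    have e3 := h.incr_col.add_le (i := 0) (j := i) (by omega) hi
    have e4 := h.incr_col.add_le (i := i) (j := g - 1) (by omega) (by omega)
    have := hp' 0 (by omega); have := hp1' (g - 1) (by omega)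
    have := hq' 0 (by omega); have := hq1' (g - 1) (by omega)
    omega

theorem Blk.interval {N g a b : ℕ} {R : ℕ → ℕ → Prop} {X : Matrix (Fin g) (Fin g) Bool}
    (hR : IsPermRel N R) (hX : IsPermRel g (One X)) (h : Blk R a b X) {i j : ℕ} (hij : R i j) :
    a ≤ i ∧ i < a + g ↔ b ≤ j ∧ j < b + g := by
  constructor
  · rintro ⟨h1, h2⟩
    obtain ⟨j', hj'⟩ := hX.exists_col (a := i - a) (by omega)
    have := (h _ (by omega) _ (hX.lt_col hj')).2 hj'
    rw [show a + (i - a) = i by omega] at this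
    have e := hR.col_unique this hij
    have := hX.lt_col hj'
    omega
  · rintro ⟨h1, h2⟩
    obtain ⟨j', hj'⟩ := hX.exists_row (b := j - b) (by omega)
    have := (h _ (hX.lt_row hj') _ (by omega)).2 hj'
    rw [show b + (j - b) = j by omega] at this
    have e := hR.row_unique this hij
    have := hX.lt_row hj'
    omega

theorem Blk.bounds {N g a b : ℕ} {R : ℕ → ℕ → Prop} {X : Matrix (Fin g) (Fin g) Bool}
    (hR : IsPermRel N R) (hX : IsPermRel g (One X)) (hg : 0 < g) (h : Blk R a b X) :
    a + g ≤ N ∧ b + g ≤ N := by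
  have h1 := h.occ.row_lt hR hX (i := g - 1) (by omega)
  have h2 := h.occ.col_lt hR hX (i := g - 1) (by omega)
  omega

/-- Two blocks that are simple permutation matrices and share a row coincide. -/
theorem Blk.eq_of_row {N g a b a' b' : ℕ} {R : ℕ → ℕ → Prop} {X X' : Matrix (Fin g) (Fin g) Bool}
    (hR : IsPermRel N R) (hX : IsSimple X) (hX' : IsSimple X') (hg : 3 ≤ g)
    (h : Blk R a b X) (h' : Blk R a' b' X') (h1 : a < a' + g) (h2 : a' < a + g) :
    a = a' ∧ b = b' := by
  have key := h'.occ.inter_block hX' (fun i j hij => h.interval hR hX.permRel hij)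
  have hP := hX'.permRel
  rcases key with ⟨kr, kc⟩ | key
  · exfalso
    -- the only row of the second block that meets the first one is its first or its last row
    obtain ⟨i, hi, hi'⟩ : ∃ i, (i = 0 ∨ i = g - 1) ∧ a ≤ a' + i ∧ a' + i < a + g := by
      by_cases hc : a ≤ a'
      · exact ⟨0, by omega, by omega, by omega⟩
      · exact ⟨g - 1, by omega, by omega, by omega⟩
    have hig : i < g := by omega
    obtain ⟨j, hj⟩ := hP.exists_col hig
    have hjg := hP.lt_col hj
    have hb := (h.interval hR hX.permRel ((h' i hig j hjg).2 hj)).1 hi'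
    refine hX'.no_corner hg hi ?_ hj
    by_contra hc
    have e1 := kc j hjg (j + 1) (by omega) hb.1 hb.2
    have e2 := kc j hjg (j - 1) (by omega) hb.1 hb.2
    omega
  · have := key 0 (by omega)
    omega

/-- Two blocks that are simple permutation matrices and share a column coincide. -/
theorem Blk.eq_of_col {N g a b a' b' : ℕ} {R : ℕ → ℕ → Prop} {X X' : Matrix (Fin g) (Fin g) Bool}
    (hR : IsPermRel N R) (hX : IsSimple X) (hX' : IsSimple X') (hg : 3 ≤ g)
    (h : Blk R a b X) (h' : Blk R a' b' X') (h1 : b < b' + g) (h2 : b' < b + g) :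
    a = a' ∧ b = b' := by
  -- a common column contains a one, whose row is common as well
  have hP := hX.permRel
  obtain ⟨y, hy1, hy2, hy3, hy4⟩ : ∃ y, b ≤ y ∧ y < b + g ∧ b' ≤ y ∧ y < b' + g :=
    ⟨max b b', by omega, by omega, by omega, by omega⟩
  obtain ⟨i, hi⟩ := hP.exists_row (b := y - b) (by omega)
  have hi' := (h i (hP.lt_row hi) _ (by omega)).2 hi
  rw [show b + (y - b) = y by omega] at hi'
  have k1 := (h.interval hR hP hi').2 ⟨hy1, hy2⟩
  have k2 := (h'.interval hR hX'.permRel hi').2 ⟨hy3, hy4⟩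
  exact h.eq_of_row hR hX hX' hg h' (by omega) (by omega)

theorem Blk.matrix_eq {m n a b : ℕ} {R : ℕ → ℕ → Prop} {X X' : Matrix (Fin m) (Fin n) Bool}
    (h : Blk R a b X) (h' : Blk R a b X') : X = X' := by
  refine matrix_ext_one fun i j => ?_
  by_cases hi : i < m ∧ j < n
  · rw [← h i hi.1 j hi.2, h' i hi.1 j hi.2]
  · exact ⟨fun ⟨x, y, _⟩ => absurd ⟨x, y⟩ hi, fun ⟨x, y, _⟩ => absurd ⟨x, y⟩ hi⟩

theorem seven_le_of_mem_alphabet {g : ℕ} {X : Matrix (Fin g) (Fin g) Bool}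
    (h : X ∈ alphabet g) : 7 ≤ g := by
  obtain ⟨-, r, -, -⟩ := h
  have := Fintype.card_le_of_injective r r.injective
  rwa [Fintype.card_fin, Fintype.card_fin] at this

/-! ### Occurrences of the alphabet are consecutive -/

/-- Every occurrence in `R` of a matrix of the alphabet is in consecutive rows and columns. -/
def Consecutive (g : ℕ) (R : ℕ → ℕ → Prop) : Prop :=
  ∀ X ∈ alphabet g, ∀ r c, Occ R X r c → ∀ i < g, r i = r 0 + i ∧ c i = c 0 + i

theorem one_insertNth_row {g a : ℕ} (ha : a < g + 1) (A : Matrix (Fin g) (Fin g) Bool) (i j : ℕ) :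
    One (Fin.insertNth (α := fun _ => Fin g → Bool) ⟨a, ha⟩ (fun _ => false) A :
      Matrix (Fin (g + 1)) (Fin g) Bool) i j ↔ i ≠ a ∧ One A (if i < a then i else i - 1) j := by
  by_cases hij : i < g + 1 ∧ j < g
  · obtain ⟨hi, hj⟩ := hij
    refine (one_mk hi hj).trans ?_
    rcases lt_trichotomy i a with h | rfl | h
    · have e : (⟨i, hi⟩ : Fin (g + 1)) = Fin.succAbove ⟨a, ha⟩ ⟨i, by omega⟩ := by
        rw [Fin.succAbove_of_castSucc_lt]
        · rfl
        · exact h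
      rw [e]
      refine (iff_of_eq (congrArg (· = true) (congrFun (Fin.insertNth_apply_succAbove
        (α := fun _ => Fin g → Bool) ⟨a, ha⟩ (fun _ => false) A ⟨i, by omega⟩) ⟨j, hj⟩))).trans ?_
      simp only [h, if_true, h.ne, ne_eq, not_false_eq_true, true_and]
      exact (one_mk _ hj).symm
    · refine (iff_of_eq (congrArg (· = true) (congrFun (Fin.insertNth_apply_same
        (α := fun _ => Fin g → Bool) ⟨i, ha⟩ (fun _ => false) A) ⟨j, hj⟩))).trans ?_
      simp
    · have e : (⟨i, hi⟩ : Fin (g + 1)) = Fin.succAbove ⟨a, ha⟩ ⟨i - 1, by omega⟩ := by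
        rw [Fin.succAbove_of_le_castSucc]
        · ext; simp; omega
        · rw [Fin.le_def]; simp; omega
      rw [e]
      refine (iff_of_eq (congrArg (· = true) (congrFun (Fin.insertNth_apply_succAbove
        (α := fun _ => Fin g → Bool) ⟨a, ha⟩ (fun _ => false) A ⟨i - 1, by omega⟩) ⟨j, hj⟩))).trans ?_
      simp only [h.not_gt, if_false, h.ne', ne_eq, not_false_eq_true, true_and]
      exact (one_mk _ hj).symm
  · constructor
    · rintro ⟨x, y, _⟩; exact absurd ⟨x, y⟩ hij
    · rintro ⟨h, x, y, _⟩
      refine absurd ⟨?_, y⟩ hij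
      split_ifs at x <;> omega

theorem one_insertNth_col {g a : ℕ} (ha : a < g + 1) (A : Matrix (Fin g) (Fin g) Bool) (i j : ℕ) :
    One ((fun i => Fin.insertNth (α := fun _ => Bool) ⟨a, ha⟩ false (A i)) :
      Matrix (Fin g) (Fin (g + 1)) Bool) i j ↔ j ≠ a ∧ One A i (if j < a then j else j - 1) := by
  by_cases hij : i < g ∧ j < g + 1
  · obtain ⟨hi, hj⟩ := hij
    refine (one_mk hi hj).trans ?_
    rcases lt_trichotomy j a with h | rfl | h
    · have e : (⟨j, hj⟩ : Fin (g + 1)) = Fin.succAbove ⟨a, ha⟩ ⟨j, by omega⟩ := by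
        rw [Fin.succAbove_of_castSucc_lt]
        · rfl
        · exact h
      rw [e, Fin.insertNth_apply_succAbove]
      simp only [h, if_true, h.ne, ne_eq, not_false_eq_true, true_and]
      exact (one_mk hi _).symm
    · simp
    · have e : (⟨j, hj⟩ : Fin (g + 1)) = Fin.succAbove ⟨a, ha⟩ ⟨j - 1, by omega⟩ := by
        rw [Fin.succAbove_of_le_castSucc]
        · ext; simp; omega
        · rw [Fin.le_def]; simp; omega
      rw [e, Fin.insertNth_apply_succAbove]
      simp only [h.not_gt, if_false, h.ne', ne_eq, not_false_eq_true, true_and]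
      exact (one_mk hi _).symm
  · constructor
    · rintro ⟨x, y, _⟩; exact absurd ⟨x, y⟩ hij
    · rintro ⟨h, x, y, _⟩
      refine absurd ⟨x, ?_⟩ hij
      split_ifs at y <;> omega

theorem IncrOn.exists_gap {n : ℕ} {f : ℕ → ℕ} (h : IncrOn n f)
    (hn : ¬ ∀ i < n, f i = f 0 + i) : ∃ a, 0 < a ∧ a < n ∧ f (a - 1) + 1 < f a := by
  by_contra hc
  push Not at hc
  refine hn fun i hi => ?_
  induction i with
  | zero => simp
  | succ k ih =>
    have := ih (by omega)
    have h1 := hc (k + 1) (by omega) hi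
    have h2 := h k (k + 1) (by omega) hi
    simp only [Nat.add_sub_cancel] at h1
    omega

theorem IncrOn.insert {n a : ℕ} {f : ℕ → ℕ} (h : IncrOn n f) (ha : 0 < a) (han : a < n)
    (hgap : f (a - 1) + 1 < f a) :
    IncrOn (n + 1) (fun k => if k < a then f k else if k = a then f (a - 1) + 1 else f (k - 1)) := by
  intro i j hij hj
  simp only
  have h1 : i < a → f i + (a - 1 - i) ≤ f (a - 1) :=
    fun hi => h.add_le (i := i) (j := a - 1) (by omega) (by omega)
  have h2 : a < j → f a + (j - 1 - a) ≤ f (j - 1) :=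
    fun hi => h.add_le (i := a) (j := j - 1) (by omega) (by omega)
  have h3 : i < j → j < n → f i < f j := h i j
  have h4 : i - 1 < j - 1 → f (i - 1) < f (j - 1) := fun k => h _ _ k (by omega)
  split_ifs <;> omega

theorem IncrOn.skip {n a : ℕ} {f : ℕ → ℕ} (h : IncrOn (n + 1) f) :
    IncrOn n (fun k => f (if k < a then k else k + 1)) := by
  intro i j hij hj
  exact h _ _ (by split_ifs <;> omega) (by split_ifs <;> omega)

/-- An occurrence that is not consecutive has a gap, at which a row or a column of the matrix can
be added to the occurrence; this row or column is zero within the occurrence because the ones of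
the permutation matrix in the other rows and columns are already used. -/
theorem avoids_F1_iff {n g : ℕ} {M : Matrix (Fin n) (Fin n) Bool} (hM : IsPermRel n (One M)) :
    (∀ K ∈ F1 g, ¬ Contains M K) ↔ Consecutive g (One M) := by
  constructor
  · intro h X hX r c hO
    have hP := hX.1.permRel
    by_contra hc
    have hc' : ¬ (∀ i < g, r i = r 0 + i) ∨ ¬ (∀ i < g, c i = c 0 + i) := by
      by_contra hcc
      push Not at hcc
      exact hc fun i hi => ⟨hcc.1 i hi, hcc.2 i hi⟩
    rcases hc' with hc' | hc'
    · obtain ⟨a, ha, hag, hgap⟩ := hO.incr_row.exists_gap hc'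
      refine h _ ⟨X, hX, ⟨a, by omega⟩, ha, hag, Or.inl rfl⟩ (contains_iff.2 ⟨_, c,
        ⟨hO.incr_row.insert ha hag hgap, hO.incr_col, fun i hi j hj => ?_⟩, fun i hi => ?_,
        fun j hj => hO.col_lt hM hP hj⟩)
      · dsimp only at hi hj ⊢
        rw [one_insertNth_row]
        rcases lt_trichotomy i a with h1 | rfl | h1
        · simp [h1, h1.ne, hO.iff i (by omega) j hj]
        · simp only [lt_irrefl, if_false, if_true, ne_eq, not_true_eq_false, false_and, iff_false]
          -- the inserted row has its one in a column that is not used, since every column that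
          -- is used has a one in another row
          intro h2
          obtain ⟨k, hk⟩ := hP.exists_row hj
          have hkg := hP.lt_row hk
          have e := hM.row_unique h2 ((hO.iff k hkg j hj).2 hk)
          have e1 := hO.incr_row.lt_iff (i := i - 1) (j := k) (by omega) hkg
          have e2 := hO.incr_row.lt_iff (i := k) (j := i) hkg (by omega)
          omega
        · simp [h1.not_gt, h1.ne', hO.iff (i - 1) (by omega) j hj]
      · dsimp only at hi ⊢
        have := hO.row_lt hM hP hag
        split_ifs with h1 h2
        · exact hO.row_lt hM hP (by omega)
        · omega
        · exact hO.row_lt hM hP (by omega)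
    · obtain ⟨a, ha, hag, hgap⟩ := hO.incr_col.exists_gap hc'
      refine h _ ⟨X, hX, ⟨a, by omega⟩, ha, hag, Or.inr rfl⟩ (contains_iff.2 ⟨r, _,
        ⟨hO.incr_row, hO.incr_col.insert ha hag hgap, fun i hi j hj => ?_⟩,
        fun j hj => hO.row_lt hM hP hj, fun i hi => ?_⟩)
      · dsimp only at hi hj ⊢
        rw [one_insertNth_col]
        rcases lt_trichotomy j a with h1 | rfl | h1
        · simp [h1, h1.ne, hO.iff i hi j (by omega)]
        · simp only [lt_irrefl, if_false, if_true, ne_eq, not_true_eq_false, false_and, iff_false]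
          intro h2
          obtain ⟨k, hk⟩ := hP.exists_col hi
          have hkg := hP.lt_col hk
          have e := hM.col_unique h2 ((hO.iff i hi k hkg).2 hk)
          have e1 := hO.incr_col.lt_iff (i := j - 1) (j := k) (by omega) hkg
          have e2 := hO.incr_col.lt_iff (i := k) (j := j) hkg (by omega)
          omega
        · simp [h1.not_gt, h1.ne', hO.iff i hi (j - 1) (by omega)]
      · dsimp only at hi ⊢
        have := hO.col_lt hM hP hag
        split_ifs with h1 h2
        · exact hO.col_lt hM hP (by omega)
        · omega
        · exact hO.col_lt hM hP (by omega)
  · rintro h K ⟨X, hX, ⟨a, ha'⟩, ha, hag, rfl | rfl⟩ hK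
    · simp only at ha hag
      obtain ⟨r, c, hO, -, -⟩ := contains_iff.1 hK
      have hO' : Occ (One M) X (fun k => r (if k < a then k else k + 1)) c := by
        refine ⟨hO.incr_row.skip, hO.incr_col, fun i hi j hj => ?_⟩
        rw [hO.iff _ (by dsimp only; split_ifs <;> omega) _ hj]
        dsimp only
        rw [one_insertNth_row]
        by_cases h1 : i < a
        · simp [h1, h1.ne]
        · simp [h1, show ¬ i + 1 < a by omega, show i + 1 ≠ a by omega]
      have h1 := (h X hX _ _ hO' (a - 1) (by omega)).1
      have h2 := (h X hX _ _ hO' a (by omega)).1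
      have h3 := hO.incr_row (a - 1) a (by omega) (by dsimp only; omega)
      have h4 := hO.incr_row a (a + 1) (by omega) (by dsimp only; omega)
      simp only [show a - 1 < a by omega, lt_irrefl, if_true, if_false, ha] at h1 h2
      omega
    · simp only at ha hag
      obtain ⟨r, c, hO, -, -⟩ := contains_iff.1 hK
      have hO' : Occ (One M) X r (fun k => c (if k < a then k else k + 1)) := by
        refine ⟨hO.incr_row, hO.incr_col.skip, fun i hi j hj => ?_⟩
        rw [hO.iff _ hi _ (by dsimp only; split_ifs <;> omega)]
        dsimp only
        rw [one_insertNth_col]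
        by_cases h1 : j < a
        · simp [h1, h1.ne]
        · simp [h1, show ¬ j + 1 < a by omega, show j + 1 ≠ a by omega]
      have h1 := (h X hX _ _ hO' (a - 1) (by omega)).2
      have h2 := (h X hX _ _ hO' a (by omega)).2
      have h3 := hO.incr_col (a - 1) a (by omega) (by dsimp only; omega)
      have h4 := hO.incr_col a (a + 1) (by omega) (by dsimp only; omega)
      simp only [show a - 1 < a by omega, lt_irrefl, if_true, if_false, ha] at h1 h2
      omega

/-! ### Forbidden patterns in terms of blocks -/

section

variable {V : Type*} {Γ : TwoStackAutomaton V} {g : ℕ}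

/-- The name of a block after the difference between `B` and `B'` has been erased. -/
def Block.erase {V ι : Type*} : Block V ι → Block V ι
  | .B' => .B
  | s => s

theorem Block.erase_eq_B {V ι : Type*} {s : Block V ι} : s.erase = .B ↔ s.IsB := by
  cases s <;> simp [Block.erase, Block.IsB]

theorem Block.erase_eq_iff {V ι : Type*} {s t : Block V ι} (h : t ≠ .B) (h' : t ≠ .B') :
    s.erase = t ↔ s = t := by
  cases s <;> cases t <;> simp_all [Block.erase]

/-- The block called `s` occurs at `(a, b)`, where `B` and `B'` are not distinguished: both of
them have the name `B`, and no block has the name `B'`. -/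
def Erased (A : Block V Γ.Letter → Matrix (Fin g) (Fin g) Bool) (R : ℕ → ℕ → Prop) (a b : ℕ)
    (s : Block V Γ.Letter) : Prop :=
  ∃ t, t.erase = s ∧ Blk R a b (A t)

/-- The `k × k` block matrix with the block `s i` in row `i` and column `σ i`. -/
def permPattern (A : Block V Γ.Letter → Matrix (Fin g) (Fin g) Bool) {k : ℕ}
    (σ : Fin k → Fin k) (s : Fin k → Block V Γ.Letter) : ZeroOneMatrix :=
  blockMatrix (fun i j => if σ i = j then A (s i) else O)

/-- Among the blocks recorded by `E` there are some of the names `s i`, at the positions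
`(x i, y (σ i))`, with `x` and `y` increasing so that the blocks do not overlap. -/
structure Arranged (E : ℕ → ℕ → Block V Γ.Letter → Prop) (g : ℕ) {k : ℕ} (σ : Fin k → Fin k)
    (s : Fin k → Block V Γ.Letter) (x y : Fin k → ℕ) : Prop where
  row : ∀ i j, i < j → x i + g ≤ x j
  col : ∀ i j, i < j → y i + g ≤ y j
  block : ∀ i, E (x i) (y (σ i)) (s i)

variable {A : Block V Γ.Letter → Matrix (Fin g) (Fin g) Bool}

theorem permPattern_entry {k : ℕ} {σ : Fin k → Fin k} {s : Fin k → Block V Γ.Letter}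
    (i j : Fin (k * g)) : (permPattern A σ s).entry i j = true ↔
      σ i.divNat = j.divNat ∧ A (s i.divNat) i.modNat j.modNat = true := by
  change (if σ i.divNat = j.divNat then A (s i.divNat) else O) i.modNat j.modNat = true ↔ _
  split_ifs with h
  · simp [h]
  · simp [h, O]

/-- Since occurrences of the alphabet are consecutive, an occurrence of a block pattern consists of
blocks in the prescribed relative position. -/
theorem contains_permPattern_iff (hA : ∀ s, A s ∈ alphabet g) {n k : ℕ}
    {M : Matrix (Fin n) (Fin n) Bool} (hM : IsPermRel n (One M)) (hC : Consecutive g (One M))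
    {σ : Fin k → Fin k} (hσ : Function.Injective σ) {s : Fin k → Block V Γ.Letter} :
    Contains M (permPattern A σ s) ↔
      ∃ x y, Arranged (fun a b s => Blk (One M) a b (A s)) g σ s x y := by
  have hg (i : Fin k) : 7 ≤ g := seven_le_of_mem_alphabet (hA (s i))
  constructor
  · intro h
    obtain ⟨r, c, hO, -, -⟩ := contains_iff.1 h
    have hidx (i : Fin k) {u : ℕ} (hu : u < g) : i * g + u < k * g := by
      calc i * g + u < (i + 1) * g := by rw [add_mul]; omega
        _ ≤ k * g := Nat.mul_le_mul_right _ i.2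
    have hgap (i j : Fin k) (hij : i < j) : (i : ℕ) * g + g ≤ j * g := by
      have : ((i : ℕ) + 1) * g ≤ j * g := Nat.mul_le_mul_right _ hij
      rwa [add_mul, one_mul] at this
    refine ⟨fun i => r (i * g), fun j => c (j * g), fun i j hij => ?_, fun i j hij => ?_,
      fun i => ?_⟩
    · have := hO.incr_row.add_le (i := i * g) (j := j * g) (by have := hgap i j hij; omega)
        (hidx j (u := 0) (by have := hg i; omega))
      have := hgap i j hij
      omega
    · have := hO.incr_col.add_le (i := i * g) (j := j * g) (by have := hgap i j hij; omega)
        (hidx j (u := 0) (by have := hg i; omega))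
      have := hgap i j hij
      omega
    · have hO' : Occ (One M) (A (s i)) (fun u => r (i * g + u)) (fun u => c (σ i * g + u)) := by
        refine ⟨fun u v huv hv => hO.incr_row _ _ (by omega) (hidx i hv),
          fun u v huv hv => hO.incr_col _ _ (by omega) (hidx (σ i) hv), fun u hu v hv => ?_⟩
        rw [hO.iff _ (hidx i hu) _ (hidx (σ i) hv)]
        refine (one_mk (hidx i hu) (hidx (σ i) hv)).trans ?_
        rw [one_mk hu hv, permPattern_entry]
        have e1 : (⟨i * g + u, hidx i hu⟩ : Fin (k * g)).divNat = i := by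
          ext; simp [Nat.add_div_of_dvd_right, Nat.div_eq_of_lt hu,
            Nat.mul_div_cancel _ (Nat.zero_lt_of_lt hu)]
        have e2 : (⟨σ i * g + v, hidx (σ i) hv⟩ : Fin (k * g)).divNat = σ i := by
          ext; simp [Nat.add_div_of_dvd_right, Nat.div_eq_of_lt hv,
            Nat.mul_div_cancel _ (Nat.zero_lt_of_lt hu)]
        have e3 : (⟨i * g + u, hidx i hu⟩ : Fin (k * g)).modNat = ⟨u, hu⟩ := by
          ext; simp [Nat.mod_eq_of_lt hu]
        have e4 : (⟨σ i * g + v, hidx (σ i) hv⟩ : Fin (k * g)).modNat = ⟨v, hv⟩ := by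
          ext; simp [Nat.mod_eq_of_lt hv]
        rw [e1, e2, e3, e4]
        simp
      have hc := hC _ (hA (s i)) _ _ hO'
      exact hO'.blk (fun u hu => (hc u hu).1) (fun u hu => (hc u hu).2)
  · rintro ⟨x, y, h⟩
    have hσ' := Finite.surjective_of_injective hσ
    have hP (i : Fin k) := (hA (s i)).1.permRel
    have hbx (i : Fin k) := ((h.block i).bounds hM (hP i) (by have := hg i; omega)).1
    have hby (j : Fin k) : y j + g ≤ n := by
      obtain ⟨i, rfl⟩ := hσ' j
      exact ((h.block i).bounds hM (hP i) (by have := hg i; omega)).2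
    have hmono (z : Fin k → ℕ) (hz : ∀ i j, i < j → z i + g ≤ z j) (i j : Fin (k * g))
        (hij : i < j) : z i.divNat + i.modNat < z j.divNat + j.modNat := by
      have hi := i.modNat.2
      have hd : i.divNat ≤ j.divNat := by
        rw [Fin.le_def, Fin.coe_divNat, Fin.coe_divNat]
        exact Nat.div_le_div_right hij.le
      rcases hd.eq_or_lt with hd | hd
      · rw [hd]
        have h1 := congrArg Fin.val hd
        rw [Fin.coe_divNat, Fin.coe_divNat] at h1
        rw [Fin.coe_modNat, Fin.coe_modNat]
        have h2 := Nat.div_add_mod i.1 g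
        have h3 := Nat.div_add_mod j.1 g
        rw [h1] at h2
        have : i.1 < j.1 := hij
        omega
      · have := hz _ _ hd
        omega
    have hbx' (i : Fin (k * g)) : x i.divNat + i.modNat < n := by
      have := hbx i.divNat; have := i.modNat.2; omega
    have hby' (i : Fin (k * g)) : y i.divNat + i.modNat < n := by
      have := hby i.divNat; have := i.modNat.2; omega
    refine ⟨OrderEmbedding.ofStrictMono (fun i => ⟨_, hbx' i⟩) (fun i j hij => hmono x h.row i j hij),
      OrderEmbedding.ofStrictMono (fun i => ⟨_, hby' i⟩) (fun i j hij => hmono y h.col i j hij), ?_⟩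
    ext i j
    rw [Bool.eq_iff_iff]
    refine (one_mk (hbx' i) (hby' j)).symm.trans (Iff.trans ?_ (permPattern_entry i j).symm)
    set i' : Fin k := Fin.divNat i
    set j' : Fin k := Fin.divNat j
    by_cases hij : σ i' = j'
    · rw [← hij, h.block i' _ (Fin.modNat i).2 _ (Fin.modNat j).2, one_fin]
      simp
    · simp only [hij, false_and, iff_false]
      intro h1
      have h2 := ((h.block i').interval hM (hP i') h1).1
        ⟨by omega, by have := (Fin.modNat i).2; omega⟩
      have h3 := (Fin.modNat j).2
      rcases lt_or_gt_of_ne hij with h4 | h4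
      · have := h.col _ _ h4; omega
      · have := h.col _ _ h4; omega

/-! ### The patterns of `F₅` and `F₄` -/

theorem mem_F5_iff {K : ZeroOneMatrix} : K ∈ F5 Γ A ↔
    ∃ p q : Γ.Letter, p.1.1 = q.1.1 ∧
      ((∃ s : Block V Γ.Letter, s.IsB ∧ K = permPattern A ![1, 2, 0] ![.Z p, .Z q, s]) ∨
       (∃ j, K = permPattern A ![2, 0, 1] ![.T j, .Z p, .Z q])) := by
  have e (p q : Γ.Letter) : (Label.push p.1.1 p.1.2).Similar (Label.push q.1.1 q.1.2) ↔
      p.1.1 = q.1.1 := by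
    simp [Label.Similar, Label.stack, eq_comm]
  have e1 (p q : Γ.Letter) (s : Block V Γ.Letter) :
      permPattern A ![1, 2, 0] ![.Z p, .Z q, s] = blockMatrix !![
          O, A (.Z p), O;
          O, O, A (.Z q);
          A s, O, O] := by
    refine congrArg blockMatrix ?_
    ext i j u v
    fin_cases i <;> fin_cases j <;> rfl
  have e2 (p q : Γ.Letter) (j : V) :
      permPattern A ![2, 0, 1] ![.T j, .Z p, .Z q] = blockMatrix !![
          O, O, A (.T j);
          A (.Z p), O, O;
          O, A (.Z q), O] := by
    refine congrArg blockMatrix ?_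
    ext i j u v
    fin_cases i <;> fin_cases j <;> rfl
  simp only [e1, e2, F5, Set.mem_ofPred_eq, e]

/-- `Template Γ σ s c`: the block patterns of `F₄` are those of the form `permPattern A σ s'` where
`s` arises from `s'` by erasing the difference between `B` and `B'`, and `s' c = B'`. The five
constructors stand for the five sets `W₁, …, W₅`. -/
inductive Template (Γ : TwoStackAutomaton V) :
    {k : ℕ} → (Fin k → Fin k) → (Fin k → Block V Γ.Letter) → Fin k → Prop
  | push (i j k : V) (p : Γ.Letter) : Γ.Adj i j → Γ.Adj j k →
      Γ.label j = .push p.1.1 p.1.2 →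
      Template Γ ![2, 5, 0, 7, 6, 1, 4, 3] ![.T i, .T j, .B, .Z p, .T k, .B, .B, .Z p] 5
  | pop (i j k : V) (p : Γ.Letter) : Γ.Adj i j → Γ.Adj j k →
      Γ.label j = .pop p.1.1 p.1.2 →
      Template Γ ![4, 3, 6, 1, 0, 7, 2, 5] ![.Z p, .T i, .T j, .B, .Z p, .T k, .B, .B] 6
  | eps (i j k : V) : Γ.Adj i j → Γ.Adj j k → Γ.label j = .eps →
      Template Γ ![2, 5, 0, 3, 6, 1, 4] ![.T i, .T j, .B, .E, .T k, .B, .B] 5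
  | first (k : V) : Γ.Adj Γ.start k →
      Template Γ ![4, 1, 2, 5, 0, 3] ![.T Γ.start, .P, .E, .T k, .B, .B] 4
  | last (i : V) : Γ.Adj i Γ.accept →
      Template Γ ![2, 5, 0, 3, 4, 1] ![.T i, .T Γ.accept, .B, .E, .Q, .B] 5

theorem Template.injective {k : ℕ} {σ : Fin k → Fin k} {s : Fin k → Block V Γ.Letter} {c : Fin k}
    (h : Template Γ σ s c) : Function.Injective σ := by
  cases h <;> decide

theorem Template.center {k : ℕ} {σ : Fin k → Fin k} {s : Fin k → Block V Γ.Letter} {c : Fin k}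
    (h : Template Γ σ s c) : s c = .B := by
  cases h <;> rfl

theorem Template.size_le {k : ℕ} {σ : Fin k → Fin k} {s : Fin k → Block V Γ.Letter} {c : Fin k}
    (h : Template Γ σ s c) : k ≤ 8 := by
  cases h <;> decide

theorem permPattern_push {a0 a1 a2 a3 a4 a5 a6 a7 : Block V Γ.Letter} :
    permPattern A ![2, 5, 0, 7, 6, 1, 4, 3] ![a0, a1, a2, a3, a4, a5, a6, a7] = blockMatrix !![
      O, O, A a0, O, O, O, O, O;
      O, O, O, O, O, A a1, O, O;
      A a2, O, O, O, O, O, O, O;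
      O, O, O, O, O, O, O, A a3;
      O, O, O, O, O, O, A a4, O;
      O, A a5, O, O, O, O, O, O;
      O, O, O, O, A a6, O, O, O;
      O, O, O, A a7, O, O, O, O] := by
  refine congrArg blockMatrix ?_
  ext i j u v
  fin_cases i <;> fin_cases j <;> rfl

theorem permPattern_pop {a0 a1 a2 a3 a4 a5 a6 a7 : Block V Γ.Letter} :
    permPattern A ![4, 3, 6, 1, 0, 7, 2, 5] ![a0, a1, a2, a3, a4, a5, a6, a7] = blockMatrix !![
      O, O, O, O, A a0, O, O, O;
      O, O, O, A a1, O, O, O, O;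
      O, O, O, O, O, O, A a2, O;
      O, A a3, O, O, O, O, O, O;
      A a4, O, O, O, O, O, O, O;
      O, O, O, O, O, O, O, A a5;
      O, O, A a6, O, O, O, O, O;
      O, O, O, O, O, A a7, O, O] := by
  refine congrArg blockMatrix ?_
  ext i j u v
  fin_cases i <;> fin_cases j <;> rfl

theorem permPattern_eps {a0 a1 a2 a3 a4 a5 a6 : Block V Γ.Letter} :
    permPattern A ![2, 5, 0, 3, 6, 1, 4] ![a0, a1, a2, a3, a4, a5, a6] = blockMatrix !![
      O, O, A a0, O, O, O, O;
      O, O, O, O, O, A a1, O;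
      A a2, O, O, O, O, O, O;
      O, O, O, A a3, O, O, O;
      O, O, O, O, O, O, A a4;
      O, A a5, O, O, O, O, O;
      O, O, O, O, A a6, O, O] := by
  refine congrArg blockMatrix ?_
  ext i j u v
  fin_cases i <;> fin_cases j <;> rfl

theorem permPattern_first {a0 a1 a2 a3 a4 a5 : Block V Γ.Letter} :
    permPattern A ![4, 1, 2, 5, 0, 3] ![a0, a1, a2, a3, a4, a5] = blockMatrix !![
      O, O, O, O, A a0, O;
      O, A a1, O, O, O, O;
      O, O, A a2, O, O, O;
      O, O, O, O, O, A a3;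
      A a4, O, O, O, O, O;
      O, O, O, A a5, O, O] := by
  refine congrArg blockMatrix ?_
  ext i j u v
  fin_cases i <;> fin_cases j <;> rfl

theorem permPattern_last {a0 a1 a2 a3 a4 a5 : Block V Γ.Letter} :
    permPattern A ![2, 5, 0, 3, 4, 1] ![a0, a1, a2, a3, a4, a5] = blockMatrix !![
      O, O, A a0, O, O, O;
      O, O, O, O, O, A a1;
      A a2, O, O, O, O, O;
      O, O, O, A a3, O, O;
      O, O, O, O, A a4, O;
      O, A a5, O, O, O, O] := by
  refine congrArg blockMatrix ?_
  ext i j u v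
  fin_cases i <;> fin_cases j <;> rfl

theorem Block.eq_of_erase_eq {V ι : Type*} {s t : Block V ι} (h : s.erase = t) (h' : t ≠ .B) :
    s = t := by
  subst h
  cases s <;> simp_all [Block.erase]

theorem mem_F4_iff {K : ZeroOneMatrix} : K ∈ F4 Γ A ↔
    ∃ (k : ℕ) (σ : Fin k → Fin k) (s' : Fin k → Block V Γ.Letter) (c : Fin k),
      Template Γ σ (fun i => (s' i).erase) c ∧ s' c = .B' ∧ K = permPattern A σ s' := by
  have erase_cons (k : ℕ) (a : Block V Γ.Letter) (s : Fin k → Block V Γ.Letter) :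
      (fun i => (Matrix.vecCons a s i).erase) = Matrix.vecCons a.erase (fun i => (s i).erase) := by
    funext i
    refine Fin.cases rfl (fun _ => rfl) i
  have erase_empty : (fun i => ((![] : Fin 0 → Block V Γ.Letter) i).erase) = ![] :=
    funext fun i => i.elim0
  simp only [F4, Set.mem_union, W1, W2, W3, W4, W5, Set.mem_ofPred_eq, ← permPattern_push,
    ← permPattern_pop, ← permPattern_eps, ← permPattern_first, ← permPattern_last]
  constructor
  · rintro ((((⟨i, j, k, p, L, R, hL, hR, h1, h2, h3, rfl⟩ |
      ⟨i, j, k, p, L, R, hL, hR, h1, h2, h3, rfl⟩) | ⟨i, j, k, L, R, hL, hR, h1, h2, h3, rfl⟩) |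
      ⟨k, R, hR, h1, rfl⟩) | ⟨i, L, hL, h1, rfl⟩)
    · refine ⟨8, _, ![.T i, .T j, L, .Z p, .T k, .B', R, .Z p], 5, ?_, rfl, rfl⟩
      simp only [erase_cons, erase_empty, Block.erase_eq_B.2 hL, Block.erase_eq_B.2 hR]
      exact Template.push i j k p h1 h2 h3
    · refine ⟨8, _, ![.Z p, .T i, .T j, L, .Z p, .T k, .B', R], 6, ?_, rfl, rfl⟩
      simp only [erase_cons, erase_empty, Block.erase_eq_B.2 hL, Block.erase_eq_B.2 hR]
      exact Template.pop i j k p h1 h2 h3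
    · refine ⟨7, _, ![.T i, .T j, L, .E, .T k, .B', R], 5, ?_, rfl, rfl⟩
      simp only [erase_cons, erase_empty, Block.erase_eq_B.2 hL, Block.erase_eq_B.2 hR]
      exact Template.eps i j k h1 h2 h3
    · refine ⟨6, _, ![.T Γ.start, .P, .E, .T k, .B', R], 4, ?_, rfl, rfl⟩
      simp only [erase_cons, erase_empty, Block.erase_eq_B.2 hR]
      exact Template.first k h1
    · refine ⟨6, _, ![.T i, .T Γ.accept, L, .E, .Q, .B'], 5, ?_, rfl, rfl⟩
      simp only [erase_cons, erase_empty, Block.erase_eq_B.2 hL]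
      exact Template.last i h1
  · rintro ⟨k, σ, s', c, ht, hc, rfl⟩
    generalize hs : (fun i => (s' i).erase) = s at ht
    have hs' (i) : (s' i).erase = s i := congrFun hs i
    have key (i) (h : s i ≠ .B) : s' i = s i := Block.eq_of_erase_eq (hs' i) h
    have keyB (i) (h : s i = .B) : (s' i).IsB := Block.erase_eq_B.1 ((hs' i).trans h)
    clear hs hs' erase_cons erase_empty
    cases ht with
    | push i j k p h1 h2 h3 =>
      have k0 : s' 0 = .T i := key 0 (by simp)
      have k1 : s' 1 = .T j := key 1 (by simp)
      have k3 : s' 3 = .Z p := key 3 (by simp)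
      have k4 : s' 4 = .T k := key 4 (by simp)
      have k7 : s' 7 = .Z p := key 7 (by simp)
      have e : s' = ![.T i, .T j, s' 2, .Z p, .T k, .B', s' 6, .Z p] := by
        ext a
        fin_cases a
        exacts [k0, k1, rfl, k3, k4, hc, rfl, k7]
      exact Or.inl (Or.inl (Or.inl (Or.inl ⟨i, j, k, p, s' 2, s' 6, keyB 2 rfl, keyB 6 rfl,
        h1, h2, h3, congrArg _ e⟩)))
    | pop i j k p h1 h2 h3 =>
      have k0 : s' 0 = .Z p := key 0 (by simp)
      have k1 : s' 1 = .T i := key 1 (by simp)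
      have k2 : s' 2 = .T j := key 2 (by simp)
      have k4 : s' 4 = .Z p := key 4 (by simp)
      have k5 : s' 5 = .T k := key 5 (by simp)
      have e : s' = ![.Z p, .T i, .T j, s' 3, .Z p, .T k, .B', s' 7] := by
        ext a
        fin_cases a
        exacts [k0, k1, k2, rfl, k4, k5, hc, rfl]
      exact Or.inl (Or.inl (Or.inl (Or.inr ⟨i, j, k, p, s' 3, s' 7, keyB 3 rfl, keyB 7 rfl,
        h1, h2, h3, congrArg _ e⟩)))
    | eps i j k h1 h2 h3 =>
      have k0 : s' 0 = .T i := key 0 (by simp)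
      have k1 : s' 1 = .T j := key 1 (by simp)
      have k3 : s' 3 = .E := key 3 (by simp)
      have k4 : s' 4 = .T k := key 4 (by simp)
      have e : s' = ![.T i, .T j, s' 2, .E, .T k, .B', s' 6] := by
        ext a
        fin_cases a
        exacts [k0, k1, rfl, k3, k4, hc, rfl]
      exact Or.inl (Or.inl (Or.inr ⟨i, j, k, s' 2, s' 6, keyB 2 rfl, keyB 6 rfl,
        h1, h2, h3, congrArg _ e⟩))
    | first k h1 =>
      have k0 : s' 0 = .T Γ.start := key 0 (by simp)
      have k1 : s' 1 = .P := key 1 (by simp)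
      have k2 : s' 2 = .E := key 2 (by simp)
      have k3 : s' 3 = .T k := key 3 (by simp)
      have e : s' = ![.T Γ.start, .P, .E, .T k, .B', s' 5] := by
        ext a
        fin_cases a
        exacts [k0, k1, k2, k3, hc, rfl]
      exact Or.inl (Or.inr ⟨k, s' 5, keyB 5 rfl, h1, congrArg _ e⟩)
    | last i h1 =>
      have k0 : s' 0 = .T i := key 0 (by simp)
      have k1 : s' 1 = .T Γ.accept := key 1 (by simp)
      have k3 : s' 3 = .E := key 3 (by simp)
      have k4 : s' 4 = .Q := key 4 (by simp)
      have e : s' = ![.T i, .T Γ.accept, s' 2, .E, .Q, .B'] := by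
        ext a
        fin_cases a
        exacts [k0, k1, rfl, k3, k4, hc]
      exact Or.inr ⟨i, s' 2, keyB 2 rfl, h1, congrArg _ e⟩

/-- The block at `(a, b)` is the center of a configuration from `F₄`, when the difference between
`B` and `B'` is disregarded. In a matrix that avoids `F₄` such a block must be `B`. -/
def Blocked (E : ℕ → ℕ → Block V Γ.Letter → Prop) (g a b : ℕ) : Prop :=
  ∃ (k : ℕ) (σ : Fin k → Fin k) (s : Fin k → Block V Γ.Letter) (c : Fin k) (x y : Fin k → ℕ),
    Template Γ σ s c ∧ Arranged E g σ s x y ∧ x c = a ∧ y (σ c) = b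

theorem avoids_F4_iff (hA : ∀ s, A s ∈ alphabet g) {n : ℕ}
    {M : Matrix (Fin n) (Fin n) Bool} (hM : IsPermRel n (One M)) (hC : Consecutive g (One M)) :
    (∀ K ∈ F4 Γ A, ¬ Contains M K) ↔
      ∀ a b, Blocked (Erased A (One M)) g a b → ¬ Blk (One M) a b (A .B') := by
  constructor
  · rintro h a b ⟨k, σ, s, c, x, y, ht, hx, rfl, rfl⟩ hB
    choose! s' hs' hs'' using hx.block
    let s1 := Function.update s' c .B'
    have hs1 : (fun i => (s1 i).erase) = s := by
      ext i
      by_cases hi : i = c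
      · subst hi
        simp only [s1, Function.update_self, Block.erase, ht.center]
      · simp only [s1, Function.update_of_ne hi, hs']
    refine h _ (mem_F4_iff.2 ⟨k, σ, s1, c, by rwa [hs1], by simp [s1], rfl⟩)
      ((contains_permPattern_iff hA hM hC ht.injective).2 ⟨x, y, hx.row, hx.col, fun i => ?_⟩)
    by_cases hi : i = c
    · subst hi
      simpa [s1] using hB
    · simpa only [s1, Function.update_of_ne hi] using hs'' i
  · intro h K hK hMK
    obtain ⟨k, σ, s', c, ht, hc, rfl⟩ := mem_F4_iff.1 hK
    obtain ⟨x, y, hx⟩ := (contains_permPattern_iff hA hM hC ht.injective).1 hMK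
    refine h _ _ ⟨k, σ, _, c, x, y, ht, ⟨hx.row, hx.col, fun i => ⟨s' i, rfl, hx.block i⟩⟩, rfl, rfl⟩
      (hc ▸ hx.block c)

/-- Blocks named by letters of the same stack do not increase above and to the right of a block
`B`, and neither do they below and to the left of a block `T v`. -/
structure NonCrossing (E : ℕ → ℕ → Block V Γ.Letter → Prop) (g : ℕ) : Prop where
  above : ∀ {p q : Γ.Letter} {a1 b1 a2 b2 a3 b3 : ℕ}, p.1.1 = q.1.1 → E a1 b1 (.Z p) →
    E a2 b2 (.Z q) → E a3 b3 .B → a1 + g ≤ a2 → a2 + g ≤ a3 → b3 + g ≤ b1 → b1 + g ≤ b2 → False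
  below : ∀ {p q : Γ.Letter} {j : V} {a1 b1 a2 b2 a3 b3 : ℕ}, p.1.1 = q.1.1 → E a1 b1 (.Z p) →
    E a2 b2 (.Z q) → E a3 b3 (.T j) → a3 + g ≤ a1 → a1 + g ≤ a2 → b1 + g ≤ b2 → b2 + g ≤ b3 →
    False

theorem lt_three_cases {P : Fin 3 → Fin 3 → Prop} (h01 : P 0 1) (h02 : P 0 2) (h12 : P 1 2) :
    ∀ i j, i < j → P i j := by
  intro i j hij
  fin_cases i <;> fin_cases j <;> first | assumption | exact absurd hij (by decide)

theorem erased_iff {R : ℕ → ℕ → Prop} {a b : ℕ} {s : Block V Γ.Letter} (h : s ≠ .B)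
    (h' : s ≠ .B') : Erased A R a b s ↔ Blk R a b (A s) := by
  constructor
  · rintro ⟨t, ht, hb⟩
    rw [Block.erase_eq_iff h h'] at ht
    exact ht ▸ hb
  · exact fun hb => ⟨s, (Block.erase_eq_iff h h').2 rfl, hb⟩

theorem avoids_F5_iff (hA : ∀ s, A s ∈ alphabet g) {n : ℕ}
    {M : Matrix (Fin n) (Fin n) Bool} (hM : IsPermRel n (One M)) (hC : Consecutive g (One M)) :
    (∀ K ∈ F5 Γ A, ¬ Contains M K) ↔ NonCrossing (Erased A (One M)) g := by
  constructor
  · intro h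
    constructor
    · rintro p q a1 b1 a2 b2 a3 b3 hpq h1 h2 ⟨s, hs, h3⟩ e1 e2 e3 e4
      rw [erased_iff (by simp) (by simp)] at h1 h2
      refine h _ (mem_F5_iff.2 ⟨p, q, hpq, Or.inl ⟨s, Block.erase_eq_B.1 hs, rfl⟩⟩)
        ((contains_permPattern_iff hA hM hC (by decide)).2
          ⟨![a1, a2, a3], ![b3, b1, b2], ?_, ?_, ?_⟩)
      · exact lt_three_cases e1 (by simp; omega) e2
      · exact lt_three_cases e3 (by simp; omega) e4
      · intro i
        fin_cases i
        exacts [h1, h2, h3]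
    · rintro p q j a1 b1 a2 b2 a3 b3 hpq h1 h2 h3 e1 e2 e3 e4
      rw [erased_iff (by simp) (by simp)] at h1 h2 h3
      refine h _ (mem_F5_iff.2 ⟨p, q, hpq, Or.inr ⟨j, rfl⟩⟩)
        ((contains_permPattern_iff hA hM hC (by decide)).2
          ⟨![a3, a1, a2], ![b1, b2, b3], ?_, ?_, ?_⟩)
      · exact lt_three_cases e1 (by simp; omega) e2
      · exact lt_three_cases e3 (by simp; omega) e4
      · intro i
        fin_cases i
        exacts [h3, h1, h2]
  · intro h K hK hMK
    obtain ⟨p, q, hpq, ⟨s, hs, rfl⟩ | ⟨j, rfl⟩⟩ := mem_F5_iff.1 hK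
    · obtain ⟨x, y, hx⟩ := (contains_permPattern_iff hA hM hC (by decide)).1 hMK
      exact h.above hpq ((erased_iff (by simp) (by simp)).2 (hx.block 0))
        ((erased_iff (by simp) (by simp)).2 (hx.block 1))
        ⟨s, Block.erase_eq_B.2 hs, hx.block 2⟩ (hx.row 0 1 (by decide)) (hx.row 1 2 (by decide))
        (hx.col 0 1 (by decide)) (hx.col 1 2 (by decide))
    · obtain ⟨x, y, hx⟩ := (contains_permPattern_iff hA hM hC (by decide)).1 hMK
      exact h.below hpq ((erased_iff (by simp) (by simp)).2 (hx.block 1))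
        ((erased_iff (by simp) (by simp)).2 (hx.block 2))
        ((erased_iff (by simp) (by simp)).2 (hx.block 0))
        (hx.row 0 1 (by decide)) (hx.row 1 2 (by decide))
        (hx.col 0 1 (by decide)) (hx.col 1 2 (by decide))

end

section

variable {V : Type*} {Γ : TwoStackAutomaton V} {g : ℕ}
  {A : Block V Γ.Letter → Matrix (Fin g) (Fin g) Bool}

/-! ### The patterns of `F₂` and `F₃` -/

theorem HasBlockAt.blk {K : ZeroOneMatrix} {a b : ℕ} {X : Matrix (Fin g) (Fin g) Bool}
    (h : K.HasBlockAt a b X) : Blk (One K.entry) a b X := by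
  intro i hi j hj
  obtain ⟨h1, h2, h3⟩ := h ⟨i, hi⟩ ⟨j, hj⟩
  rw [one_mk h1 h2, one_mk hi hj, h3]

theorem isPartialPattern_submatrix {N m n : ℕ} {R : ℕ → ℕ → Prop} (hR : IsPermRel N R)
    {X : Matrix (Fin m) (Fin n) Bool} {r c : ℕ → ℕ} (h : Occ R X r c) :
    ZeroOneMatrix.IsPartialPattern ⟨m, n, X⟩ := by
  constructor
  · intro i j j' h1 h2
    have h1' := (h.iff i i.2 j j.2).2 (one_fin.2 h1)
    have h2' := (h.iff i i.2 j' j'.2).2 (one_fin.2 h2)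
    exact Fin.ext (h.incr_col.inj j.2 j'.2 (hR.col_unique h1' h2'))
  · intro i i' j h1 h2
    have h1' := (h.iff i i.2 j j.2).2 (one_fin.2 h1)
    have h2' := (h.iff i' i'.2 j j.2).2 (one_fin.2 h2)
    exact Fin.ext (h.incr_row.inj i.2 i'.2 (hR.row_unique h1' h2'))

/-- Two blocks are contained in a pattern with `p` rows and `q` columns between them exactly when
they have at least the distance that this requires. -/
theorem exists_corner_pattern_iff {N p q : ℕ} {M : Matrix (Fin N) (Fin N) Bool}
    (hM : IsPermRel N (One M)) (hC : Consecutive g (One M)) {X Y : Matrix (Fin g) (Fin g) Bool}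
    (hX : X ∈ alphabet g) (hY : Y ∈ alphabet g) :
    (∃ K : ZeroOneMatrix, K.IsPartialPattern ∧ K.rows = g + p + g ∧ K.cols = g + q + g ∧
      K.HasBlockAt (K.rows - g) 0 X ∧ K.HasBlockAt 0 (K.cols - g) Y ∧ Contains M K) ↔
    ∃ a b a' b', Blk (One M) a b X ∧ Blk (One M) a' b' Y ∧ a' + g + p ≤ a ∧ b + g + q ≤ b' := by
  have hg := seven_le_of_mem_alphabet hX
  constructor
  · rintro ⟨⟨m, n, K⟩, -, hm, hn, hKX, hKY, hK⟩
    dsimp only at hm hn hKX hKY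
    subst hm hn
    obtain ⟨r, c, hO, -, -⟩ := contains_iff.1 hK
    dsimp only at hO
    have h1 := HasBlockAt.blk hKX
    have h2 := HasBlockAt.blk hKY
    dsimp only at h1 h2
    rw [show g + p + g - g = g + p by omega] at h1
    rw [show g + q + g - g = g + q by omega] at h2
    have o1 : Occ (One M) X (fun i => r (g + p + i)) c := by
      refine ⟨fun i j hij hj => hO.incr_row _ _ (by omega) (by omega),
        fun i j hij hj => hO.incr_col _ _ hij (by omega), fun i hi j hj => ?_⟩
      rw [hO.iff _ (by omega) _ (by omega), ← h1 i hi j hj, zero_add]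
    have o2 : Occ (One M) Y r (fun j => c (g + q + j)) := by
      refine ⟨fun i j hij hj => hO.incr_row _ _ (by omega) (by omega),
        fun i j hij hj => hO.incr_col _ _ (by omega) (by omega), fun i hi j hj => ?_⟩
      rw [hO.iff _ (by omega) _ (by omega), ← h2 i hi j hj, zero_add]
    have c1 := hC _ hX _ _ o1
    have c2 := hC _ hY _ _ o2
    refine ⟨_, _, _, _, o1.blk (fun i hi => (c1 i hi).1) (fun i hi => (c1 i hi).2),
      o2.blk (fun i hi => (c2 i hi).1) (fun i hi => (c2 i hi).2), ?_, ?_⟩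
    · have := hO.incr_row.add_le (i := 0) (j := g + p) (by omega) (by omega)
      simp only [add_zero]; omega
    · have := hO.incr_col.add_le (i := 0) (j := g + q) (by omega) (by omega)
      simp only [add_zero]; omega
  · rintro ⟨a, b, a', b', hBX, hBY, h1, h2⟩
    have b1 := hBX.bounds hM hX.1.permRel (by omega)
    have b2 := hBY.bounds hM hY.1.permRel (by omega)
    let r : ℕ → ℕ := fun i => if i < g + p then a' + i else a + (i - (g + p))
    let c : ℕ → ℕ := fun i => if i < g + q then b + i else b' + (i - (g + q))
    have hr (i : ℕ) (hi : i < g + p + g) : r i < N := by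
      simp only [r]; split_ifs <;> omega
    have hc (i : ℕ) (hi : i < g + q + g) : c i < N := by
      simp only [c]; split_ifs <;> omega
    let K : Matrix (Fin (g + p + g)) (Fin (g + q + g)) Bool :=
      fun i j => M ⟨r i, hr i i.2⟩ ⟨c j, hc j j.2⟩
    have hO : Occ (One M) K r c := by
      refine ⟨fun i j hij hj => ?_, fun i j hij hj => ?_, fun i hi j hj => ?_⟩
      · simp only [r]; split_ifs <;> omega
      · simp only [c]; split_ifs <;> omega
      · rw [one_mk (hr i hi) (hc j hj), one_mk hi hj]
    refine ⟨⟨_, _, K⟩, isPartialPattern_submatrix hM hO, rfl, rfl, fun i j => ?_, fun i j => ?_,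
      contains_iff.2 ⟨r, c, hO, hr, hc⟩⟩
    · have e : g + p + g - g = g + p := by omega
      refine ⟨by simp only [e]; omega, by simp only; omega, ?_⟩
      rw [Bool.eq_iff_iff, ← one_fin, ← one_fin (M := X), ← hBX i i.2 j j.2]
      simp only [e]
      rw [← hO.iff _ (by omega) _ (by omega)]
      simp [r, c, show (j : ℕ) < g + q by omega]
    · have e : g + q + g - g = g + q := by omega
      refine ⟨by simp only; omega, by simp only [e]; omega, ?_⟩
      rw [Bool.eq_iff_iff, ← one_fin, ← one_fin (M := Y), ← hBY i i.2 j j.2]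
      simp only [e]
      rw [← hO.iff _ (by omega) _ (by omega)]
      simp [r, c, show (i : ℕ) < g + p by omega]

/-- For a block `B` and a block `T v` above and to the right of it: if there are rows between them,
then there are at most `3g` columns between them, and if there are columns between them, then there
are at most `3g` rows between them. -/
def Close (E : ℕ → ℕ → Block V Γ.Letter → Prop) (g : ℕ) : Prop :=
  ∀ {a b a' b' : ℕ} {v : V}, E a b .B → E a' b' (.T v) →
    ¬ (a' + g + 1 ≤ a ∧ b + g + (3 * g + 1) ≤ b') ∧ ¬ (a' + g + (3 * g + 1) ≤ a ∧ b + g + 1 ≤ b')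

theorem avoids_F2_iff (hA : ∀ s, A s ∈ alphabet g) {n : ℕ}
    {M : Matrix (Fin n) (Fin n) Bool} (hM : IsPermRel n (One M)) (hC : Consecutive g (One M)) :
    (∀ K ∈ F2 Γ A, ¬ Contains M K) ↔ Close (Erased A (One M)) g := by
  have key (p q : ℕ) (s : Block V Γ.Letter) (v : V) :=
    exists_corner_pattern_iff (p := p) (q := q) hM hC (hA s) (hA (.T v))
  constructor
  · rintro h a b a' b' v ⟨s, hs, h1⟩ h2
    rw [Block.erase_eq_B] at hs
    rw [erased_iff (by simp) (by simp)] at h2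
    constructor
    · rintro ⟨h3, h4⟩
      obtain ⟨K, k1, k2, k3, k4, k5, k6⟩ := (key _ _ s v).2 ⟨a, b, a', b', h1, h2, h3, h4⟩
      exact h K ⟨k1, Or.inl ⟨by omega, by omega⟩, ⟨s, hs, k4⟩, ⟨v, k5⟩⟩ k6
    · rintro ⟨h3, h4⟩
      obtain ⟨K, k1, k2, k3, k4, k5, k6⟩ := (key _ _ s v).2 ⟨a, b, a', b', h1, h2, h3, h4⟩
      exact h K ⟨k1, Or.inr ⟨by omega, by omega⟩, ⟨s, hs, k4⟩, ⟨v, k5⟩⟩ k6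
  · rintro h K ⟨k1, k2, ⟨s, hs, k3⟩, ⟨v, k4⟩⟩ hK
    rcases k2 with ⟨h1, h2⟩ | ⟨h1, h2⟩
    · obtain ⟨a, b, a', b', h5, h6, h7, h8⟩ := (key 1 (3 * g + 1) s v).1
        ⟨K, k1, by omega, by omega, k3, k4, hK⟩
      exact (h ⟨s, Block.erase_eq_B.2 hs, h5⟩ ((erased_iff (by simp) (by simp)).2 h6)).1 ⟨h7, h8⟩
    · obtain ⟨a, b, a', b', h5, h6, h7, h8⟩ := (key (3 * g + 1) 1 s v).1
        ⟨K, k1, by omega, by omega, k3, k4, hK⟩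
      exact (h ⟨s, Block.erase_eq_B.2 hs, h5⟩ ((erased_iff (by simp) (by simp)).2 h6)).2 ⟨h7, h8⟩

theorem one_append_row_right {m n k : ℕ} (X : Matrix (Fin m) (Fin n) Bool) (i j : ℕ) :
    One (Fin.append X (fun _ _ => false) : Matrix (Fin (m + k)) (Fin n) Bool) i j ↔ One X i j := by
  constructor
  · rintro ⟨hi, hj, h⟩
    by_cases h1 : i < m
    · exact ⟨h1, hj, by rwa [← congrFun (Fin.append_left X (fun _ _ => false) ⟨i, h1⟩) ⟨j, hj⟩]⟩
    · have e : (⟨i, hi⟩ : Fin (m + k)) = Fin.natAdd m ⟨i - m, by omega⟩ := by ext; simp; omega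
      rw [e, congrFun (Fin.append_right X (fun _ _ => false) _) ⟨j, hj⟩] at h
      simp at h
  · rintro ⟨hi, hj, h⟩
    refine ⟨by omega, hj, ?_⟩
    rwa [← congrFun (Fin.append_left X (fun _ _ => false) ⟨i, hi⟩) ⟨j, hj⟩] at h

theorem one_append_row_left {m n k : ℕ} (X : Matrix (Fin m) (Fin n) Bool) (i j : ℕ) :
    One (Fin.append (fun _ _ => false) X : Matrix (Fin (k + m)) (Fin n) Bool) i j ↔
      k ≤ i ∧ One X (i - k) j := by
  constructor
  · rintro ⟨hi, hj, h⟩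
    by_cases h1 : i < k
    · have := congrFun (Fin.append_left (fun _ _ => false) X ⟨i, h1⟩) ⟨j, hj⟩
      exact absurd (h.symm.trans this) (by simp)
    · have e : (⟨i, hi⟩ : Fin (k + m)) = Fin.natAdd k ⟨i - k, by omega⟩ := by ext; simp; omega
      rw [e, congrFun (Fin.append_right (fun _ _ => false) X _) ⟨j, hj⟩] at h
      exact ⟨by omega, by omega, hj, h⟩
  · rintro ⟨h1, hi, hj, h⟩
    refine ⟨by omega, hj, ?_⟩
    have e : (⟨i, by omega⟩ : Fin (k + m)) = Fin.natAdd k ⟨i - k, by omega⟩ := by ext; simp; omega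
    rw [e, congrFun (Fin.append_right (fun _ _ => false) X _) ⟨j, hj⟩]
    exact h

theorem one_append_col_right {m n k : ℕ} (X : Matrix (Fin m) (Fin n) Bool) (i j : ℕ) :
    One ((fun i => Fin.append (X i) (fun _ => false)) : Matrix (Fin m) (Fin (n + k)) Bool) i j ↔
      One X i j := by
  constructor
  · rintro ⟨hi, hj, h⟩
    by_cases h1 : j < n
    · exact ⟨hi, h1, by rwa [← Fin.append_left (X ⟨i, hi⟩) (fun _ => false) ⟨j, h1⟩]⟩
    · have e : (⟨j, hj⟩ : Fin (n + k)) = Fin.natAdd n ⟨j - n, by omega⟩ := by ext; simp; omega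
      rw [e] at h
      exact absurd (h.symm.trans (Fin.append_right (X ⟨i, hi⟩) (fun _ => false) _)) (by simp)
  · rintro ⟨hi, hj, h⟩
    refine ⟨hi, by omega, ?_⟩
    rwa [← Fin.append_left (X ⟨i, hi⟩) (fun _ => false) ⟨j, hj⟩] at h

theorem one_append_col_left {m n k : ℕ} (X : Matrix (Fin m) (Fin n) Bool) (i j : ℕ) :
    One ((fun i => Fin.append (fun _ => false) (X i)) : Matrix (Fin m) (Fin (k + n)) Bool) i j ↔
      k ≤ j ∧ One X i (j - k) := by
  constructor
  · rintro ⟨hi, hj, h⟩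
    by_cases h1 : j < k
    · have := Fin.append_left (fun _ => false) (X ⟨i, hi⟩) ⟨j, h1⟩
      exact absurd (h.symm.trans this) (by simp)
    · have e : (⟨j, hj⟩ : Fin (k + n)) = Fin.natAdd k ⟨j - k, by omega⟩ := by ext; simp; omega
      rw [e] at h
      exact ⟨by omega, hi, by omega, (Fin.append_right (fun _ => false) (X ⟨i, hi⟩) _).symm.trans h⟩
  · rintro ⟨h1, hi, hj, h⟩
    refine ⟨hi, by omega, ?_⟩
    have e : (⟨j, by omega⟩ : Fin (k + n)) = Fin.natAdd k ⟨j - k, by omega⟩ := by ext; simp; omega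
    rw [e]
    exact (Fin.append_right (fun _ => false) (X ⟨i, hi⟩) _).trans h

/-- The blocks `P` are close to the upper and to the left border of an `N × N` matrix, the blocks
`Q` are close to the lower and to the right border. -/
structure NearBorder (E : ℕ → ℕ → Block V Γ.Letter → Prop) (g N : ℕ) : Prop where
  P : ∀ {a b}, E a b .P → a ≤ g ∧ b ≤ g
  Q : ∀ {a b}, E a b .Q → N ≤ a + 2 * g ∧ N ≤ b + 2 * g

theorem contains_append_row_right_iff {N k : ℕ} {M : Matrix (Fin N) (Fin N) Bool}
    (hM : IsPermRel N (One M)) (hC : Consecutive g (One M)) {X : Matrix (Fin g) (Fin g) Bool}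
    (hX : X ∈ alphabet g) : Contains M ⟨g + k, g, Fin.append X (fun _ _ => false)⟩ ↔
      ∃ a b, Blk (One M) a b X ∧ a + g + k ≤ N := by
  have hg := seven_le_of_mem_alphabet hX
  rw [contains_iff]
  constructor
  · rintro ⟨r, c, hO, hr, hc⟩
    dsimp only at hO hr hc
    have o : Occ (One M) X r c := ⟨fun i j hij hj => hO.incr_row i j hij (by omega), hO.incr_col,
      fun i hi j hj => by rw [hO.iff i (by omega) j hj]; exact one_append_row_right X i j⟩
    have hc := hC _ hX _ _ o
    refine ⟨_, _, o.blk (fun i hi => (hc i hi).1) (fun i hi => (hc i hi).2), ?_⟩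
    have := hO.incr_row.add_le (i := 0) (j := g + k - 1) (by omega) (by omega)
    have := hr (g + k - 1) (by omega)
    omega
  · rintro ⟨a, b, hB, hab⟩
    have hb := hB.bounds hM hX.1.permRel (by omega)
    refine ⟨(a + ·), (b + ·), ⟨fun i j hij _ => by omega,
      fun i j hij _ => by omega, fun i hi j hj => ?_⟩,
      fun i hi => by dsimp only at hi ⊢; omega, fun i hi => by dsimp only at hi ⊢; omega⟩
    dsimp only at hi hj ⊢
    refine Iff.trans ?_ (one_append_row_right X i j).symm
    by_cases h1 : i < g
    · exact hB i h1 j hj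
    · refine ⟨fun h => ?_, fun ⟨h, _⟩ => absurd h h1⟩
      have := (hB.interval hM hX.1.permRel h).2 ⟨by omega, by omega⟩
      omega

theorem contains_append_row_left_iff {N k : ℕ} {M : Matrix (Fin N) (Fin N) Bool}
    (hM : IsPermRel N (One M)) (hC : Consecutive g (One M)) {X : Matrix (Fin g) (Fin g) Bool}
    (hX : X ∈ alphabet g) : Contains M ⟨k + g, g, Fin.append (fun _ _ => false) X⟩ ↔
      ∃ a b, Blk (One M) a b X ∧ k ≤ a := by
  have hg := seven_le_of_mem_alphabet hX
  rw [contains_iff]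
  constructor
  · rintro ⟨r, c, hO, hr, hc⟩
    dsimp only at hO hr hc
    have o : Occ (One M) X (fun i => r (k + i)) c :=
      ⟨fun i j hij hj => hO.incr_row _ _ (by omega) (by omega), hO.incr_col,
      fun i hi j hj => by
        rw [hO.iff _ (by omega) j hj]
        exact (one_append_row_left X _ j).trans (by simp)⟩
    have hc := hC _ hX _ _ o
    refine ⟨_, _, o.blk (fun i hi => (hc i hi).1) (fun i hi => (hc i hi).2), ?_⟩
    have := hO.incr_row.add_le (i := 0) (j := k) (by omega) (by omega)
    simp only [add_zero]
    omega
  · rintro ⟨a, b, hB, hab⟩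
    have hb := hB.bounds hM hX.1.permRel (by omega)
    refine ⟨(a - k + ·), (b + ·), ⟨fun i j hij _ => by omega,
      fun i j hij _ => by omega, fun i hi j hj => ?_⟩,
      fun i hi => by dsimp only at hi ⊢; omega, fun i hi => by dsimp only at hi ⊢; omega⟩
    dsimp only at hi hj ⊢
    refine Iff.trans ?_ (one_append_row_left X i j).symm
    by_cases h1 : k ≤ i
    · rw [← hB (i - k) (by omega) j hj]
      simp [h1, show a - k + i = a + (i - k) by omega]
    · refine ⟨fun h => ?_, fun ⟨h, _⟩ => absurd h h1⟩
      have := (hB.interval hM hX.1.permRel h).2 ⟨by omega, by omega⟩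
      omega

theorem contains_append_col_right_iff {N k : ℕ} {M : Matrix (Fin N) (Fin N) Bool}
    (hM : IsPermRel N (One M)) (hC : Consecutive g (One M)) {X : Matrix (Fin g) (Fin g) Bool}
    (hX : X ∈ alphabet g) : Contains M ⟨g, g + k, fun i => Fin.append (X i) (fun _ => false)⟩ ↔
      ∃ a b, Blk (One M) a b X ∧ b + g + k ≤ N := by
  have hg := seven_le_of_mem_alphabet hX
  rw [contains_iff]
  constructor
  · rintro ⟨r, c, hO, hr, hc⟩
    dsimp only at hO hr hc
    have o : Occ (One M) X r c := ⟨hO.incr_row, fun i j hij hj => hO.incr_col i j hij (by omega),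
      fun i hi j hj => by rw [hO.iff i hi j (by omega)]; exact one_append_col_right X i j⟩
    have hc' := hC _ hX _ _ o
    refine ⟨_, _, o.blk (fun i hi => (hc' i hi).1) (fun i hi => (hc' i hi).2), ?_⟩
    have := hO.incr_col.add_le (i := 0) (j := g + k - 1) (by omega) (by omega)
    have := hc (g + k - 1) (by omega)
    omega
  · rintro ⟨a, b, hB, hab⟩
    have hb := hB.bounds hM hX.1.permRel (by omega)
    refine ⟨(a + ·), (b + ·), ⟨fun i j hij _ => by omega,
      fun i j hij _ => by omega, fun i hi j hj => ?_⟩,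
      fun i hi => by dsimp only at hi ⊢; omega, fun i hi => by dsimp only at hi ⊢; omega⟩
    dsimp only at hi hj ⊢
    refine Iff.trans ?_ (one_append_col_right X i j).symm
    by_cases h1 : j < g
    · exact hB i hi j h1
    · refine ⟨fun h => ?_, fun ⟨_, h, _⟩ => absurd h h1⟩
      have := (hB.interval hM hX.1.permRel h).1 ⟨by omega, by omega⟩
      omega

theorem contains_append_col_left_iff {N k : ℕ} {M : Matrix (Fin N) (Fin N) Bool}
    (hM : IsPermRel N (One M)) (hC : Consecutive g (One M)) {X : Matrix (Fin g) (Fin g) Bool}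
    (hX : X ∈ alphabet g) : Contains M ⟨g, k + g, fun i => Fin.append (fun _ => false) (X i)⟩ ↔
      ∃ a b, Blk (One M) a b X ∧ k ≤ b := by
  have hg := seven_le_of_mem_alphabet hX
  rw [contains_iff]
  constructor
  · rintro ⟨r, c, hO, hr, hc⟩
    dsimp only at hO hr hc
    have o : Occ (One M) X r (fun i => c (k + i)) :=
      ⟨hO.incr_row, fun i j hij hj => hO.incr_col _ _ (by omega) (by omega),
      fun i hi j hj => by
        rw [hO.iff i hi _ (by omega)]
        exact (one_append_col_left X i _).trans (by simp)⟩
    have hc := hC _ hX _ _ o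
    refine ⟨_, _, o.blk (fun i hi => (hc i hi).1) (fun i hi => (hc i hi).2), ?_⟩
    have := hO.incr_col.add_le (i := 0) (j := k) (by omega) (by omega)
    simp only [add_zero]
    omega
  · rintro ⟨a, b, hB, hab⟩
    have hb := hB.bounds hM hX.1.permRel (by omega)
    refine ⟨(a + ·), (b - k + ·), ⟨fun i j hij _ => by omega,
      fun i j hij _ => by omega, fun i hi j hj => ?_⟩,
      fun i hi => by dsimp only at hi ⊢; omega, fun i hi => by dsimp only at hi ⊢; omega⟩
    dsimp only at hi hj ⊢
    refine Iff.trans ?_ (one_append_col_left X i j).symm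
    by_cases h1 : k ≤ j
    · rw [← hB i hi (j - k) (by omega)]
      simp [h1, show b - k + j = b + (j - k) by omega]
    · refine ⟨fun h => ?_, fun ⟨h, _⟩ => absurd h h1⟩
      have := (hB.interval hM hX.1.permRel h).1 ⟨by omega, by omega⟩
      omega

theorem avoids_F3_iff (hA : ∀ s, A s ∈ alphabet g) {n : ℕ}
    {M : Matrix (Fin n) (Fin n) Bool} (hM : IsPermRel n (One M)) (hC : Consecutive g (One M)) :
    (∀ K ∈ F3 Γ A, ¬ Contains M K) ↔ NearBorder (Erased A (One M)) g n := by
  have k1 := contains_append_row_right_iff (k := g + 1) hM hC (hA .Q)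
  have k2 := contains_append_row_left_iff (k := g + 1) hM hC (hA .P)
  have k3 := contains_append_col_right_iff (k := g + 1) hM hC (hA .Q)
  have k4 := contains_append_col_left_iff (k := g + 1) hM hC (hA .P)
  constructor
  · intro h
    have h1 := mt k1.2 (h _ (by simp [F3]))
    have h2 := mt k2.2 (h _ (by simp [F3]))
    have h3 := mt k3.2 (h _ (by simp [F3]))
    have h4 := mt k4.2 (h _ (by simp [F3]))
    push Not at h1 h2 h3 h4
    refine ⟨fun {a b} hE => ?_, fun {a b} hE => ?_⟩
    · rw [erased_iff (by simp) (by simp)] at hE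
      have := h2 a b hE; have := h4 a b hE; omega
    · rw [erased_iff (by simp) (by simp)] at hE
      have := h1 a b hE; have := h3 a b hE; omega
  · rintro h K (rfl | rfl | rfl | rfl) hK
    · obtain ⟨a, b, hb, h1⟩ := k1.1 hK
      have := h.Q ((erased_iff (by simp) (by simp)).2 hb)
      omega
    · obtain ⟨a, b, hb, h1⟩ := k2.1 hK
      have := h.P ((erased_iff (by simp) (by simp)).2 hb)
      omega
    · obtain ⟨a, b, hb, h1⟩ := k3.1 hK
      have := h.Q ((erased_iff (by simp) (by simp)).2 hb)
      omega
    · obtain ⟨a, b, hb, h1⟩ := k4.1 hK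
      have := h.P ((erased_iff (by simp) (by simp)).2 hb)
      omega

/-! ### Avoidance of all forbidden patterns -/

/-- The conditions that the forbidden patterns `F₂`, `F₃` and `F₅` impose on the blocks recorded
by `E`. -/
structure Admissible (E : ℕ → ℕ → Block V Γ.Letter → Prop) (g N : ℕ) : Prop where
  close : Close E g
  nearBorder : NearBorder E g N
  nonCrossing : NonCrossing E g

theorem avoids_forbidden_iff (hA : ∀ s, A s ∈ alphabet g) {n : ℕ}
    {M : Matrix (Fin n) (Fin n) Bool} (hM : IsPermRel n (One M)) :
    (∀ K ∈ forbidden Γ A, ¬ Contains M K) ↔ Consecutive g (One M) ∧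
      Admissible (Erased A (One M)) g n ∧
      ∀ a b, Blocked (Erased A (One M)) g a b → ¬ Blk (One M) a b (A .B') := by
  constructor
  · intro h
    have hC := (avoids_F1_iff (g := g) hM).1 (fun K hK => h K (by simp [forbidden, hK]))
    exact ⟨hC, ⟨(avoids_F2_iff hA hM hC).1 (fun K hK => h K (by simp [forbidden, hK])),
      (avoids_F3_iff hA hM hC).1 (fun K hK => h K (by simp [forbidden, hK])),
      (avoids_F5_iff hA hM hC).1 (fun K hK => h K (by simp [forbidden, hK]))⟩,
      (avoids_F4_iff hA hM hC).1 (fun K hK => h K (by simp [forbidden, hK]))⟩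
  · rintro ⟨hC, ⟨h2, h3, h5⟩, h4⟩ K ((((hK | hK) | hK) | hK) | hK)
    · exact (avoids_F1_iff hM).2 hC K hK
    · exact (avoids_F2_iff hA hM hC).2 h2 K hK
    · exact (avoids_F3_iff hA hM hC).2 h3 K hK
    · exact (avoids_F4_iff hA hM hC).2 h4 K hK
    · exact (avoids_F5_iff hA hM hC).2 h5 K hK

theorem contains_alphabet_iff {N : ℕ} {M : Matrix (Fin N) (Fin N) Bool}
    (hM : IsPermRel N (One M)) (hC : Consecutive g (One M)) {X : Matrix (Fin g) (Fin g) Bool}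
    (hX : X ∈ alphabet g) : Contains M ⟨g, g, X⟩ ↔ ∃ a b, Blk (One M) a b X := by
  rw [contains_iff]
  constructor
  · rintro ⟨r, c, hO, -, -⟩
    have hc := hC _ hX _ _ hO
    exact ⟨_, _, hO.blk (fun i hi => (hc i hi).1) (fun i hi => (hc i hi).2)⟩
  · rintro ⟨a, b, hB⟩
    have hb := hB.bounds hM hX.1.permRel (by have := seven_le_of_mem_alphabet hX; omega)
    exact ⟨_, _, hB.occ, fun i hi => by dsimp only at hi ⊢; omega,
      fun i hi => by dsimp only at hi ⊢; omega⟩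

end

/-! ### Replacing a block -/

/-- If two permutations agree outside of a block, the occurrences of the alphabet in the second one
are this block and the occurrences in the first one that avoid the rows and columns of the
block. -/
theorem Occ.of_agree {N g a b : ℕ} {R R1 : ℕ → ℕ → Prop} {X X1 Y : Matrix (Fin g) (Fin g) Bool}
    {r c : ℕ → ℕ} (hR : IsPermRel N R) (hR1 : IsPermRel N R1) (hC : Consecutive g R)
    (hX : X ∈ alphabet g) (hX1 : X1 ∈ alphabet g) (hY : Y ∈ alphabet g)
    (hB : Blk R a b X) (hB1 : Blk R1 a b X1)
    (hagree : ∀ i j, ¬ (a ≤ i ∧ i < a + g ∧ b ≤ j ∧ j < b + g) → (R1 i j ↔ R i j))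
    (hO : Occ R1 Y r c) :
    (∀ i < g, r i = a + i ∧ c i = b + i) ∨
      (Occ R Y r c ∧ ∀ i < g, ¬ (a ≤ r i ∧ r i < a + g)) := by
  have hg := seven_le_of_mem_alphabet hX
  have hYP := hY.1.permRel
  have hI1 : ∀ {i j}, R1 i j → (a ≤ i ∧ i < a + g ↔ b ≤ j ∧ j < b + g) :=
    fun h => hB1.interval hR1 hX1.1.permRel h
  rcases hO.inter_block hY.1 (fun i j h => hI1 h) with ⟨hr, hc⟩ | h
  swap
  · exact Or.inl h
  right
  by_cases hex : ∃ i0 < g, a ≤ r i0 ∧ r i0 < a + g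
  swap
  · push Not at hex
    refine ⟨⟨hO.incr_row, hO.incr_col, fun i hi j hj => ?_⟩, fun i hi h => ?_⟩
    · rw [← hagree _ _ (fun h => absurd (hex i hi h.1) (by omega)), hO.iff i hi j hj]
    · exact absurd (hex i hi h.1) (by omega)
  · exfalso
    obtain ⟨i0, hi0, hi1, hi2⟩ := hex
    obtain ⟨j0, hij0⟩ := hYP.exists_col hi0
    have hj0 := hYP.lt_col hij0
    have hj1 := (hI1 ((hO.iff _ hi0 _ hj0).2 hij0)).1 ⟨hi1, hi2⟩
    -- replace the only entry of the occurrence in the block by a one of the block `X`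
    obtain ⟨y, hxy⟩ := hX.1.permRel.exists_col (a := 0) (by omega)
    have hy := hX.1.permRel.lt_col hxy
    have hRxy : R a (b + y) := by simpa using (hB 0 (by omega) y hy).2 hxy
    have hO' : Occ R Y (Function.update r i0 a) (Function.update c j0 (b + y)) := by
      refine ⟨fun i j hij hj => ?_, fun i j hij hj => ?_, fun i hi j hj => ?_⟩
      · have h1 := hO.incr_row i j hij hj
        by_cases e1 : i = i0
        · subst e1
          have := hr i hi0 j hj
          rw [Function.update_self, Function.update_of_ne (by omega)]
          omega
        · by_cases e2 : j = i0
          · subst e2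
            have := hr j hj i (by omega)
            rw [Function.update_self, Function.update_of_ne (by omega)]
            omega
          · rwa [Function.update_of_ne e1, Function.update_of_ne e2]
      · have h1 := hO.incr_col i j hij hj
        by_cases e1 : i = j0
        · subst e1
          have := hc i hj0 j hj
          rw [Function.update_self, Function.update_of_ne (by omega)]
          omega
        · by_cases e2 : j = j0
          · subst e2
            have := hc j hj i (by omega)
            rw [Function.update_self, Function.update_of_ne (by omega)]
            omega
          · rwa [Function.update_of_ne e1, Function.update_of_ne e2]
      · by_cases e1 : i = i0
        · subst e1
          rw [Function.update_self]
          by_cases e2 : j = j0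
          · subst e2
            rw [Function.update_self]
            exact ⟨fun _ => hij0, fun _ => hRxy⟩
          · rw [Function.update_of_ne e2]
            constructor
            · intro h
              have := hR.col_unique h hRxy
              have := hc j0 hj0 j hj hj1.1 hj1.2 (by omega) (by omega)
              omega
            · intro h
              exact absurd (hYP.col_unique h hij0) e2
        · rw [Function.update_of_ne e1]
          have hri : ¬ (a ≤ r i ∧ r i < a + g) :=
            fun h => e1 (hr i hi i0 hi0 h.1 h.2 hi1 hi2)
          by_cases e2 : j = j0
          · subst e2
            rw [Function.update_self]
            constructor
            · intro h
              have := hR.row_unique h hRxy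
              omega
            · intro h
              exact absurd (hYP.row_unique h hij0) e1
          · rw [Function.update_of_ne e2, ← hagree _ _ (fun h => hri ⟨h.1, h.2.1⟩), hO.iff i hi j hj]
    have hcons := hC Y hY _ _ hO'
    have hblk := hO'.blk (fun i hi => (hcons i hi).1) (fun i hi => (hcons i hi).2)
    have e0 := (hcons i0 hi0).1
    rw [Function.update_self] at e0
    have e := hblk.eq_of_row hR hY.1 hX.1 (by omega) hB (by omega) (by omega)
    have e3 := (hcons (g - 1) (by omega)).1
    rw [Function.update_of_ne (by omega), e.1] at e3
    have := hr i0 hi0 (g - 1) (by omega) hi1 hi2 (by omega) (by omega)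
    omega

theorem Consecutive.of_agree {N g a b : ℕ} {R R1 : ℕ → ℕ → Prop}
    {X X1 : Matrix (Fin g) (Fin g) Bool}
    (hR : IsPermRel N R) (hR1 : IsPermRel N R1) (hC : Consecutive g R)
    (hX : X ∈ alphabet g) (hX1 : X1 ∈ alphabet g) (hB : Blk R a b X) (hB1 : Blk R1 a b X1)
    (hagree : ∀ i j, ¬ (a ≤ i ∧ i < a + g ∧ b ≤ j ∧ j < b + g) → (R1 i j ↔ R i j)) :
    Consecutive g R1 := by
  intro Y hY r c hO i hi
  rcases hO.of_agree hR hR1 hC hX hX1 hY hB hB1 hagree with h | h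
  · have := h 0 (by omega)
    have := h i hi
    omega
  · exact hC Y hY r c h.1 i hi

theorem Blk.of_agree {N g a b a' b' : ℕ} {R R1 : ℕ → ℕ → Prop}
    {X X1 Y : Matrix (Fin g) (Fin g) Bool}
    (hR : IsPermRel N R) (hR1 : IsPermRel N R1) (hC : Consecutive g R)
    (hX : X ∈ alphabet g) (hX1 : X1 ∈ alphabet g) (hY : Y ∈ alphabet g)
    (hB : Blk R a b X) (hB1 : Blk R1 a b X1)
    (hagree : ∀ i j, ¬ (a ≤ i ∧ i < a + g ∧ b ≤ j ∧ j < b + g) → (R1 i j ↔ R i j))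
    (h : Blk R1 a' b' Y) (hne : ¬ (a' = a ∧ b' = b)) : Blk R a' b' Y := by
  rcases h.occ.of_agree hR hR1 hC hX hX1 hY hB hB1 hagree with h' | h'
  · have := h' 0 (by have := seven_le_of_mem_alphabet hX; omega)
    omega
  · exact h'.1.iff

/-- The matrix `M` with the block at `(a, b)` replaced by `X`. -/
noncomputable def replaceBlock {N g : ℕ} (M : Matrix (Fin N) (Fin N) Bool) (a b : ℕ)
    (X : Matrix (Fin g) (Fin g) Bool) : Matrix (Fin N) (Fin N) Bool := fun i j =>
  if h : (a ≤ i ∧ i < a + g) ∧ (b ≤ j ∧ j < b + g) then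
    X ⟨i - a, by omega⟩ ⟨j - b, by omega⟩ else M i j

section Replace

variable {N g a b : ℕ} {M : Matrix (Fin N) (Fin N) Bool} {X X1 : Matrix (Fin g) (Fin g) Bool}

theorem one_replaceBlock_of_not (i j : ℕ) (h : ¬ (a ≤ i ∧ i < a + g ∧ b ≤ j ∧ j < b + g)) :
    One (replaceBlock M a b X) i j ↔ One M i j := by
  by_cases hij : i < N ∧ j < N
  · rw [one_mk hij.1 hij.2, one_mk hij.1 hij.2, replaceBlock, dif_neg]
    intro h'; exact h ⟨h'.1.1, h'.1.2, h'.2.1, h'.2.2⟩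
  · exact ⟨fun ⟨x, y, _⟩ => absurd ⟨x, y⟩ hij, fun ⟨x, y, _⟩ => absurd ⟨x, y⟩ hij⟩

theorem blk_replaceBlock (ha : a + g ≤ N) (hb : b + g ≤ N) :
    Blk (One (replaceBlock M a b X)) a b X := by
  intro i hi j hj
  rw [one_mk (by omega) (by omega), replaceBlock, dif_pos (by simp; omega), one_mk hi hj]
  simp

theorem isPermRel_replaceBlock (hM : IsPermRel N (One M)) (hX : IsPermRel g (One X))
    (hX1 : IsPermRel g (One X1)) (hg : 0 < g) (hB : Blk (One M) a b X) :
    IsPermRel N (One (replaceBlock M a b X1)) := by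
  obtain ⟨ha, hb⟩ := hB.bounds hM hX hg
  have hB1 := blk_replaceBlock (M := M) (X := X1) ha hb
  have hI {i j : ℕ} : One M i j → (a ≤ i ∧ i < a + g ↔ b ≤ j ∧ j < b + g) :=
    fun h => hB.interval hM hX h
  -- the ones in the rows or columns of the new block are inside of the block
  have hI1 {i j : ℕ} (h : One (replaceBlock M a b X1) i j) :
      (a ≤ i ∧ i < a + g ∧ b ≤ j ∧ j < b + g ∧ One X1 (i - a) (j - b)) ∨
      (¬ (a ≤ i ∧ i < a + g) ∧ ¬ (b ≤ j ∧ j < b + g) ∧ One M i j) := by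
    by_cases hin : a ≤ i ∧ i < a + g ∧ b ≤ j ∧ j < b + g
    · left
      have := hB1 (i - a) (by omega) (j - b) (by omega)
      rw [show a + (i - a) = i by omega, show b + (j - b) = j by omega] at this
      exact ⟨hin.1, hin.2.1, hin.2.2.1, hin.2.2.2, this.1 h⟩
    · right
      rw [one_replaceBlock_of_not _ _ hin] at h
      have := hI h
      exact ⟨by tauto, by tauto, h⟩
  refine ⟨fun ⟨h, _, _⟩ => h, fun ⟨_, h, _⟩ => h, fun {i} hi => ?_, fun {j} hj => ?_,
    fun {i j j'} h h' => ?_, fun {i i' j} h h' => ?_⟩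
  · by_cases h : a ≤ i ∧ i < a + g
    · obtain ⟨y, hy⟩ := hX1.exists_col (a := i - a) (by omega)
      have := (hB1 _ (by omega) _ (hX1.lt_col hy)).2 hy
      rw [show a + (i - a) = i by omega] at this
      exact ⟨_, this⟩
    · obtain ⟨y, hy⟩ := hM.exists_col hi
      exact ⟨y, (one_replaceBlock_of_not _ _ (fun h' => h ⟨h'.1, h'.2.1⟩)).2 hy⟩
  · by_cases h : b ≤ j ∧ j < b + g
    · obtain ⟨y, hy⟩ := hX1.exists_row (b := j - b) (by omega)
      have := (hB1 _ (hX1.lt_row hy) _ (by omega)).2 hy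
      rw [show b + (j - b) = j by omega] at this
      exact ⟨_, this⟩
    · obtain ⟨y, hy⟩ := hM.exists_row hj
      exact ⟨y, (one_replaceBlock_of_not _ _ (fun h' => h ⟨h'.2.2.1, h'.2.2.2⟩)).2 hy⟩
  · rcases hI1 h with ⟨h1, h2, h3, h4, h5⟩ | ⟨h1, h2, h3⟩ <;>
      rcases hI1 h' with ⟨h1', h2', h3', h4', h5'⟩ | ⟨h1', h2', h3'⟩
    · have := hX1.col_unique h5 h5'; omega
    · exact absurd ⟨h1, h2⟩ h1'
    · exact absurd ⟨h1', h2'⟩ h1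
    · exact hM.col_unique h3 h3'
  · rcases hI1 h with ⟨h1, h2, h3, h4, h5⟩ | ⟨h1, h2, h3⟩ <;>
      rcases hI1 h' with ⟨h1', h2', h3', h4', h5'⟩ | ⟨h1', h2', h3'⟩
    · have := hX1.row_unique h5 h5'; omega
    · exact absurd ⟨h3, h4⟩ h2'
    · exact absurd ⟨h3', h4'⟩ h2
    · exact hM.row_unique h3 h3'

end Replace

/-! ### The involution -/

section

variable {V : Type*} {Γ : TwoStackAutomaton V} {g N : ℕ}

open Classical in
/-- Exchange `B` and `B'` at `(a, b)`. -/
noncomputable def flipBlock (A : Block V Γ.Letter → Matrix (Fin g) (Fin g) Bool)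
    (M : Matrix (Fin N) (Fin N) Bool) (p : ℕ × ℕ) : Matrix (Fin N) (Fin N) Bool :=
  replaceBlock M p.1 p.2 (if Blk (One M) p.1 p.2 (A .B) then A .B' else A .B)

/-- The permutation matrices that avoid all forbidden patterns, see `avoids_forbidden_iff`. -/
structure Valid (A : Block V Γ.Letter → Matrix (Fin g) (Fin g) Bool)
    (M : Matrix (Fin N) (Fin N) Bool) : Prop where
  perm : IsPermRel N (One M)
  consecutive : Consecutive g (One M)
  admissible : Admissible (Erased A (One M)) g N
  blocked : ∀ a b, Blocked (Erased A (One M)) g a b → ¬ Blk (One M) a b (A .B')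

/-- The blocks `B` and `B'` that can be exchanged without creating a pattern from `F₄`. -/
def free (A : Block V Γ.Letter → Matrix (Fin g) (Fin g) Bool) (R : ℕ → ℕ → Prop) : Set (ℕ × ℕ) :=
  {p | Erased A R p.1 p.2 .B ∧ ¬ Blocked (Erased A R) g p.1 p.2}

variable {A : Block V Γ.Letter → Matrix (Fin g) (Fin g) Bool} {M : Matrix (Fin N) (Fin N) Bool}

theorem erased_B_iff {R : ℕ → ℕ → Prop} {a b : ℕ} :
    Erased A R a b .B ↔ Blk R a b (A .B) ∨ Blk R a b (A .B') := by
  constructor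
  · rintro ⟨t, ht, hb⟩
    rcases Block.erase_eq_B.1 ht with rfl | rfl
    · exact Or.inl hb
    · exact Or.inr hb
  · rintro (h | h)
    · exact ⟨_, rfl, h⟩
    · exact ⟨_, rfl, h⟩

/-- Exchanging `B` and `B'` changes no other block, and it creates no new occurrence of the
alphabet. -/
theorem flipBlock_spec (hA : ∀ s, A s ∈ alphabet g) (hinj : Function.Injective A)
    (hM : IsPermRel N (One M)) (hC : Consecutive g (One M)) {p : ℕ × ℕ}
    (hp : Erased A (One M) p.1 p.2 .B) :
    IsPermRel N (One (flipBlock A M p)) ∧ Consecutive g (One (flipBlock A M p)) ∧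
      Erased A (One (flipBlock A M p)) = Erased A (One M) ∧
      (∀ a b s, ¬ (a = p.1 ∧ b = p.2) →
        (Blk (One (flipBlock A M p)) a b (A s) ↔ Blk (One M) a b (A s))) ∧
      (Blk (One (flipBlock A M p)) p.1 p.2 (A .B) ↔ ¬ Blk (One M) p.1 p.2 (A .B)) := by
  classical
  obtain ⟨s0, hs0, hB⟩ := hp
  rw [Block.erase_eq_B] at hs0
  have hg := seven_le_of_mem_alphabet (hA .B)
  obtain ⟨s1, hs1, e1⟩ : ∃ s1 : Block V Γ.Letter, s1.IsB ∧
      (if Blk (One M) p.1 p.2 (A .B) then A .B' else A .B) = A s1 := by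
    split_ifs
    · exact ⟨.B', Or.inr rfl, rfl⟩
    · exact ⟨.B, Or.inl rfl, rfl⟩
  have hflip : flipBlock A M p = replaceBlock M p.1 p.2 (A s1) := by rw [flipBlock, e1]
  obtain ⟨ha, hb⟩ := hB.bounds hM (hA _).1.permRel (by omega)
  have hB1 : Blk (One (flipBlock A M p)) p.1 p.2 (A s1) := by
    rw [hflip]; exact blk_replaceBlock ha hb
  have hM1 : IsPermRel N (One (flipBlock A M p)) := by
    rw [hflip]
    exact isPermRel_replaceBlock hM (hA s0).1.permRel (hA s1).1.permRel (by omega) hB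
  have hagree (i j : ℕ) (h : ¬ (p.1 ≤ i ∧ i < p.1 + g ∧ p.2 ≤ j ∧ j < p.2 + g)) :
      One (flipBlock A M p) i j ↔ One M i j := by
    rw [hflip]; exact one_replaceBlock_of_not _ _ h
  have hC1 := Consecutive.of_agree hM hM1 hC (hA s0) (hA s1) hB hB1 hagree
  have hne (a b : ℕ) (s : Block V Γ.Letter) (h : ¬ (a = p.1 ∧ b = p.2)) :
      Blk (One (flipBlock A M p)) a b (A s) ↔ Blk (One M) a b (A s) :=
    ⟨fun h' => Blk.of_agree hM hM1 hC (hA s0) (hA s1) (hA s) hB hB1 hagree h' h,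
      fun h' => Blk.of_agree hM1 hM hC1 (hA s1) (hA s0) (hA s) hB1 hB
        (fun i j hij => (hagree i j hij).symm) h' h⟩
  refine ⟨hM1, hC1, ?_, hne, ?_⟩
  · ext a b s
    by_cases h : a = p.1 ∧ b = p.2
    · obtain ⟨rfl, rfl⟩ := h
      -- both matrices have exactly one block there, whose erased name is `B`
      have key (R : ℕ → ℕ → Prop) (t : Block V Γ.Letter) (ht : t.IsB)
          (hb : Blk R p.1 p.2 (A t)) : Erased A R p.1 p.2 s ↔ s = .B := by
        constructor
        · rintro ⟨u, rfl, hu⟩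
          rw [hinj (hu.matrix_eq hb)]
          exact Block.erase_eq_B.2 ht
        · rintro rfl
          exact ⟨t, Block.erase_eq_B.2 ht, hb⟩
      rw [key _ _ hs1 hB1, key _ _ hs0 hB]
    · simp only [Erased, hne a b _ h]
  · constructor
    · intro h h'
      rw [if_pos h'] at e1
      have := hinj (h.matrix_eq (e1 ▸ hB1))
      simp at this
    · intro h
      rw [if_neg h] at e1
      rwa [e1]

/-- Flipping a free block preserves validity: all conditions are stated in terms of the erased
names, except for the one that blocked blocks are `B`, and these are not changed. -/
theorem Valid.flip (hA : ∀ s, A s ∈ alphabet g) (hinj : Function.Injective A)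
    (hM : Valid A M) {p : ℕ × ℕ} (hp : p ∈ free A (One M)) : Valid A (flipBlock A M p) := by
  obtain ⟨h1, h2, h3, h4, h5⟩ := flipBlock_spec hA hinj hM.perm hM.consecutive hp.1
  refine ⟨h1, h2, h3 ▸ hM.admissible, fun a b hab => ?_⟩
  rw [h3] at hab
  rw [h4 a b .B' (by rintro ⟨rfl, rfl⟩; exact hp.2 hab)]
  exact hM.blocked a b hab

theorem flipBlock_flipBlock (hA : ∀ s, A s ∈ alphabet g) (hinj : Function.Injective A)
    (hM : IsPermRel N (One M)) (hC : Consecutive g (One M)) {p : ℕ × ℕ}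
    (hp : Erased A (One M) p.1 p.2 .B) :
    flipBlock A (flipBlock A M p) p = M := by
  classical
  obtain ⟨h1, h2, h3, h4, h5⟩ := flipBlock_spec hA hinj hM hC hp
  have hg := seven_le_of_mem_alphabet (hA .B)
  have hp' := hp
  rw [← h3] at hp'
  obtain ⟨-, -, h3', h4', h5'⟩ := flipBlock_spec hA hinj h1 h2 hp'
  refine matrix_ext_one fun i j => ?_
  by_cases hij : p.1 ≤ i ∧ i < p.1 + g ∧ p.2 ≤ j ∧ j < p.2 + g
  · -- the names of the two blocks agree, hence so do their entries
    have key (R R' : ℕ → ℕ → Prop) (hR : Erased A R p.1 p.2 .B) (hR' : Erased A R' p.1 p.2 .B)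
        (h : Blk R p.1 p.2 (A .B) ↔ Blk R' p.1 p.2 (A .B)) : R i j ↔ R' i j := by
      obtain ⟨s, hs, hs'⟩ : ∃ s, Blk R p.1 p.2 (A s) ∧ Blk R' p.1 p.2 (A s) := by
        rw [erased_B_iff] at hR hR'
        by_cases hB : Blk R p.1 p.2 (A .B)
        · exact ⟨_, hB, h.1 hB⟩
        · exact ⟨_, hR.resolve_left hB, hR'.resolve_left (mt h.2 hB)⟩
      have e1 := hs (i - p.1) (by omega) (j - p.2) (by omega)
      have e2 := hs' (i - p.1) (by omega) (j - p.2) (by omega)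
      rw [show p.1 + (i - p.1) = i by omega, show p.2 + (j - p.2) = j by omega] at e1 e2
      rw [e1, e2]
    refine key _ _ (by rw [h3']; exact hp') hp ?_
    rw [h5', h5, not_not]
  · rw [flipBlock, one_replaceBlock_of_not _ _, flipBlock,
      one_replaceBlock_of_not _ _]
    all_goals exact hij

theorem flipBlock_ne (hA : ∀ s, A s ∈ alphabet g) (hinj : Function.Injective A)
    (hM : IsPermRel N (One M)) (hC : Consecutive g (One M)) {p : ℕ × ℕ}
    (hp : Erased A (One M) p.1 p.2 .B) : flipBlock A M p ≠ M := by
  intro h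
  have := (flipBlock_spec hA hinj hM hC hp).2.2.2.2
  rw [h] at this
  tauto

theorem card_modEq_card_fixedPoints_of_involutive {α : Type*} [Finite α] {f : α → α}
    (hf : Function.Involutive f) : Nat.card α ≡ Nat.card {x // f x = x} [MOD 2] := by
  classical
  have := Fintype.ofFinite α
  have h := Equiv.Perm.card_fixedPoints_modEq (α := α) (f := (f : Function.End α)) (p := 2) (n := 1)
    ((pow_two (M := Function.End α) f).trans hf.comp_self)
  rw [Nat.card_eq_fintype_card, Nat.card_eq_fintype_card]
  convert h
  rfl

/-- Modulo 2, only those valid matrices count in which all blocks `B` and `B'` are blocked: in the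
other ones, one of the blocks that are not blocked can be flipped. -/
theorem ncard_valid_modEq (hA : ∀ s, A s ∈ alphabet g) (hinj : Function.Injective A) (N : ℕ) :
    Set.ncard {M : Matrix (Fin N) (Fin N) Bool | Valid A M ∧ ∃ a b, Erased A (One M) a b .B} ≡
    Set.ncard {M : Matrix (Fin N) (Fin N) Bool | (Valid A M ∧ ∃ a b, Erased A (One M) a b .B) ∧
      free A (One M) = ∅} [MOD 2] := by
  classical
  let S : Set (Matrix (Fin N) (Fin N) Bool) := {M | Valid A M ∧ ∃ a b, Erased A (One M) a b .B}
  -- the choice depends only on the set of free blocks, which does not change in a flip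
  let pick : Set (ℕ × ℕ) → ℕ × ℕ := fun U => if h : U.Nonempty then h.some else (0, 0)
  have hpick {U : Set (ℕ × ℕ)} (h : U.Nonempty) : pick U ∈ U := by
    simp only [pick, h, dif_pos]; exact h.some_mem
  have hfree {M : Matrix (Fin N) (Fin N) Bool} (hM : Valid A M) {p : ℕ × ℕ}
      (hp : p ∈ free A (One M)) : free A (One (flipBlock A M p)) = free A (One M) := by
    simp only [free, (flipBlock_spec hA hinj hM.perm hM.consecutive hp.1).2.2.1]
  let f : S → S := fun M =>
    if h : (free A (One M.1)).Nonempty then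
      ⟨flipBlock A M.1 (pick (free A (One M.1))), M.2.1.flip hA hinj (hpick h), by
        rw [(flipBlock_spec hA hinj M.2.1.perm M.2.1.consecutive (hpick h).1).2.2.1]
        exact M.2.2⟩
    else M
  have hf : Function.Involutive f := by
    rintro ⟨M, hM⟩
    by_cases h : (free A (One M)).Nonempty
    · apply Subtype.ext
      have e := hfree hM.1 (hpick h)
      simp only [f, h, dif_pos, e]
      exact flipBlock_flipBlock hA hinj hM.1.perm hM.1.consecutive (hpick h).1
    · simp [f, h]
  have hfix (M : S) : f M = M ↔ free A (One M.1) = ∅ := by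
    rw [← Set.not_nonempty_iff_eq_empty]
    by_cases h : (free A (One M.1)).Nonempty
    · simp only [f, h, dif_pos, not_true_eq_false, iff_false]
      intro h'
      exact flipBlock_ne hA hinj M.2.1.perm M.2.1.consecutive (hpick h).1 (congrArg Subtype.val h')
    · simp [f, h]
  have key := card_modEq_card_fixedPoints_of_involutive hf
  rw [Nat.card_coe_set_eq] at key
  refine key.trans ?_
  rw [← Nat.card_coe_set_eq]
  rw [Nat.card_congr ((Equiv.subtypeEquivRight hfix).trans (Equiv.subtypeSubtypeEquivSubtypeInter
    (fun M => M ∈ S) (fun M => free A (One M) = ∅)))]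
  rfl

end

/-! ### Balanced words and non-crossing matchings -/

/-- A matching of the pushes and pops of the word `ℓ 0, …, ℓ (n - 1)`, given by the function `q`
that maps every pop to a preceding push of the same letter, such that no two of the pairs that
belong to the same stack cross. -/
structure PopMatching (ℓ : ℕ → Label) (n : ℕ) (q : ℕ → ℕ) : Prop where
  push_of_pop : ∀ {u s i}, u < n → ℓ u = .pop s i → q u < u ∧ ℓ (q u) = .push s i
  inj : ∀ {u w s i s' i'}, u < n → w < n → ℓ u = .pop s i → ℓ w = .pop s' i' → q u = q w → u = w
  surj : ∀ {t s i}, t < n → ℓ t = .push s i → ∃ u < n, q u = t ∧ ℓ u = .pop s i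
  nonCrossing : ∀ {u w s i i'}, u < w → w < n → ℓ u = .pop s i → ℓ w = .pop s i' → q u < q w →
    u < q w

theorem PopMatching.unique {ℓ : ℕ → Label} {n : ℕ} {q q' : ℕ → ℕ} (h : PopMatching ℓ n q)
    (h' : PopMatching ℓ n q') {u : ℕ} {s : Stack} {i : ℤ} (hu : u < n) (hℓ : ℓ u = .pop s i) :
    q u = q' u := by
  induction u using Nat.strong_induction_on generalizing s i with
  | _ u ih =>
    -- at the first pop where the matchings differ, the smaller partner gives a crossing
    have key {q q' : ℕ → ℕ} (h : PopMatching ℓ n q) (h' : PopMatching ℓ n q')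
        (ih : ∀ w < u, ∀ {s i}, w < n → ℓ w = .pop s i → q w = q' w) : ¬ q u < q' u := by
      intro hlt
      obtain ⟨h1, h2⟩ := h'.push_of_pop hu hℓ
      obtain ⟨w, hw, hw1, hw2⟩ := h.surj (h1.trans hu) h2
      rcases lt_trichotomy w u with h3 | rfl | h3
      · have := ih w h3 hw hw2
        exact h3.ne (h'.inj hw hu hw2 hℓ (this.symm.trans hw1))
      · omega
      · have := h.nonCrossing h3 hw hℓ hw2 (by omega)
        omega
    have k1 := key h h' (fun w hw _ _ hn hl => ih w hw hn hl)
    have k2 := key h' h (fun w hw _ _ hn hl => (ih w hw hn hl).symm)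
    omega

/-- The content of a stack. -/
def stackContent (w : List ℤ × List ℤ) : Stack → List ℤ
  | .X => w.1
  | .Y => w.2

theorem stackStep_push {w : List ℤ × List ℤ} {s : Stack} {i : ℤ} :
    ∃ w', stackStep w (.push s i) = some w' ∧ stackContent w' s = i :: stackContent w s ∧
      ∀ s' ≠ s, stackContent w' s' = stackContent w s' := by
  cases s
  · refine ⟨_, rfl, rfl, fun s' hs => ?_⟩
    cases s'
    exacts [absurd rfl hs, rfl]
  · refine ⟨_, rfl, rfl, fun s' hs => ?_⟩
    cases s'
    exacts [rfl, absurd rfl hs]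

theorem stackStep_pop_of_cons {w : List ℤ × List ℤ} {s : Stack} {i : ℤ} {l : List ℤ}
    (h : stackContent w s = i :: l) :
    ∃ w', stackStep w (.pop s i) = some w' ∧ stackContent w' s = l ∧
      ∀ s' ≠ s, stackContent w' s' = stackContent w s' := by
  obtain ⟨w1, w2⟩ := w
  cases s
  · obtain rfl : w1 = i :: l := h
    refine ⟨(l, w2), by simp [stackStep], rfl, fun s' hs => ?_⟩
    cases s'
    exacts [absurd rfl hs, rfl]
  · obtain rfl : w2 = i :: l := h
    refine ⟨(w1, l), by simp [stackStep], rfl, fun s' hs => ?_⟩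
    cases s'
    exacts [rfl, absurd rfl hs]

theorem stackStep_pop_eq_some {w w' : List ℤ × List ℤ} {s : Stack} {i : ℤ}
    (h : stackStep w (.pop s i) = some w') : ∃ l, stackContent w s = i :: l := by
  obtain ⟨w1, w2⟩ := w
  cases s
  · simp only [stackStep, Option.ite_none_right_eq_some, List.head?_eq_some_iff] at h
    exact h.1
  · simp only [stackStep, Option.ite_none_right_eq_some, List.head?_eq_some_iff] at h
    exact h.1

/-- The list `p` consists of the pushes to the stack `s` before step `t` that are not matched
with a pop before step `t`, in decreasing order. -/
def IsOpen (ℓ : ℕ → Label) (t : ℕ) (q : ℕ → ℕ) (s : Stack) (p : List ℕ) : Prop :=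
  p.Pairwise (· > ·) ∧ ∀ j, j ∈ p ↔ j < t ∧ (∃ i, ℓ j = .push s i) ∧
    ∀ u < t, ∀ s' i', ℓ u = .pop s' i' → q u ≠ j

/-- The letter of a label. -/
def Label.letter : Label → ℤ
  | .eps => 0
  | .push _ i => i
  | .pop _ i => i

section

variable {ℓ : ℕ → Label} {t : ℕ} {q : ℕ → ℕ} {s : Stack} {p : List ℕ}

theorem IsOpen.push {i : ℤ} (h : IsOpen ℓ t q s p) (ht : ℓ t = .push s i)
    (hq : ∀ u < t, ∀ s' i', ℓ u = .pop s' i' → q u < u) : IsOpen ℓ (t + 1) q s (t :: p) := by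
  refine ⟨List.pairwise_cons.2 ⟨fun j hj => ((h.2 j).1 hj).1, h.1⟩, fun j => ?_⟩
  rw [List.mem_cons, h.2]
  constructor
  · rintro (rfl | ⟨h1, h2, h3⟩)
    · refine ⟨by omega, ⟨i, ht⟩, fun u hu s' i' hl => ?_⟩
      rcases Nat.lt_succ_iff_lt_or_eq.1 hu with hu | rfl
      · have := hq u hu s' i' hl; omega
      · simp [ht] at hl
    · refine ⟨by omega, h2, fun u hu s' i' hl => ?_⟩
      rcases Nat.lt_succ_iff_lt_or_eq.1 hu with hu | rfl
      · exact h3 u hu s' i' hl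
      · simp [ht] at hl
  · rintro ⟨h1, h2, h3⟩
    rcases Nat.lt_succ_iff_lt_or_eq.1 h1 with h1 | rfl
    · exact Or.inr ⟨h1, h2, fun u hu => h3 u (by omega)⟩
    · exact Or.inl rfl

theorem IsOpen.pop {i : ℤ} {l : List ℕ} (h : IsOpen ℓ t q s (q t :: l)) (ht : ℓ t = .pop s i) :
    IsOpen ℓ (t + 1) q s l := by
  have h1 := List.pairwise_cons.1 h.1
  refine ⟨h1.2, fun j => ?_⟩
  have h2 := h.2 j
  rw [List.mem_cons] at h2
  constructor
  · intro hj
    obtain ⟨h3, h4, h5⟩ := h2.1 (Or.inr hj)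
    refine ⟨by omega, h4, fun u hu s' i' hl => ?_⟩
    rcases Nat.lt_succ_iff_lt_or_eq.1 hu with hu | rfl
    · exact h5 u hu s' i' hl
    · exact (h1.1 j hj).ne'
  · rintro ⟨h3, ⟨k, h4⟩, h5⟩
    have hjt : j ≠ t := by rintro rfl; simp [ht] at h4
    rcases h2.2 ⟨by omega, ⟨k, h4⟩, fun u hu => h5 u (by omega)⟩ with rfl | h6
    · exact absurd rfl (h5 t (by omega) s i ht)
    · exact h6

theorem IsOpen.other (h : IsOpen ℓ t q s p) (h1 : ∀ i, ℓ t ≠ .push s i)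
    (h2 : ∀ s' i', ℓ t = .pop s' i' → ∀ i, ℓ (q t) ≠ .push s i) : IsOpen ℓ (t + 1) q s p := by
  refine ⟨h.1, fun j => ?_⟩
  rw [h.2]
  constructor
  · rintro ⟨h3, ⟨k, h4⟩, h5⟩
    refine ⟨by omega, ⟨k, h4⟩, fun u hu s' i' hl => ?_⟩
    rcases Nat.lt_succ_iff_lt_or_eq.1 hu with hu | rfl
    · exact h5 u hu s' i' hl
    · rintro rfl
      exact h2 s' i' hl k h4
  · rintro ⟨h3, ⟨k, h4⟩, h5⟩
    have hjt : j ≠ t := by rintro rfl; exact h1 k h4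
    exact ⟨by omega, ⟨k, h4⟩, fun u hu => h5 u (by omega)⟩

theorem IsOpen.congr {q' : ℕ → ℕ} (h : IsOpen ℓ t q s p) (hq : ∀ u < t, q u = q' u) :
    IsOpen ℓ t q' s p := by
  refine ⟨h.1, fun j => (h.2 j).trans ?_⟩
  constructor
  · rintro ⟨h1, h2, h3⟩
    exact ⟨h1, h2, fun u hu => hq u hu ▸ h3 u hu⟩
  · rintro ⟨h1, h2, h3⟩
    exact ⟨h1, h2, fun u hu => (hq u hu).symm ▸ h3 u hu⟩

end

/-- The result of the first `t` steps for the word `ℓ`. -/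
def run (ℓ : ℕ → Label) (t : ℕ) : Option (List ℤ × List ℤ) :=
  ((List.range t).map ℓ).foldlM stackStep ([], [])

theorem run_succ (ℓ : ℕ → Label) (t : ℕ) :
    run ℓ (t + 1) = (run ℓ t).bind fun w => stackStep w (ℓ t) := by
  simp only [run, List.range_succ, List.map_append, List.foldlM_append]
  simp

/-- The stacks always hold the letters of the open pushes. The partner of a pop is on top of its
stack because the matching has no crossings. -/
theorem run_of_popMatching {ℓ : ℕ → Label} {n : ℕ} {q : ℕ → ℕ} (h : PopMatching ℓ n q) :
    run ℓ n = some ([], []) := by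
  have key (t : ℕ) (ht : t ≤ n) : ∃ w, ∃ p : Stack → List ℕ, run ℓ t = some w ∧
      ∀ s, IsOpen ℓ t q s (p s) ∧ stackContent w s = (p s).map fun j => (ℓ j).letter := by
    induction t with
    | zero =>
      refine ⟨([], []), fun _ => [], rfl, fun s => ⟨⟨List.Pairwise.nil, by simp⟩, ?_⟩⟩
      cases s <;> rfl
    | succ t ih =>
      classical
      obtain ⟨w, p, hw, hp⟩ := ih (by omega)
      rw [run_succ, hw]
      rcases hl : ℓ t with _ | ⟨s, i⟩ | ⟨s, i⟩
      · exact ⟨w, p, rfl, fun s' => ⟨(hp s').1.other (by simp [hl]) (by simp [hl]), (hp s').2⟩⟩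
      · obtain ⟨w', h1, h2, h3⟩ := stackStep_push (w := w) (s := s) (i := i)
        refine ⟨w', Function.update p s (t :: p s), h1, fun s' => ?_⟩
        by_cases hs : s' = s
        · subst hs
          rw [Function.update_self]
          refine ⟨(hp s').1.push hl fun u hu _ _ hu' => (h.push_of_pop (by omega) hu').1, ?_⟩
          rw [h2, (hp s').2, List.map_cons, hl, Label.letter]
        · rw [Function.update_of_ne hs]
          exact ⟨(hp s').1.other (by simp [hl, Ne.symm hs]) (by simp [hl]),
            (h3 s' hs).trans (hp s').2⟩
      · obtain ⟨hq1, hq2⟩ := h.push_of_pop (u := t) (by omega) hl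
        -- the partner of a pop is the last open push
        have hmem : q t ∈ p s := ((hp s).1.2 _).2 ⟨hq1, ⟨i, hq2⟩, fun u hu s' i' hu' he =>
          hu.ne (h.inj (by omega) (by omega) hu' hl he)⟩
        obtain ⟨j, l, hjl⟩ := List.exists_cons_of_ne_nil (List.ne_nil_of_mem hmem)
        have hj : q t = j := by
          rw [hjl] at hmem
          rcases List.mem_cons.1 hmem with h1 | h1
          · exact h1
          · exfalso
            have h2 := (hp s).1.1
            rw [hjl] at h2
            have h3 := (List.pairwise_cons.1 h2).1 _ h1
            obtain ⟨h4, ⟨k, h5⟩, h6⟩ := ((hp s).1.2 j).1 (by simp [hjl])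
            obtain ⟨w, hw1, hw2, hw3⟩ := h.surj (h4.trans (by omega)) h5
            rcases lt_trichotomy w t with h7 | rfl | h7
            · exact h6 w h7 _ _ hw3 hw2
            · omega
            · have := h.nonCrossing h7 hw1 hl hw3 (by omega)
              omega
        subst hj
        obtain ⟨w', h1, h2, h3⟩ := stackStep_pop_of_cons (w := w) (s := s) (i := i)
          (l := l.map fun j => (ℓ j).letter) (by
            rw [(hp s).2, hjl, List.map_cons, hq2, Label.letter])
        refine ⟨w', Function.update p s l, h1, fun s' => ?_⟩
        by_cases hs : s' = s
        · subst hs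
          rw [Function.update_self]
          exact ⟨IsOpen.pop (hjl ▸ (hp s').1) hl, h2⟩
        · rw [Function.update_of_ne hs]
          exact ⟨(hp s').1.other (by simp [hl]) (by simp [hq2, Ne.symm hs]),
            (h3 s' hs).trans (hp s').2⟩
  obtain ⟨⟨w1, w2⟩, p, hw, hp⟩ := key n le_rfl
  have hempty (s : Stack) : p s = [] := by
    refine List.eq_nil_iff_forall_not_mem.2 fun j hj => ?_
    obtain ⟨h1, ⟨i, h2⟩, h3⟩ := ((hp s).1.2 j).1 hj
    obtain ⟨u, h4, h5, h6⟩ := h.surj h1 h2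
    exact h3 u h4 _ _ h6 h5
  have e1 : w1 = [] := by simpa [hempty, stackContent] using (hp .X).2
  have e2 : w2 = [] := by simpa [hempty, stackContent] using (hp .Y).2
  rw [hw, e1, e2]

/-- Every pop is matched with the push that is on top of its stack. The last property of the
induction hypothesis, that no pair encloses an open push, implies that no crossing arises. -/
theorem exists_popMatching_of_run {ℓ : ℕ → Label} {n : ℕ} (h : run ℓ n = some ([], [])) :
    ∃ q, PopMatching ℓ n q := by
  have key (t : ℕ) (w : List ℤ × List ℤ) (hw : run ℓ t = some w) :
      ∃ (q : ℕ → ℕ) (p : Stack → List ℕ),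
        (∀ u < t, ∀ s i, ℓ u = .pop s i → q u < u ∧ ℓ (q u) = .push s i) ∧
        (∀ u w s i s' i', u < t → w < t → ℓ u = .pop s i → ℓ w = .pop s' i' → q u = q w → u = w) ∧
        (∀ u w s i i', u < w → w < t → ℓ u = .pop s i → ℓ w = .pop s i' → q u < q w → u < q w) ∧
        (∀ s, IsOpen ℓ t q s (p s) ∧ stackContent w s = (p s).map fun j => (ℓ j).letter) ∧
        (∀ s, ∀ j ∈ p s, ∀ u < t, ∀ i, ℓ u = .pop s i → q u < j → u < j) := by
    induction t generalizing w with
    | zero =>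
      obtain rfl : ([], []) = w := by simpa [run] using hw
      refine ⟨id, fun _ => [], by simp, by simp, by simp,
        fun s => ⟨⟨List.Pairwise.nil, by simp⟩, ?_⟩, by simp⟩
      cases s <;> rfl
    | succ t ih =>
      classical
      rw [run_succ, Option.bind_eq_some_iff] at hw
      obtain ⟨w0, hw0, hw⟩ := hw
      obtain ⟨q, p, c1, c2, c3, c4, c5⟩ := ih w0 hw0
      have lt_of {u : ℕ} (hu : u < t + 1) (hne : u ≠ t) : u < t := by omega
      rcases hl : ℓ t with _ | ⟨s, i⟩ | ⟨s, i⟩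
      · have hne {u : ℕ} {s i} (hu : ℓ u = .pop s i) : u ≠ t := by rintro rfl; simp [hl] at hu
        obtain rfl : w0 = w := by simpa [hl, stackStep] using hw
        refine ⟨q, p, fun u hu s i h => c1 u (lt_of hu (hne h)) s i h,
          fun u w s i s' i' hu hw h h' => c2 u w s i s' i' (lt_of hu (hne h)) (lt_of hw (hne h')) h h',
          fun u w s i i' huw hw h h' => c3 u w s i i' huw (lt_of hw (hne h')) h h',
          fun s' => ⟨(c4 s').1.other (by simp [hl]) (by simp [hl]), (c4 s').2⟩,
          fun s j hj u hu i h => c5 s j hj u (lt_of hu (hne h)) i h⟩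
      · have hne {u : ℕ} {s i} (hu : ℓ u = .pop s i) : u ≠ t := by rintro rfl; simp [hl] at hu
        obtain ⟨w', h1, h2, h3⟩ := stackStep_push (w := w0) (s := s) (i := i)
        rw [hl, h1] at hw
        obtain rfl := Option.some.inj hw
        refine ⟨q, Function.update p s (t :: p s), fun u hu s i h => c1 u (lt_of hu (hne h)) s i h,
          fun u w s i s' i' hu hw h h' => c2 u w s i s' i' (lt_of hu (hne h)) (lt_of hw (hne h')) h h',
          fun u w s i i' huw hw h h' => c3 u w s i i' huw (lt_of hw (hne h')) h h',
          fun s' => ?_, fun s' j hj u hu i h => ?_⟩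
        · by_cases hs : s' = s
          · subst hs
            rw [Function.update_self]
            refine ⟨(c4 s').1.push hl fun u hu _ _ hu' => (c1 u hu _ _ hu').1, ?_⟩
            rw [h2, (c4 s').2, List.map_cons, hl, Label.letter]
          · rw [Function.update_of_ne hs]
            exact ⟨(c4 s').1.other (by simp [hl, Ne.symm hs]) (by simp [hl]),
              (h3 s' hs).trans (c4 s').2⟩
        · have hut := lt_of hu (hne h)
          by_cases hs : s' = s
          · subst hs
            rw [Function.update_self] at hj
            rcases List.mem_cons.1 hj with rfl | hj
            · exact fun _ => hut
            · exact c5 s' j hj u hut i h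
          · rw [Function.update_of_ne hs] at hj
            exact c5 s' j hj u hut i h
      · rw [hl] at hw
        obtain ⟨l', hl'⟩ := stackStep_pop_eq_some hw
        obtain ⟨w', h1, h2, h3⟩ := stackStep_pop_of_cons hl'
        rw [h1] at hw
        obtain rfl := Option.some.inj hw
        have hpl := (c4 s).2
        rw [hl'] at hpl
        obtain ⟨j, l, hjl, hj, hl''⟩ := List.map_eq_cons_iff.1 hpl.symm
        obtain ⟨hj1, ⟨k, hj2⟩, hj3⟩ := ((c4 s).1.2 j).1 (by simp [hjl])
        obtain rfl : k = i := by simpa [hj2, Label.letter] using hj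
        -- match the pop with the top of the stack
        have hq {u : ℕ} (hu : u < t) : Function.update q t j u = q u :=
          Function.update_of_ne hu.ne _ _
        have hqt : Function.update q t j t = j := Function.update_self ..
        have cases_of {u : ℕ} (hu : u < t + 1) : u < t ∨ u = t := by omega
        refine ⟨Function.update q t j, Function.update p s l, fun u hu s' i' h => ?_,
          fun u w s1 i1 s2 i2 hu hw h h' he => ?_, fun u w s1 i1 i2 huw hw h h' hlt => ?_,
          fun s' => ?_, fun s' j' hj' u hu i' h hlt => ?_⟩
        · rcases cases_of hu with hu | rfl
          · rw [hq hu]; exact c1 u hu s' i' h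
          · rw [hqt, hj2]
            rw [hl] at h
            simp only [Label.pop.injEq] at h
            exact ⟨hj1, by rw [h.1, h.2]⟩
        · rcases cases_of hu with hu | rfl <;> rcases cases_of hw with hw | rfl
          · rw [hq hu, hq hw] at he; exact c2 u w _ _ _ _ hu hw h h' he
          · rw [hq hu, hqt] at he; exact absurd he (hj3 u hu _ _ h)
          · rw [hq hw, hqt] at he; exact absurd he.symm (hj3 w hw _ _ h')
          · rfl
        · rcases cases_of hw with hw | rfl
          · rw [hq (by omega), hq hw] at hlt
            rw [hq hw]
            exact c3 u w s1 i1 i2 huw hw h h' hlt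
          · rw [hq huw, hqt] at hlt
            rw [hqt]
            rw [hl] at h'
            simp only [Label.pop.injEq] at h'
            obtain ⟨rfl, -⟩ := h'
            exact c5 s j (by simp [hjl]) u huw i1 h hlt
        · by_cases hs : s' = s
          · subst hs
            rw [Function.update_self]
            refine ⟨IsOpen.pop (i := k) ?_ hl, by rw [h2, hl'']⟩
            rw [hqt, ← hjl]
            exact (c4 s').1.congr fun u hu => (hq hu).symm
          · rw [Function.update_of_ne hs]
            refine ⟨((c4 s').1.congr fun u hu => (hq hu).symm).other (by simp [hl]) ?_,
              (h3 s' hs).trans (c4 s').2⟩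
            rw [hqt, hj2]
            simp [Ne.symm hs]
        · by_cases hs : s' = s
          · subst hs
            rw [Function.update_self] at hj'
            rcases cases_of hu with hu | rfl
            · rw [hq hu] at hlt
              exact c5 s' j' (by rw [hjl]; exact List.mem_cons_of_mem _ hj') u hu i' h hlt
            · have := (c4 s').1.1
              rw [hjl] at this
              have := (List.pairwise_cons.1 this).1 j' hj'
              rw [hqt] at hlt
              omega
          · rw [Function.update_of_ne hs] at hj'
            rcases cases_of hu with hu | rfl
            · rw [hq hu] at hlt
              exact c5 s' j' hj' u hu i' h hlt
            · rw [hl] at h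
              simp only [Label.pop.injEq] at h
              exact absurd h.1.symm hs
  obtain ⟨q, p, c1, c2, c3, c4, -⟩ := key n _ h
  refine ⟨q, fun hu => c1 _ hu _ _, fun hu hw => c2 _ _ _ _ _ _ hu hw, ?_,
    fun huw hw => c3 _ _ _ _ _ huw hw⟩
  intro t s i ht hl
  by_contra hc
  push Not at hc
  have hmem : t ∈ p s := by
    refine ((c4 s).1.2 t).2 ⟨ht, ⟨i, hl⟩, fun u hu s' i' hu' he => ?_⟩
    have := c1 u hu s' i' hu'
    rw [he, hl] at this
    simp only [Label.push.injEq] at this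
    exact hc u hu he (by rw [hu', this.2.1, this.2.2])
  have : p s = [] := by
    have := (c4 s).2
    cases s <;> exact List.map_eq_nil_iff.1 this.symm
  simp [this] at hmem

/-- A permutation of the steps of a word that maps every push to a later pop and every pop to an
earlier push of the same letter, without crossings among the pushes and among the pops of the same
stack. It is in fact an involution, but the values on the pushes and those on the pops are read off
from different blocks of a matrix, so this is not part of the definition. -/
structure Pairing (ℓ : ℕ → Label) (n : ℕ) (ν : ℕ → ℕ) : Prop where
  lt : ∀ {t}, t < n → ν t < n
  inj : ∀ {t t'}, t < n → t' < n → ν t = ν t' → t = t'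
  eps : ∀ {t}, t < n → ℓ t = .eps → ν t = t
  push : ∀ {t s i}, t < n → ℓ t = .push s i → t < ν t ∧ ℓ (ν t) = .pop s i
  pop : ∀ {t s i}, t < n → ℓ t = .pop s i → ν t < t ∧ ℓ (ν t) = .push s i
  above : ∀ {t t' s i i'}, t < t' → t' < n → ℓ t = .push s i → ℓ t' = .push s i' → ν t < ν t' →
    ν t < t'
  below : ∀ {t t' s i i'}, t < t' → t' < n → ℓ t = .pop s i → ℓ t' = .pop s i' → ν t < ν t' →
    t < ν t'

theorem Pairing.surj {ℓ : ℕ → Label} {n : ℕ} {ν : ℕ → ℕ} (h : Pairing ℓ n ν) {u : ℕ} (hu : u < n) :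
    ∃ t < n, ν t = u := by
  have hf : Function.Injective (fun t : Fin n => (⟨ν t, h.lt t.2⟩ : Fin n)) := fun a b hab =>
    Fin.ext (h.inj a.2 b.2 (congrArg Fin.val hab))
  obtain ⟨t, ht⟩ := Finite.surjective_of_injective hf ⟨u, hu⟩
  exact ⟨t, t.2, congrArg Fin.val ht⟩

theorem Pairing.popMatching {ℓ : ℕ → Label} {n : ℕ} {ν : ℕ → ℕ} (h : Pairing ℓ n ν) :
    PopMatching ℓ n ν := by
  refine ⟨fun hu hl => h.pop hu hl, fun hu hw _ _ he => h.inj hu hw he, fun {t s i} ht hl => ?_,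
    fun huw hw hu' hw' hlt => h.below huw hw hu' hw' hlt⟩
  obtain ⟨u, hu, rfl⟩ := h.surj ht
  refine ⟨u, hu, rfl, ?_⟩
  rcases hlu : ℓ u with _ | ⟨s', i'⟩ | ⟨s', i'⟩
  · rw [h.eps hu hlu, hlu] at hl; simp at hl
  · rw [(h.push hu hlu).2] at hl; simp at hl
  · rw [(h.pop hu hlu).2] at hl; simpa using hl

/-- Inverting a pairing exchanges the roles of pushes and pops. -/
theorem Pairing.inverse {ℓ : ℕ → Label} {n : ℕ} {ν μ : ℕ → ℕ} (h : Pairing ℓ n ν)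
    (hμ : ∀ t < n, μ t < n ∧ ν (μ t) = t) : Pairing ℓ n μ := by
  have hinv {t : ℕ} (ht : t < n) : μ (ν t) = t :=
    h.inj (hμ _ (h.lt ht)).1 ht (hμ _ (h.lt ht)).2
  have hpush {t s i} (ht : t < n) (hl : ℓ t = .push s i) : μ t > t ∧ ℓ (μ t) = .pop s i := by
    obtain ⟨h1, h2⟩ := hμ t ht
    rcases hlu : ℓ (μ t) with _ | ⟨s', i'⟩ | ⟨s', i'⟩
    · have := h.eps h1 hlu; rw [h2] at this; rw [← this, hl] at hlu; simp at hlu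
    · have := (h.push h1 hlu).2; rw [h2, hl] at this; simp at this
    · have := h.pop h1 hlu
      rw [h2, hl] at this
      simp only [Label.push.injEq] at this
      exact ⟨this.1, by rw [this.2.1, this.2.2]⟩
  have hpop {t s i} (ht : t < n) (hl : ℓ t = .pop s i) : μ t < t ∧ ℓ (μ t) = .push s i := by
    obtain ⟨h1, h2⟩ := hμ t ht
    rcases hlu : ℓ (μ t) with _ | ⟨s', i'⟩ | ⟨s', i'⟩
    · have := h.eps h1 hlu; rw [h2] at this; rw [← this, hl] at hlu; simp at hlu
    · have := h.push h1 hlu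
      rw [h2, hl] at this
      simp only [Label.pop.injEq] at this
      exact ⟨this.1, by rw [this.2.1, this.2.2]⟩
    · have := (h.pop h1 hlu).2; rw [h2, hl] at this; simp at this
  refine ⟨fun ht => (hμ _ ht).1, fun {t t'} ht ht' he => ?_, fun {t} ht hl => ?_,
    fun ht hl => hpush ht hl, fun ht hl => hpop ht hl, ?_, ?_⟩
  · rw [← (hμ t ht).2, ← (hμ t' ht').2, he]
  · have := hinv ht
    rwa [h.eps ht hl] at this
  · intro t t' s i i' htt ht' hl hl' hlt
    have ht : t < n := by omega
    have := h.below hlt (hμ t' ht').1 (hpush ht hl).2 (hpush ht' hl').2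
      (by rw [(hμ t ht).2, (hμ t' ht').2]; exact htt)
    rwa [(hμ t' ht').2] at this
  · intro t t' s i i' htt ht' hl hl' hlt
    have ht : t < n := by omega
    have := h.above hlt (hμ t' ht').1 (hpop ht hl).2 (hpop ht' hl').2
      (by rw [(hμ t ht).2, (hμ t' ht').2]; exact htt)
    rwa [(hμ t ht).2] at this

/-- The non-crossing matching of a word is unique, and it determines the values of a pairing on
the pops; those on the pushes are the values on the pops of the inverse pairing. -/
theorem Pairing.unique {ℓ : ℕ → Label} {n : ℕ} {ν ν' : ℕ → ℕ} (h : Pairing ℓ n ν)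
    (h' : Pairing ℓ n ν') {t : ℕ} (ht : t < n) : ν t = ν' t := by
  rcases hl : ℓ t with _ | ⟨s, i⟩ | ⟨s, i⟩
  · rw [h.eps ht hl, h'.eps ht hl]
  · -- compare the inverse of `ν` with `ν'` at the pop that is matched with `t`
    choose! μ hμ using fun u (hu : u < n) => h.surj hu
    choose! μ' hμ' using fun u (hu : u < n) => h'.surj hu
    have k := h.inverse hμ
    have k' := h'.inverse hμ'
    obtain ⟨-, h2⟩ := h.push ht hl
    have e1 := k.popMatching.unique k'.popMatching (h.lt ht) h2
    have e2 : μ (ν t) = t := h.inj (hμ _ (h.lt ht)).1 ht (hμ _ (h.lt ht)).2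
    rw [e2] at e1
    have e3 := (hμ' _ (h.lt ht)).2
    rw [← e1] at e3
    exact e3.symm
  · exact h.popMatching.unique h'.popMatching ht hl

/-- A matching of the pops is extended to the pushes by its inverse. -/
theorem PopMatching.exists_pairing {ℓ : ℕ → Label} {n : ℕ} {q : ℕ → ℕ} (h : PopMatching ℓ n q) :
    ∃ ν, Pairing ℓ n ν := by
  classical
  choose! f hf using fun t s i (ht : t < n) (hl : ℓ t = .push s i) => h.surj ht hl
  let ν : ℕ → ℕ := fun t => match ℓ t with
    | .eps => t
    | .push s i => f t s i
    | .pop _ _ => q t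
  have heps {t} (hl : ℓ t = .eps) : ν t = t := by simp [ν, hl]
  have hpush {t s i} (ht : t < n) (hl : ℓ t = .push s i) :
      ν t < n ∧ q (ν t) = t ∧ ℓ (ν t) = .pop s i := by
    have : ν t = f t s i := by simp [ν, hl]
    rw [this]
    exact hf t s i ht hl
  have hpop {t s i} (hl : ℓ t = .pop s i) : ν t = q t := by simp [ν, hl]
  have hq {t s i} (ht : t < n) (hl : ℓ t = .push s i) : t < ν t := by
    obtain ⟨h1, h2, h3⟩ := hpush ht hl
    have := (h.push_of_pop h1 h3).1
    omega
  refine ⟨ν, fun {t} ht => ?_, fun {t t'} ht ht' he => ?_, fun ht hl => heps hl,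
    fun ht hl => ⟨hq ht hl, (hpush ht hl).2.2⟩, fun ht hl => hpop hl ▸ h.push_of_pop ht hl, ?_, ?_⟩
  · rcases hl : ℓ t with _ | ⟨s, i⟩ | ⟨s, i⟩
    · rwa [heps hl]
    · exact (hpush ht hl).1
    · rw [hpop hl]; exact (h.push_of_pop ht hl).1.trans ht
  · rcases hl : ℓ t with _ | ⟨s, i⟩ | ⟨s, i⟩ <;> rcases hl' : ℓ t' with _ | ⟨s', i'⟩ | ⟨s', i'⟩
    · rwa [heps hl, heps hl'] at he
    · have := (hpush ht' hl').2.2; rw [← he, heps hl, hl] at this; simp at this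
    · have := (h.push_of_pop ht' hl').2; rw [← hpop hl', ← he, heps hl, hl] at this; simp at this
    · have := (hpush ht hl).2.2; rw [he, heps hl', hl'] at this; simp at this
    · rw [← (hpush ht hl).2.1, he, (hpush ht' hl').2.1]
    · have := (h.push_of_pop ht' hl').2
      rw [← hpop hl', ← he, (hpush ht hl).2.2] at this; simp at this
    · have := (h.push_of_pop ht hl).2; rw [← hpop hl, he, heps hl', hl'] at this; simp at this
    · have := (h.push_of_pop ht hl).2
      rw [← hpop hl, he, (hpush ht' hl').2.2] at this; simp at this
    · rw [hpop hl, hpop hl'] at he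
      exact h.inj ht ht' hl hl' he
  · intro t t' s i i' htt ht' hl hl' hlt
    obtain ⟨h1, h2, h3⟩ := hpush (htt.trans ht') hl
    obtain ⟨h1', h2', h3'⟩ := hpush ht' hl'
    have := h.nonCrossing hlt h1' h3 h3' (by omega)
    omega
  · intro t t' s i i' htt ht' hl hl' hlt
    rw [hpop hl, hpop hl'] at hlt
    rw [hpop hl']
    exact h.nonCrossing htt ht' hl hl' hlt

theorem isBalanced_iff {ℓ : ℕ → Label} {n : ℕ} :
    IsBalanced ((List.range n).map ℓ) ↔ ∃ ν, Pairing ℓ n ν := by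
  constructor
  · intro h
    obtain ⟨q, hq⟩ := exists_popMatching_of_run h
    exact hq.exists_pairing
  · rintro ⟨ν, hν⟩
    exact run_of_popMatching hν.popMatching

section

variable {V : Type*} {Γ : TwoStackAutomaton V} {g N : ℕ}

/-! ### From matrices to paths -/

/-- A system of `g × g` blocks in an `N × N` matrix, no two of which share a row or a column, that
satisfies the conditions imposed by `F₂`, `F₃` and `F₅`. -/
structure BlockSystem (E : ℕ → ℕ → Block V Γ.Letter → Prop) (g N : ℕ) : Prop where
  pos : 0 < g
  bounds : ∀ {a b s}, E a b s → a + g ≤ N ∧ b + g ≤ N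
  row_eq : ∀ {a b s a' b' s'}, E a b s → E a' b' s' → a < a' + g → a' < a + g →
    a = a' ∧ b = b' ∧ s = s'
  col_eq : ∀ {a b s a' b' s'}, E a b s → E a' b' s' → b < b' + g → b' < b + g →
    a = a' ∧ b = b' ∧ s = s'
  admissible : Admissible E g N

/-- The name of the block that encodes the label of a vertex. -/
inductive SlotName (Γ : TwoStackAutomaton V) : Label → Block V Γ.Letter → Prop
  | eps : SlotName Γ .eps .E
  | push (p : Γ.Letter) : SlotName Γ (.push p.1.1 p.1.2) (.Z p)
  | pop (p : Γ.Letter) : SlotName Γ (.pop p.1.1 p.1.2) (.Z p)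

theorem SlotName.of_push {s : Stack} {i : ℤ} {S : Block V Γ.Letter}
    (h : SlotName Γ (.push s i) S) : ∃ p : Γ.Letter, p.1 = (s, i) ∧ S = .Z p := by
  generalize hl : Label.push s i = l at h
  cases h with
  | eps => simp at hl
  | push p =>
    obtain ⟨rfl, rfl⟩ := Label.push.inj hl
    exact ⟨p, rfl, rfl⟩
  | pop p => simp at hl

theorem SlotName.of_pop {s : Stack} {i : ℤ} {S : Block V Γ.Letter}
    (h : SlotName Γ (.pop s i) S) : ∃ p : Γ.Letter, p.1 = (s, i) ∧ S = .Z p := by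
  generalize hl : Label.pop s i = l at h
  cases h with
  | eps => simp at hl
  | push p => simp at hl
  | pop p =>
    obtain ⟨rfl, rfl⟩ := Label.pop.inj hl
    exact ⟨p, rfl, rfl⟩

theorem SlotName.unique {l : Label} {S S' : Block V Γ.Letter} (h : SlotName Γ l S)
    (h' : SlotName Γ l S') : S = S' := by
  cases h with
  | eps => cases h'; rfl
  | push p =>
    obtain ⟨q, hq, rfl⟩ := h'.of_push
    rw [Subtype.ext (hq.trans (Prod.mk.eta (p := p.1)))]
  | pop p =>
    obtain ⟨q, hq, rfl⟩ := h'.of_pop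
    rw [Subtype.ext (hq.trans (Prod.mk.eta (p := p.1)))]

/-- The layout of the block matrix that encodes the path `γ 0, …, γ (n - 1)` together with a
pairing `ν` of its steps, in units of `g` rows and columns. The rows and the columns `3t`, `3t + 2`, `3t + 4` belong to the
step `t`; its label is encoded by a block in row `3t + 2` and a block in column `3t + 2`. -/
inductive Layout (Γ : TwoStackAutomaton V) (γ : ℕ → V) (ν : ℕ → ℕ) (n : ℕ) :
    ℕ → ℕ → Block V Γ.Letter → Prop
  | P : Layout Γ γ ν n 1 1 .P
  | Q : Layout Γ γ ν n (3 * n) (3 * n) .Q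
  | T (t : ℕ) : t < n → Layout Γ γ ν n (3 * t) (3 * t + 4) (.T (γ t))
  | B (t : ℕ) : t < n → Layout Γ γ ν n (3 * t + 4) (3 * t) .B
  | slot (t : ℕ) (S : Block V Γ.Letter) : t < n → SlotName Γ (Γ.label (γ t)) S →
      Layout Γ γ ν n (3 * t + 2) (3 * ν t + 2) S

/-- The blocks in the row and in the column of step `t` that encode the label of the vertex,
where `x = t * g`. -/
def Slot (E : ℕ → ℕ → Block V Γ.Letter → Prop) (g x : ℕ) : Label → Prop
  | .eps => E (3 * x + 2 * g) (3 * x + 2 * g) .E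
  | .push s i => ∃ p : Γ.Letter, p.1 = (s, i) ∧
      (∃ y, 3 * x + 3 * g ≤ y ∧ E (3 * x + 2 * g) y (.Z p)) ∧
      ∃ z, 3 * x + 3 * g ≤ z ∧ E z (3 * x + 2 * g) (.Z p)
  | .pop s i => ∃ p : Γ.Letter, p.1 = (s, i) ∧
      (∃ y, y + g ≤ 3 * x + 2 * g ∧ E (3 * x + 2 * g) y (.Z p)) ∧
      ∃ z, z + g ≤ 3 * x + 2 * g ∧ E z (3 * x + 2 * g) (.Z p)

/-- The blocks that encode the step `t` of a path, at which the vertex `v` is entered, where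
`x = t * g`. The block `B` of the preceding step (or the block `P` if there is none) is needed to
locate the next step. -/
structure Node (E : ℕ → ℕ → Block V Γ.Letter → Prop) (g x : ℕ) (v : V) : Prop where
  T : E (3 * x) (3 * x + 4 * g) (.T v)
  B : E (3 * x + 4 * g) (3 * x) .B
  prev : ∃ y s, E (3 * x + g) y s ∧ (s = .B ∨ s = .P)
  slot : Slot E g x (Γ.label v)

/-- The step after the one at `x` enters the vertex `w`. -/
structure Next (E : ℕ → ℕ → Block V Γ.Letter → Prop) (g x : ℕ) (v w : V) : Prop where
  adj : Γ.Adj v w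
  T : ∃ y, 3 * x + 5 * g ≤ y ∧ E (3 * x + 3 * g) y (.T w)
  B : ∃ z, 3 * x + 5 * g ≤ z ∧ E z (3 * x + 3 * g) .B

/-- The step at `x` is the last one. -/
def Last (E : ℕ → ℕ → Block V Γ.Letter → Prop) (g x : ℕ) (v : V) : Prop :=
  v = Γ.accept ∧ E (3 * x + 3 * g) (3 * x + 3 * g) .Q

variable {E : ℕ → ℕ → Block V Γ.Letter → Prop}

/-- In all patterns of `F₄` except for those from `W₄` there is a block `B` to the left of the
center. -/
theorem Blocked.first_or_exists_left {a b : ℕ} (h : Blocked E g a b) :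
    (∃ (k : V) (x y : Fin 6 → ℕ), Γ.Adj Γ.start k ∧
      Arranged E g ![4, 1, 2, 5, 0, 3] ![.T Γ.start, .P, .E, .T k, .B, .B] x y ∧
      x 4 = a ∧ y 0 = b) ∨ ∃ a' b', b' + g ≤ b ∧ E a' b' .B := by
  obtain ⟨k, σ, s, c, x, y, ht, hx, rfl, rfl⟩ := h
  cases ht with
  | push i j k p h1 h2 h3 =>
    exact Or.inr ⟨_, _, hx.col 0 1 (by decide), hx.block 2⟩
  | pop i j k p h1 h2 h3 =>
    exact Or.inr ⟨_, _, hx.col 1 2 (by decide), hx.block 3⟩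
  | eps i j k h1 h2 h3 =>
    exact Or.inr ⟨_, _, hx.col 0 1 (by decide), hx.block 2⟩
  | first k h1 => exact Or.inl ⟨k, x, y, h1, hx, rfl, rfl⟩
  | last i h1 =>
    exact Or.inr ⟨_, _, hx.col 0 1 (by decide), hx.block 2⟩

/-- The leftmost block `B` must be the center of a pattern from `W₄`, which determines the blocks
of the first step. -/
theorem BlockSystem.exists_first (hE : BlockSystem E g N)
    (hblocked : ∀ a b, E a b .B → Blocked E g a b) (hB : ∃ a b, E a b .B) :
    E g g .P ∧ Node E g 0 Γ.start ∧ ∃ w, Next E g 0 Γ.start w := by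
  classical
  have hg := hE.pos
  have hex : ∃ b a, E a b .B := by obtain ⟨a, b, h⟩ := hB; exact ⟨b, a, h⟩
  obtain ⟨a, ha⟩ := Nat.find_spec hex
  rcases (hblocked _ _ ha).first_or_exists_left with ⟨k, x, y, hk, hx, h1, h2⟩ | ⟨a', b', h1, h2⟩
  swap
  · exact absurd ⟨a', h2⟩ (Nat.find_min hex (m := b') (by omega))
  have x01 := hx.row 0 1 (by decide)
  have x12 := hx.row 1 2 (by decide)
  have x23 := hx.row 2 3 (by decide)
  have x34 := hx.row 3 4 (by decide)
  have x45 := hx.row 4 5 (by decide)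
  have y01 := hx.col 0 1 (by decide)
  have y12 := hx.col 1 2 (by decide)
  have y23 := hx.col 2 3 (by decide)
  have y34 := hx.col 3 4 (by decide)
  have y45 := hx.col 4 5 (by decide)
  have hT : E (x 0) (y 4) (.T Γ.start) := hx.block 0
  have hP : E (x 1) (y 1) .P := hx.block 1
  have hEE : E (x 2) (y 2) .E := hx.block 2
  have hTk : E (x 3) (y 5) (.T k) := hx.block 3
  have hB4 : E (x 4) (y 0) .B := hx.block 4
  have hB5 : E (x 5) (y 3) .B := hx.block 5
  have p := hE.admissible.nearBorder.P hP
  have c := hE.admissible.close hB4 hT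
  have e0 : x 0 = 0 := by omega
  have e0' : y 0 = 0 := by omega
  have e1 : x 1 = g := by omega
  have e1' : y 1 = g := by omega
  have e4 : x 4 = 4 * g := by omega
  have e4' : y 4 = 4 * g := by omega
  have e2 : x 2 = 2 * g := by omega
  have e2' : y 2 = 2 * g := by omega
  have e3 : x 3 = 3 * g := by omega
  have e3' : y 3 = 3 * g := by omega
  rw [e0, e4'] at hT
  rw [e1, e1'] at hP
  rw [e2, e2'] at hEE
  rw [e3] at hTk
  rw [e4, e0'] at hB4
  rw [e3'] at hB5
  refine ⟨hP, ⟨by simpa using hT, by simpa using hB4, ⟨g, .P, by simpa using hP, Or.inr rfl⟩, ?_⟩,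
    k, hk, ⟨y 5, by omega, by simpa using hTk⟩, ⟨x 5, by omega, by simpa using hB5⟩⟩
  rw [Γ.label_start]
  simpa [Slot] using hEE

/-- In a pattern from `W₁`, `W₂`, `W₃` or `W₅` whose center is the block `B` of the next step, the
blocks `T i` and `T j` are those of the two steps. Their positions relative to the center are
forced by `F₂`. -/
theorem BlockSystem.step_aux (hE : BlockSystem E g N) {x z : ℕ} {v w i j : V} (hv : Node E g x v)
    (hw : Next E g x v w) (hz : E z (3 * x + 3 * g) .B) {x0 y2 x1 y5 : ℕ}
    (hTi : E x0 y2 (.T i)) (hTj : E x1 y5 (.T j)) (h1 : x0 + g ≤ x1) (h2 : x1 + 4 * g ≤ z)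
    (h3 : 3 * x + 4 * g ≤ y2) (h4 : y2 + 3 * g ≤ y5) :
    j = w ∧ x1 = 3 * x + 3 * g ∧ z = 3 * x + 7 * g ∧ y2 = 3 * x + 4 * g ∧
      y5 = 3 * x + 7 * g := by
  have hg := hE.pos
  have c1 := hE.admissible.close hz hTi
  have c2 := hE.admissible.close hz hTj
  obtain ⟨y, hy, hTw⟩ := hw.T
  obtain ⟨z', hz', hB'⟩ := hw.B
  obtain ⟨rfl, -⟩ := hE.col_eq hz hB' (by omega) (by omega)
  have c3 := hE.admissible.close hz hTw
  have e2 : y2 = 3 * x + 4 * g := by omega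
  have e0 := (hE.col_eq hTi hv.T (by omega) (by omega)).1
  -- the only block `T` in the rows where `T j` may be is `T w`
  obtain ⟨y', s, hs, hs'⟩ := hv.prev
  have r1 : 3 * x + 3 * g ≤ x1 + g - 1 := by
    by_contra hc
    by_cases hc' : x1 < 3 * x + 2 * g
    · have := (hE.row_eq hTj hs (by omega) (by omega)).2.2
      rcases hs' with rfl | rfl <;> simp at this
    · have hslot := hv.slot
      rcases hl : Γ.label v with _ | ⟨s, i⟩ | ⟨s, i⟩ <;> rw [hl] at hslot
      · have := (hE.row_eq hTj hslot (by omega) (by omega)).2.2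
        simp at this
      · obtain ⟨p, -, ⟨y, -, hp⟩, -⟩ := hslot
        have := (hE.row_eq hTj hp (by omega) (by omega)).2.2
        simp at this
      · obtain ⟨p, -, ⟨y, -, hp⟩, -⟩ := hslot
        have := (hE.row_eq hTj hp (by omega) (by omega)).2.2
        simp at this
  obtain ⟨e3, -, e4⟩ := hE.row_eq hTj hTw (by omega) (by omega)
  simp only [Block.T.injEq] at e4
  exact ⟨e4, by omega, by omega, e2, by omega⟩

/-- The block `B` of the next step is blocked. The pattern of which it is the center determines
the other blocks of that step, and it contains blocks of the step after it unless the path ends. -/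
theorem BlockSystem.step (hE : BlockSystem E g N)
    (hblocked : ∀ a b, E a b .B → Blocked E g a b) {x : ℕ} {v w : V} (hv : Node E g x v)
    (hw : Next E g x v w) :
    Node E g (x + g) w ∧ ((∃ w', Next E g (x + g) w w') ∨ Last E g (x + g) w) := by
  have hg := hE.pos
  obtain ⟨z, hz, hzB⟩ := hw.B
  obtain ⟨k, σ, s, c, X, Y, ht, hx, hxc, hyc⟩ := hblocked _ _ hzB
  have prev : ∃ y s, E (3 * (x + g) + g) y s ∧ (s = .B ∨ s = .P) :=
    ⟨3 * x, .B, by rw [show 3 * (x + g) + g = 3 * x + 4 * g by ring]; exact hv.B, Or.inl rfl⟩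
  cases ht with
  | push i j k p h1 h2 h3 =>
    have x01 := hx.row 0 1 (by decide)
    have x12 := hx.row 1 2 (by decide)
    have x23 := hx.row 2 3 (by decide)
    have x34 := hx.row 3 4 (by decide)
    have x45 := hx.row 4 5 (by decide)
    have x56 := hx.row 5 6 (by decide)
    have x67 := hx.row 6 7 (by decide)
    have y12 := hx.col 1 2 (by decide)
    have y23 := hx.col 2 3 (by decide)
    have y34 := hx.col 3 4 (by decide)
    have y45 := hx.col 4 5 (by decide)
    have y56 := hx.col 5 6 (by decide)
    have y67 := hx.col 6 7 (by decide)
    change Y 1 = _ at hyc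
    have b0 : E (X 0) (Y 2) (.T i) := hx.block 0
    have b1 : E (X 1) (Y 5) (.T j) := hx.block 1
    have b3 : E (X 3) (Y 7) (.Z p) := hx.block 3
    have b4 : E (X 4) (Y 6) (.T k) := hx.block 4
    have b6 : E (X 6) (Y 4) .B := hx.block 6
    have b7 : E (X 7) (Y 3) (.Z p) := hx.block 7
    obtain ⟨rfl, e1, e2, e3, e4⟩ := hE.step_aux hv hw hzB b0 b1 x01 (by omega) (by omega) (by omega)
    rw [show X 1 = 3 * (x + g) by omega, show Y 5 = 3 * (x + g) + 4 * g by omega] at b1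
    rw [show X 3 = 3 * (x + g) + 2 * g by omega] at b3
    rw [show X 4 = 3 * (x + g) + 3 * g by omega] at b4
    rw [show Y 4 = 3 * (x + g) + 3 * g by omega] at b6
    rw [show Y 3 = 3 * (x + g) + 2 * g by omega] at b7
    rw [show z = 3 * (x + g) + 4 * g by omega, show 3 * x + 3 * g = 3 * (x + g) by omega] at hzB
    refine ⟨⟨b1, hzB, prev, ?_⟩, Or.inl ⟨k, h2, ⟨_, by omega, b4⟩, ⟨_, by omega, b6⟩⟩⟩
    rw [h3]
    exact ⟨p, rfl, ⟨_, by omega, b3⟩, ⟨_, by omega, b7⟩⟩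
  | pop i j k p h1 h2 h3 =>
    have x01 := hx.row 0 1 (by decide)
    have x12 := hx.row 1 2 (by decide)
    have x23 := hx.row 2 3 (by decide)
    have x34 := hx.row 3 4 (by decide)
    have x45 := hx.row 4 5 (by decide)
    have x56 := hx.row 5 6 (by decide)
    have x67 := hx.row 6 7 (by decide)
    have y01 := hx.col 0 1 (by decide)
    have y12 := hx.col 1 2 (by decide)
    have y23 := hx.col 2 3 (by decide)
    have y34 := hx.col 3 4 (by decide)
    have y45 := hx.col 4 5 (by decide)
    have y56 := hx.col 5 6 (by decide)
    have y67 := hx.col 6 7 (by decide)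
    change Y 2 = _ at hyc
    have b0 : E (X 0) (Y 4) (.Z p) := hx.block 0
    have b1 : E (X 1) (Y 3) (.T i) := hx.block 1
    have b2 : E (X 2) (Y 6) (.T j) := hx.block 2
    have b4 : E (X 4) (Y 0) (.Z p) := hx.block 4
    have b5 : E (X 5) (Y 7) (.T k) := hx.block 5
    have b7 : E (X 7) (Y 5) .B := hx.block 7
    obtain ⟨rfl, e1, e2, e3, e4⟩ := hE.step_aux hv hw hzB b1 b2 x12 (by omega) (by omega) (by omega)
    rw [show X 2 = 3 * (x + g) by omega, show Y 6 = 3 * (x + g) + 4 * g by omega] at b2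
    rw [show X 4 = 3 * (x + g) + 2 * g by omega] at b4
    rw [show X 5 = 3 * (x + g) + 3 * g by omega] at b5
    rw [show Y 5 = 3 * (x + g) + 3 * g by omega] at b7
    rw [show Y 4 = 3 * (x + g) + 2 * g by omega] at b0
    rw [show z = 3 * (x + g) + 4 * g by omega, show 3 * x + 3 * g = 3 * (x + g) by omega] at hzB
    refine ⟨⟨b2, hzB, prev, ?_⟩, Or.inl ⟨k, h2, ⟨_, by omega, b5⟩, ⟨_, by omega, b7⟩⟩⟩
    rw [h3]
    exact ⟨p, rfl, ⟨_, by omega, b4⟩, ⟨_, by omega, b0⟩⟩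
  | eps i j k h1 h2 h3 =>
    have x01 := hx.row 0 1 (by decide)
    have x12 := hx.row 1 2 (by decide)
    have x23 := hx.row 2 3 (by decide)
    have x34 := hx.row 3 4 (by decide)
    have x45 := hx.row 4 5 (by decide)
    have x56 := hx.row 5 6 (by decide)
    have y12 := hx.col 1 2 (by decide)
    have y23 := hx.col 2 3 (by decide)
    have y34 := hx.col 3 4 (by decide)
    have y45 := hx.col 4 5 (by decide)
    have y56 := hx.col 5 6 (by decide)
    change Y 1 = _ at hyc
    have b0 : E (X 0) (Y 2) (.T i) := hx.block 0
    have b1 : E (X 1) (Y 5) (.T j) := hx.block 1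
    have b3 : E (X 3) (Y 3) .E := hx.block 3
    have b4 : E (X 4) (Y 6) (.T k) := hx.block 4
    have b6 : E (X 6) (Y 4) .B := hx.block 6
    obtain ⟨rfl, e1, e2, e3, e4⟩ := hE.step_aux hv hw hzB b0 b1 x01 (by omega) (by omega) (by omega)
    rw [show X 1 = 3 * (x + g) by omega, show Y 5 = 3 * (x + g) + 4 * g by omega] at b1
    rw [show X 3 = 3 * (x + g) + 2 * g by omega, show Y 3 = 3 * (x + g) + 2 * g by omega] at b3
    rw [show X 4 = 3 * (x + g) + 3 * g by omega] at b4
    rw [show Y 4 = 3 * (x + g) + 3 * g by omega] at b6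
    rw [show z = 3 * (x + g) + 4 * g by omega, show 3 * x + 3 * g = 3 * (x + g) by omega] at hzB
    refine ⟨⟨b1, hzB, prev, ?_⟩, Or.inl ⟨k, h2, ⟨_, by omega, b4⟩, ⟨_, by omega, b6⟩⟩⟩
    rw [h3]
    exact b3
  | first k h1 =>
    have y01 := hx.col 0 1 (by decide)
    change Y 0 = _ at hyc
    have b1 : E (X 1) (Y 1) .P := hx.block 1
    have := hE.admissible.nearBorder.P b1
    omega
  | last i h1 =>
    have x01 := hx.row 0 1 (by decide)
    have x12 := hx.row 1 2 (by decide)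
    have x23 := hx.row 2 3 (by decide)
    have x34 := hx.row 3 4 (by decide)
    have x45 := hx.row 4 5 (by decide)
    have y12 := hx.col 1 2 (by decide)
    have y23 := hx.col 2 3 (by decide)
    have y34 := hx.col 3 4 (by decide)
    have y45 := hx.col 4 5 (by decide)
    change Y 1 = _ at hyc
    have b0 : E (X 0) (Y 2) (.T i) := hx.block 0
    have b1 : E (X 1) (Y 5) (.T Γ.accept) := hx.block 1
    have b3 : E (X 3) (Y 3) .E := hx.block 3
    have b4 : E (X 4) (Y 4) .Q := hx.block 4
    obtain ⟨e0, e1, e2, e3, e4⟩ :=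
      hE.step_aux hv hw hzB b0 b1 x01 (by omega) (by omega) (by omega)
    rw [show X 1 = 3 * (x + g) by omega, show Y 5 = 3 * (x + g) + 4 * g by omega] at b1
    rw [show X 3 = 3 * (x + g) + 2 * g by omega, show Y 3 = 3 * (x + g) + 2 * g by omega] at b3
    rw [show X 4 = 3 * (x + g) + 3 * g by omega, show Y 4 = 3 * (x + g) + 3 * g by omega] at b4
    rw [show z = 3 * (x + g) + 4 * g by omega, show 3 * x + 3 * g = 3 * (x + g) by omega] at hzB
    subst e0
    refine ⟨⟨b1, hzB, prev, ?_⟩, Or.inr ⟨rfl, b4⟩⟩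
    rw [Γ.label_accept]
    exact b3

/-- Since the matrix is finite, the path has a last step. -/
theorem BlockSystem.exists_chain (hE : BlockSystem E g N)
    (hblocked : ∀ a b, E a b .B → Blocked E g a b) (hB : ∃ a b, E a b .B) :
    ∃ (n : ℕ) (γ : ℕ → V), (∀ t ≤ n, Node E g (t * g) (γ t)) ∧ γ 0 = Γ.start ∧
      (∀ t < n, Γ.Adj (γ t) (γ (t + 1))) ∧ Last E g (n * g) (γ n) := by
  have hg := hE.pos
  obtain ⟨-, hfirst, w0, hw0⟩ := hE.exists_first hblocked hB
  have key (t : ℕ) : (∃ (γ : ℕ → V) (w : V), (∀ s ≤ t, Node E g (s * g) (γ s)) ∧ γ 0 = Γ.start ∧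
      (∀ s < t, Γ.Adj (γ s) (γ (s + 1))) ∧ Next E g (t * g) (γ t) w) ∨
      ∃ (n : ℕ) (γ : ℕ → V), (∀ t ≤ n, Node E g (t * g) (γ t)) ∧ γ 0 = Γ.start ∧
      (∀ t < n, Γ.Adj (γ t) (γ (t + 1))) ∧ Last E g (n * g) (γ n) := by
    induction t with
    | zero =>
      left
      refine ⟨fun _ => Γ.start, w0, fun s hs => ?_, rfl, by simp, by simpa using hw0⟩
      obtain rfl : s = 0 := by omega
      simpa using hfirst
    | succ t ih =>
      rcases ih with ⟨γ, w, h1, h2, h3, h4⟩ | h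
      swap
      · exact Or.inr h
      have hst := hE.step hblocked (h1 t le_rfl) h4
      rw [← Nat.succ_mul, Nat.succ_eq_add_one] at hst
      have hup {s : ℕ} (hs : s ≤ t) : Function.update γ (t + 1) w s = γ s :=
        Function.update_of_ne (by omega) _ _
      have hself : Function.update γ (t + 1) w (t + 1) = w := Function.update_self ..
      have c1 (s : ℕ) (hs : s ≤ t + 1) : Node E g (s * g) (Function.update γ (t + 1) w s) := by
        rcases Nat.le_or_eq_of_le_succ hs with hs | rfl
        · rw [hup hs]; exact h1 s hs
        · rw [hself]; exact hst.1
      have c3 (s : ℕ) (hs : s < t + 1) : Γ.Adj (Function.update γ (t + 1) w s)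
          (Function.update γ (t + 1) w (s + 1)) := by
        rcases Nat.lt_succ_iff_lt_or_eq.1 hs with hs | rfl
        · rw [hup (by omega), hup (by omega)]; exact h3 s hs
        · rw [hup (by omega), hself]; exact h4.adj
      rcases hst.2 with ⟨w', hw'⟩ | hlast
      · exact Or.inl ⟨_, w', c1, (hup (by omega)).trans h2, c3, by rwa [hself]⟩
      · exact Or.inr ⟨t + 1, _, c1, (hup (by omega)).trans h2, c3, by rwa [hself]⟩
  rcases key N with ⟨γ, w, h1, -⟩ | h
  · -- the matrix has no room for that many steps
    have := (hE.bounds (h1 N le_rfl).T).1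
    have := Nat.le_mul_of_pos_right N hg
    omega
  · exact h

/-- A valid matrix in which all blocks `B` are blocked encodes an accepting path together with a
pairing of its steps. -/
theorem BlockSystem.exists_layout (hE : BlockSystem E g N)
    (hblocked : ∀ a b, E a b .B → Blocked E g a b) (hB : ∃ a b, E a b .B) :
    ∃ (n : ℕ) (γ : ℕ → V) (ν : ℕ → ℕ), N = (3 * (n + 1) + 2) * g ∧ γ 0 = Γ.start ∧
      γ n = Γ.accept ∧ (∀ t < n, Γ.Adj (γ t) (γ (t + 1))) ∧
      Pairing (fun t => Γ.label (γ t)) (n + 1) ν ∧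
      ∀ u v s, Layout Γ γ ν (n + 1) u v s → E (u * g) (v * g) s := by
  have hg := hE.pos
  have hP := (hE.exists_first hblocked hB).1
  obtain ⟨n, γ, hnode, h0, hadj, hacc, hQ⟩ := hE.exists_chain hblocked hB
  have hN : N = 3 * (n * g) + 5 * g := by
    have := (hE.bounds (hnode n le_rfl).T).2
    have := (hE.admissible.nearBorder.Q hQ).1
    omega
  have mul_lt {t u : ℕ} : t * g < u * g ↔ t < u := Nat.mul_lt_mul_right hg
  have mul_le {t u : ℕ} : t * g ≤ u * g ↔ t ≤ u := Nat.mul_le_mul_right_iff hg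
  -- every column belongs to one of the blocks that have been found
  have hcol {a b : ℕ} {p : Γ.Letter} (h : E a b (.Z p)) :
      ∃ u < n + 1, b = 3 * (u * g) + 2 * g := by
    have hb := (hE.bounds h).2
    obtain ⟨u, r, rr, hr, hrr, e⟩ : ∃ u r rr, r < 3 ∧ rr < g ∧ b = 3 * (u * g) + r * g + rr := by
      refine ⟨b / g / 3, b / g % 3, b % g, Nat.mod_lt _ (by omega), Nat.mod_lt _ hg, ?_⟩
      have e1 := Nat.div_add_mod b g
      have e2 := Nat.div_add_mod (b / g) 3
      calc b = g * (b / g) + b % g := e1.symm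
        _ = g * (3 * (b / g / 3) + b / g % 3) + b % g := by rw [e2]
        _ = _ := by ring
    have hu1 : u * g < (n + 2) * g := by rw [add_mul]; omega
    rw [mul_lt] at hu1
    interval_cases r
    · rcases Nat.lt_succ_iff_lt_or_eq.1 hu1 with hu | rfl
      · have := (hE.col_eq h (hnode u (by omega)).B (by omega) (by omega)).2.2
        simp at this
      · have e3 : (n + 1) * g = n * g + g := by ring
        have := (hE.col_eq h hQ (by omega) (by omega)).2.2
        simp at this
    · rcases Nat.eq_zero_or_pos u with rfl | hu
      · have := (hE.col_eq h hP (by omega) (by omega)).2.2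
        simp at this
      · obtain ⟨u, rfl⟩ : ∃ u', u = u' + 1 := ⟨u - 1, by omega⟩
        have e3 : (u + 1) * g = u * g + g := by ring
        have := (hE.col_eq h (hnode u (by omega)).T (by omega) (by omega)).2.2
        simp at this
    · have hu2 : u * g < (n + 1) * g := by rw [add_mul]; omega
      rw [mul_lt, Nat.lt_succ_iff] at hu2
      refine ⟨u, by omega, ?_⟩
      have hslot := (hnode u hu2).slot
      rcases hl : Γ.label (γ u) with _ | ⟨s, i⟩ | ⟨s, i⟩ <;> rw [hl] at hslot
      · have := (hE.col_eq h hslot (by omega) (by omega)).2.2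
        simp at this
      · obtain ⟨p, -, -, ⟨y, -, hp⟩⟩ := hslot
        exact (hE.col_eq h hp (by omega) (by omega)).2.1
      · obtain ⟨p, -, -, ⟨y, -, hp⟩⟩ := hslot
        exact (hE.col_eq h hp (by omega) (by omega)).2.1
  have hpair (t : ℕ) (ht : t < n + 1) : ∃ u < n + 1,
      (Γ.label (γ t) = .eps → u = t) ∧
      (∀ s i, Γ.label (γ t) = .push s i → t < u ∧ Γ.label (γ u) = .pop s i) ∧
      (∀ s i, Γ.label (γ t) = .pop s i → u < t ∧ Γ.label (γ u) = .push s i) ∧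
      ∃ S, E (3 * (t * g) + 2 * g) (3 * (u * g) + 2 * g) S ∧ SlotName Γ (Γ.label (γ t)) S := by
    have hslot := (hnode t (by omega)).slot
    rcases hl : Γ.label (γ t) with _ | ⟨s, i⟩ | ⟨s, i⟩ <;> rw [hl] at hslot
    · exact ⟨t, ht, by simp, by simp, by simp, .E, hslot, .eps⟩
    · obtain ⟨p, hp, ⟨y, hy, hy'⟩, -⟩ := hslot
      obtain ⟨u, hu, rfl⟩ := hcol hy'
      have htu : t * g < u * g := by omega
      refine ⟨u, hu, by simp, ?_, by simp, .Z p, hy', by simpa only [hp] using SlotName.push p⟩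
      · intro s' i' h
        obtain ⟨rfl, rfl⟩ := Label.push.inj h
        refine ⟨mul_lt.1 htu, ?_⟩
        have hslot' := (hnode u (by omega)).slot
        rcases hl' : Γ.label (γ u) with _ | ⟨s', i'⟩ | ⟨s', i'⟩ <;> rw [hl'] at hslot'
        · have := (hE.col_eq hy' hslot' (by omega) (by omega)).2.2
          simp at this
        · obtain ⟨p', -, -, z, hz, hz'⟩ := hslot'
          have := (hE.col_eq hy' hz' (by omega) (by omega)).1
          omega
        · obtain ⟨p', hp', -, z, hz, hz'⟩ := hslot'
          have := (hE.col_eq hy' hz' (by omega) (by omega)).2.2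
          simp only [Block.Z.injEq] at this
          subst this
          rw [hp] at hp'
          obtain ⟨rfl, rfl⟩ := Prod.mk.inj hp'
          rfl
    · obtain ⟨p, hp, ⟨y, hy, hy'⟩, -⟩ := hslot
      obtain ⟨u, hu, rfl⟩ := hcol hy'
      have htu : u * g < t * g := by omega
      refine ⟨u, hu, by simp, by simp, ?_, .Z p, hy', by simpa only [hp] using SlotName.pop p⟩
      · intro s' i' h
        obtain ⟨rfl, rfl⟩ := Label.pop.inj h
        refine ⟨mul_lt.1 htu, ?_⟩
        have hslot' := (hnode u (by omega)).slot
        rcases hl' : Γ.label (γ u) with _ | ⟨s', i'⟩ | ⟨s', i'⟩ <;> rw [hl'] at hslot'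
        · have := (hE.col_eq hy' hslot' (by omega) (by omega)).2.2
          simp at this
        · obtain ⟨p', hp', -, z, hz, hz'⟩ := hslot'
          have := (hE.col_eq hy' hz' (by omega) (by omega)).2.2
          simp only [Block.Z.injEq] at this
          subst this
          rw [hp] at hp'
          obtain ⟨rfl, rfl⟩ := Prod.mk.inj hp'
          rfl
        · obtain ⟨p', -, -, z, hz, hz'⟩ := hslot'
          have := (hE.col_eq hy' hz' (by omega) (by omega)).1
          omega
  choose! ν hν1 hν2 hν3 hν4 S hS hS1 using hpair
  refine ⟨n, γ, ν, by rw [hN]; ring, h0, hacc, hadj, ⟨fun ht => hν1 _ ht, ?_,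
    fun ht h => hν2 _ ht h, fun ht h => hν3 _ ht _ _ h, fun ht h => hν4 _ ht _ _ h, ?_, ?_⟩, ?_⟩
  · intro t t' ht ht' he
    have h1 := hS t ht
    have h2 := hS t' ht'
    rw [he] at h1
    have := (hE.col_eq h1 h2 (by omega) (by omega)).1
    exact Nat.eq_of_mul_eq_mul_right hg (by omega)
  · -- a crossing above the diagonal is excluded by the block `B` of the later step
    intro t t' s i i' htt ht' hl hl' hlt
    by_contra hc
    have ht : t < n + 1 := by omega
    obtain ⟨p, hp, hSp⟩ := SlotName.of_push (hl ▸ hS1 t ht)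
    obtain ⟨p', hp', hSp'⟩ := SlotName.of_push (hl' ▸ hS1 t' ht')
    have h1 := hS t ht
    have h2 := hS t' ht'
    rw [hSp] at h1
    rw [hSp'] at h2
    have q1 : t * g + g ≤ t' * g := by rw [← Nat.succ_mul]; exact mul_le.2 htt
    have q2 : ν t * g + g ≤ ν t' * g := by rw [← Nat.succ_mul]; exact mul_le.2 hlt
    have q3 : t' * g ≤ ν t * g := mul_le.2 (by omega)
    exact hE.admissible.nonCrossing.above (by rw [hp, hp']) h1 h2 (hnode t' (by omega)).B
      (by omega) (by omega) (by omega) (by omega)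
  · intro t t' s i i' htt ht' hl hl' hlt
    by_contra hc
    have ht : t < n + 1 := by omega
    obtain ⟨p, hp, hSp⟩ := SlotName.of_pop (hl ▸ hS1 t ht)
    obtain ⟨p', hp', hSp'⟩ := SlotName.of_pop (hl' ▸ hS1 t' ht')
    have h1 := hS t ht
    have h2 := hS t' ht'
    rw [hSp] at h1
    rw [hSp'] at h2
    have q1 : t * g + g ≤ t' * g := by rw [← Nat.succ_mul]; exact mul_le.2 htt
    have q2 : ν t * g + g ≤ ν t' * g := by rw [← Nat.succ_mul]; exact mul_le.2 hlt
    have q3 : ν t' * g ≤ t * g := mul_le.2 (by omega)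
    exact hE.admissible.nonCrossing.below (by rw [hp, hp']) h1 h2 (hnode t (by omega)).T
      (by omega) (by omega) (by omega) (by omega)
  · intro u v s h
    cases h with
    | P => simpa using hP
    | Q =>
      rw [show 3 * (n + 1) * g = 3 * (n * g) + 3 * g by ring]
      exact hQ
    | T t ht =>
      rw [show 3 * t * g = 3 * (t * g) by ring, show (3 * t + 4) * g = 3 * (t * g) + 4 * g by ring]
      exact (hnode t (by omega)).T
    | B t ht =>
      rw [show 3 * t * g = 3 * (t * g) by ring, show (3 * t + 4) * g = 3 * (t * g) + 4 * g by ring]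
      exact (hnode t (by omega)).B
    | slot t s ht hs =>
      rw [show (3 * t + 2) * g = 3 * (t * g) + 2 * g by ring,
        show (3 * ν t + 2) * g = 3 * (ν t * g) + 2 * g by ring, hs.unique (hS1 t ht)]
      exact hS t ht

end

/-! ### The block permutation of a path avoids `matrixL` -/

/-- The positions above the diagonal in the layout of a path. -/
def Upper (ℓ : ℕ → Label) (n : ℕ) (ν : ℕ → ℕ) (u v : ℕ) : Prop :=
  (∃ t < n, u = 3 * t ∧ v = 3 * t + 4) ∨
    ∃ t < n, ∃ s i, ℓ t = .push s i ∧ u = 3 * t + 2 ∧ v = 3 * ν t + 2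

/-- No three positions above and to the right of a point on or above the diagonal are
increasing: at most one of them is a block `T`, the other ones belong to different stacks, and
a block `T v` next to them would force `v` to be both a push and a pop. -/
theorem Pairing.no_three_upper {ℓ : ℕ → Label} {n : ℕ} {ν : ℕ → ℕ} (hν : Pairing ℓ n ν)
    {u1 v1 u2 v2 u3 v3 x y : ℕ} (h1 : Upper ℓ n ν u1 v1) (h2 : Upper ℓ n ν u2 v2)
    (h3 : Upper ℓ n ν u3 v3) (hu12 : u1 < u2) (hu23 : u2 < u3) (hu3 : u3 < x) (hxy : x ≤ y)
    (hv1 : y < v1) (hv12 : v1 < v2) (hv23 : v2 < v3) : False := by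
  have same {t t' s i i'} (htt : t < t') (ht' : t' < n) (hl : ℓ t = .push s i)
      (hl' : ℓ t' = .push s i') (h : ν t < ν t') : ν t < t' := hν.above htt ht' hl hl' h
  rcases h1 with ⟨t1, ht1, rfl, rfl⟩ | ⟨t1, ht1, s1, i1, hl1, rfl, rfl⟩ <;>
    rcases h2 with ⟨t2, ht2, rfl, rfl⟩ | ⟨t2, ht2, s2, i2, hl2, rfl, rfl⟩ <;>
    rcases h3 with ⟨t3, ht3, rfl, rfl⟩ | ⟨t3, ht3, s3, i3, hl3, rfl, rfl⟩
  · omega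
  · omega
  · omega
  · omega
  · omega
  · -- the middle step would be a pop and a push
    have e1 : ν t1 = t2 := by omega
    have e2 : t3 = t2 := by omega
    have := (hν.push ht1 hl1).2
    rw [e1, ← e2, hl3] at this
    simp at this
  · omega
  · have e : s1 = s2 ∨ s1 = s3 ∨ s2 = s3 := by
      cases s1 <;> cases s2 <;> cases s3 <;> simp
    rcases e with rfl | rfl | rfl
    · have := same (by omega) ht2 hl1 hl2 (by omega); omega
    · have := same (by omega) ht3 hl1 hl3 (by omega); omega
    · have := same (by omega) ht3 hl2 hl3 (by omega); omega

section

variable {V : Type*} {Γ : TwoStackAutomaton V} {γ : ℕ → V} {ν : ℕ → ℕ} {n : ℕ}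

/-- On every stack, the blocks of the pushes are above the diagonal and those of the pops are
below it. -/
theorem Layout.upper (hν : Pairing (fun t => Γ.label (γ t)) n ν) {u v : ℕ}
    {s : Block V Γ.Letter} (h : Layout Γ γ ν n u v s) (huv : u + 2 ≤ v) :
    Upper (fun t => Γ.label (γ t)) n ν u v := by
  cases h with
  | P => omega
  | Q => omega
  | T t ht => exact Or.inl ⟨t, ht, rfl, rfl⟩
  | B t ht => omega
  | slot t s ht hs =>
    rcases hl : Γ.label (γ t) with _ | ⟨s, i⟩ | ⟨s, i⟩
    · have := hν.eps ht hl; omega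
    · exact Or.inr ⟨t, ht, s, i, hl, rfl, rfl⟩
    · have := hν.pop ht hl; omega

/-- The transpose of `Layout.upper`, in which the pairing is replaced by its inverse. -/
theorem Layout.lower (hν : Pairing (fun t => Γ.label (γ t)) n ν) {μ : ℕ → ℕ}
    (hμ : ∀ t < n, μ t < n ∧ ν (μ t) = t) {u v : ℕ}
    {s : Block V Γ.Letter} (h : Layout Γ γ ν n u v s) (huv : v + 2 ≤ u) :
    Upper (fun t => Γ.label (γ t)) n μ v u := by
  cases h with
  | P => omega
  | Q => omega
  | T t ht => omega
  | B t ht => exact Or.inl ⟨t, ht, rfl, rfl⟩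
  | slot t s ht hs =>
    rcases hl : Γ.label (γ t) with _ | ⟨s, i⟩ | ⟨s, i⟩
    · have := hν.eps ht hl; omega
    · have := hν.push ht hl; omega
    · have e : μ (ν t) = t := hν.inj (hμ _ (hν.lt ht)).1 ht (hμ _ (hν.lt ht)).2
      exact Or.inr ⟨ν t, hν.lt ht, s, i, (hν.pop ht hl).2, rfl, by rw [e]⟩

theorem Layout.lt (hν : Pairing (fun t => Γ.label (γ t)) n ν) (hn : 0 < n) {u v : ℕ}
    {s : Block V Γ.Letter} (h : Layout Γ γ ν n u v s) : u < 3 * n + 2 ∧ v < 3 * n + 2 := by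
  cases h with
  | P => omega
  | Q => omega
  | T t ht => omega
  | B t ht => omega
  | slot t s ht hs => have := hν.lt ht; omega

theorem SlotName.exists_of_pairing (hν : Pairing (fun t => Γ.label (γ t)) n ν) {t : ℕ}
    (ht : t < n) : ∃ S, SlotName Γ (Γ.label (γ t)) S := by
  rcases hl : Γ.label (γ t) with _ | ⟨s, i⟩ | ⟨s, i⟩
  · exact ⟨_, .eps⟩
  · exact ⟨_, .push ⟨(s, i), γ t, hl⟩⟩
  · exact ⟨_, .pop ⟨(s, i), γ (ν t), (hν.pop ht hl).2⟩⟩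

theorem Layout.exists_row (hν : Pairing (fun t => Γ.label (γ t)) n ν) {u : ℕ}
    (hu : u < 3 * n + 2) : ∃ v s, Layout Γ γ ν n u v s := by
  obtain ⟨t, r, hr, rfl⟩ : ∃ t r, r < 3 ∧ u = 3 * t + r :=
    ⟨u / 3, u % 3, Nat.mod_lt _ (by omega), by omega⟩
  interval_cases r
  · by_cases ht : t < n
    · exact ⟨_, _, .T t ht⟩
    · obtain rfl : t = n := by omega
      exact ⟨_, _, .Q⟩
  · rcases Nat.eq_zero_or_pos t with rfl | ht
    · exact ⟨_, _, .P⟩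
    · obtain ⟨t, rfl⟩ : ∃ t', t = t' + 1 := ⟨t - 1, by omega⟩
      exact ⟨_, _, .B t (by omega)⟩
  · have ht : t < n := by omega
    obtain ⟨S, hS⟩ := SlotName.exists_of_pairing hν ht
    exact ⟨_, _, .slot t S ht hS⟩

theorem Layout.exists_col (hν : Pairing (fun t => Γ.label (γ t)) n ν) {v : ℕ}
    (hv : v < 3 * n + 2) : ∃ u s, Layout Γ γ ν n u v s := by
  obtain ⟨t, r, hr, rfl⟩ : ∃ t r, r < 3 ∧ v = 3 * t + r :=
    ⟨v / 3, v % 3, Nat.mod_lt _ (by omega), by omega⟩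
  interval_cases r
  · by_cases ht : t < n
    · exact ⟨_, _, .B t ht⟩
    · obtain rfl : t = n := by omega
      exact ⟨_, _, .Q⟩
  · rcases Nat.eq_zero_or_pos t with rfl | ht
    · exact ⟨_, _, .P⟩
    · obtain ⟨t, rfl⟩ : ∃ t', t = t' + 1 := ⟨t - 1, by omega⟩
      exact ⟨_, _, .T t (by omega)⟩
  · have ht : t < n := by omega
    obtain ⟨t, ht', rfl⟩ := hν.surj ht
    obtain ⟨S, hS⟩ := SlotName.exists_of_pairing hν ht'
    exact ⟨_, _, .slot t S ht' hS⟩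

theorem Layout.row_unique {u v u' v' : ℕ} {s s' : Block V Γ.Letter} (h : Layout Γ γ ν n u v s)
    (h' : Layout Γ γ ν n u' v' s') (hu : u = u') : v = v' ∧ s = s' := by
  cases h <;> cases h' <;> try omega
  · exact ⟨rfl, rfl⟩
  · exact ⟨rfl, rfl⟩
  · rename_i t ht t' ht'
    obtain rfl : t = t' := by omega
    exact ⟨rfl, rfl⟩
  · rename_i t ht t' ht'
    obtain rfl : t = t' := by omega
    exact ⟨rfl, rfl⟩
  · rename_i t ht hs t' ht' hs'
    obtain rfl : t = t' := by omega
    exact ⟨rfl, hs.unique hs'⟩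

theorem Layout.col_unique (hν : Pairing (fun t => Γ.label (γ t)) n ν) {u v u' v' : ℕ}
    {s s' : Block V Γ.Letter} (h : Layout Γ γ ν n u v s)
    (h' : Layout Γ γ ν n u' v' s') (hv : v = v') : u = u' := by
  cases h <;> cases h' <;> try omega
  rename_i t ht hs t' ht' hs'
  rw [hν.inj ht ht' (by omega)]

theorem Layout.name_ne {u v : ℕ} {s : Block V Γ.Letter} (h : Layout Γ γ ν n u v s) : s ≠ .B' := by
  cases h with
  | slot t s ht hs => generalize Γ.label (γ t) = l at hs; cases hs <;> simp
  | _ => simp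

theorem exists_ones_of_contains {g : ℕ} {X : Matrix (Fin g) (Fin g) Bool}
    (h : Contains X matrixL) : ∃ r c : ℕ → ℕ, IncrOn 7 r ∧ IncrOn 7 c ∧ One X (r 0) (c 4) ∧
      One X (r 1) (c 5) ∧ One X (r 2) (c 6) ∧ One X (r 3) (c 3) ∧ One X (r 4) (c 0) ∧
      One X (r 5) (c 1) ∧ One X (r 6) (c 2) := by
  obtain ⟨r, c, hO, -, -⟩ := contains_iff.1 h
  have key (i j : Fin 7) (hij : matrixL.entry i j = true) : One X (r i) (c j) :=
    (hO.iff i i.2 j j.2).2 (one_fin.2 hij)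
  exact ⟨r, c, hO.incr_row, hO.incr_col, key 0 4 rfl, key 1 5 rfl, key 2 6 rfl, key 3 3 rfl,
    key 4 0 rfl, key 5 1 rfl, key 6 2 rfl⟩

/-! ### The matrix of a path -/

variable {g : ℕ} {A : Block V Γ.Letter → Matrix (Fin g) (Fin g) Bool}

open Classical in
/-- The block matrix with the given layout. -/
noncomputable def layoutMatrix (A : Block V Γ.Letter → Matrix (Fin g) (Fin g) Bool) (γ : ℕ → V)
    (ν : ℕ → ℕ) (n : ℕ) : Matrix (Fin ((3 * n + 2) * g)) (Fin ((3 * n + 2) * g)) Bool :=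
  fun i j => decide (∃ s, Layout Γ γ ν n (i / g) (j / g) s ∧ One (A s) (i % g) (j % g))

theorem one_layoutMatrix (hν : Pairing (fun t => Γ.label (γ t)) n ν) (hn : 0 < n) (hg : 0 < g)
    (a b : ℕ) : One (layoutMatrix A γ ν n) a b ↔
      ∃ s, Layout Γ γ ν n (a / g) (b / g) s ∧ One (A s) (a % g) (b % g) := by
  constructor
  · rintro ⟨ha, hb, h⟩
    simpa [layoutMatrix] using h
  · rintro ⟨s, hs, h⟩
    obtain ⟨h1, h2⟩ := hs.lt hν hn
    refine ⟨(Nat.div_lt_iff_lt_mul hg).1 h1, (Nat.div_lt_iff_lt_mul hg).1 h2, ?_⟩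
    simpa [layoutMatrix] using ⟨s, hs, h⟩

theorem mul_add_div_of_lt {u i : ℕ} (hi : i < g) : (u * g + i) / g = u := by
  rw [Nat.mul_comm, Nat.mul_add_div (by omega), Nat.div_eq_of_lt hi, add_zero]

theorem mul_add_mod_of_lt {u i : ℕ} (hi : i < g) : (u * g + i) % g = i := by
  rw [Nat.mul_comm, Nat.mul_add_mod, Nat.mod_eq_of_lt hi]

theorem blk_layoutMatrix (hν : Pairing (fun t => Γ.label (γ t)) n ν) (hn : 0 < n)
    {u v : ℕ} {s : Block V Γ.Letter} (h : Layout Γ γ ν n u v s) :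
    Blk (One (layoutMatrix A γ ν n)) (u * g) (v * g) (A s) := by
  intro i hi j hj
  rw [one_layoutMatrix hν hn (by omega), mul_add_div_of_lt hi, mul_add_div_of_lt hj,
    mul_add_mod_of_lt hi, mul_add_mod_of_lt hj]
  constructor
  · rintro ⟨s', hs', h'⟩
    rwa [(h.row_unique hs' rfl).2]
  · exact fun h' => ⟨s, h, h'⟩

theorem isPermRel_layoutMatrix (hA : ∀ s, IsPermRel g (One (A s)))
    (hν : Pairing (fun t => Γ.label (γ t)) n ν) (hn : 0 < n) (hg : 0 < g) :
    IsPermRel ((3 * n + 2) * g) (One (layoutMatrix A γ ν n)) := by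
  refine ⟨fun ⟨h, _, _⟩ => h, fun ⟨_, h, _⟩ => h, fun {a} ha => ?_, fun {b} hb => ?_,
    fun {a b b'} h h' => ?_, fun {a a' b} h h' => ?_⟩
  · obtain ⟨v, s, h⟩ := Layout.exists_row hν ((Nat.div_lt_iff_lt_mul hg).2 ha)
    obtain ⟨j, hj⟩ := (hA s).exists_col (Nat.mod_lt a hg)
    have hjg := (hA s).lt_col hj
    refine ⟨v * g + j, (one_layoutMatrix hν hn hg _ _).2 ⟨s, ?_⟩⟩
    rw [mul_add_div_of_lt hjg, mul_add_mod_of_lt hjg]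
    exact ⟨h, hj⟩
  · obtain ⟨u, s, h⟩ := Layout.exists_col hν ((Nat.div_lt_iff_lt_mul hg).2 hb)
    obtain ⟨i, hi⟩ := (hA s).exists_row (Nat.mod_lt b hg)
    have hig := (hA s).lt_row hi
    refine ⟨u * g + i, (one_layoutMatrix hν hn hg _ _).2 ⟨s, ?_⟩⟩
    rw [mul_add_div_of_lt hig, mul_add_mod_of_lt hig]
    exact ⟨h, hi⟩
  · rw [one_layoutMatrix hν hn hg] at h h'
    obtain ⟨s, hs, h⟩ := h
    obtain ⟨s', hs', h'⟩ := h'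
    obtain ⟨e1, rfl⟩ := hs.row_unique hs' rfl
    have e2 := (hA s).col_unique h h'
    rw [← Nat.div_add_mod b g, ← Nat.div_add_mod b' g, e1, e2]
  · rw [one_layoutMatrix hν hn hg] at h h'
    obtain ⟨s, hs, h⟩ := h
    obtain ⟨s', hs', h'⟩ := h'
    have e1 := hs.col_unique hν hs' rfl
    obtain ⟨-, rfl⟩ := hs.row_unique hs' e1
    have e2 := (hA s).row_unique h h'
    rw [← Nat.div_add_mod a g, ← Nat.div_add_mod a' g, e1, e2]

/-- The only occurrences of the alphabet in the matrix of a path are the blocks of the layout. An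
occurrence that meets every block in at most one entry would be a pattern of the permutation of
the blocks, which does not contain `matrixL`. -/
theorem occ_layoutMatrix (hA : ∀ s, A s ∈ alphabet g)
    (hν : Pairing (fun t => Γ.label (γ t)) n ν) (hn : 0 < n) {X : Matrix (Fin g) (Fin g) Bool}
    (hX : X ∈ alphabet g) {r c : ℕ → ℕ} (hO : Occ (One (layoutMatrix A γ ν n)) X r c) :
    ∃ u v s, Layout Γ γ ν n u v s ∧ ∀ i < g, r i = u * g + i ∧ c i = v * g + i := by
  have hg := seven_le_of_mem_alphabet hX
  have hg0 : 0 < g := by omega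
  have hM := isPermRel_layoutMatrix (fun s => (hA s).1.permRel) hν hn hg0
  have hXP := hX.1.permRel
  by_contra hc
  push Not at hc
  have hsmall {u v s} (h : Layout Γ γ ν n u v s) :
      (∀ i < g, ∀ i' < g, u * g ≤ r i → r i < u * g + g → u * g ≤ r i' → r i' < u * g + g →
        i = i') ∧ (∀ i < g, ∀ i' < g, v * g ≤ c i → c i < v * g + g → v * g ≤ c i' →
        c i' < v * g + g → i = i') := by
    rcases hO.inter_block hX.1 (fun i j hij =>
      (blk_layoutMatrix hν hn h).interval hM (hA s).1.permRel hij) with h' | h'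
    · exact h'
    · obtain ⟨i, hi, h''⟩ := hc u v s h
      exact absurd (h' i hi).2 (h'' (h' i hi).1)
  have mem_div (a : ℕ) : a / g * g ≤ a ∧ a < a / g * g + g := by
    have h1 := Nat.div_add_mod' a g
    have h2 := Nat.mod_lt a hg0
    omega
  have hr {i i' : ℕ} (h : i < i') (hi' : i' < g) : r i / g < r i' / g := by
    refine lt_of_le_of_ne (Nat.div_le_div_right (hO.incr_row i i' h hi').le) fun he => h.ne ?_
    obtain ⟨v, s, hL⟩ := Layout.exists_row hν
      ((Nat.div_lt_iff_lt_mul hg0).2 (hO.row_lt hM hXP hi'))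
    have k1 := mem_div (r i)
    have k2 := mem_div (r i')
    rw [he] at k1
    exact (hsmall hL).1 i (by omega) i' hi' k1.1 k1.2 k2.1 k2.2
  have hcc {i i' : ℕ} (h : i < i') (hi' : i' < g) : c i / g < c i' / g := by
    refine lt_of_le_of_ne (Nat.div_le_div_right (hO.incr_col i i' h hi').le) fun he => h.ne ?_
    obtain ⟨v, s, hL⟩ := Layout.exists_col hν
      ((Nat.div_lt_iff_lt_mul hg0).2 (hO.col_lt hM hXP hi'))
    have k1 := mem_div (c i)
    have k2 := mem_div (c i')
    rw [he] at k1
    exact (hsmall hL).2 i (by omega) i' hi' k1.1 k1.2 k2.1 k2.2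
  obtain ⟨ρ, κ, hρ, hκ, h0, h1, h2, h3, h4, h5, h6⟩ := exists_ones_of_contains hX.2
  have hL {i j : ℕ} (h : One X i j) : ∃ s, Layout Γ γ ν n (r i / g) (c j / g) s := by
    have := (hO.iff i (hXP.lt_row h) j (hXP.lt_col h)).2 h
    rw [one_layoutMatrix hν hn hg0] at this
    exact this.imp fun s hs => hs.1
  obtain ⟨s0, l0⟩ := hL h0
  obtain ⟨s1, l1⟩ := hL h1
  obtain ⟨s2, l2⟩ := hL h2
  obtain ⟨s3, l3⟩ := hL h3
  obtain ⟨s4, l4⟩ := hL h4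
  obtain ⟨s5, l5⟩ := hL h5
  obtain ⟨s6, l6⟩ := hL h6
  have r01 := hr (hρ 0 1 (by omega) (by omega)) (hXP.lt_row h1)
  have r12 := hr (hρ 1 2 (by omega) (by omega)) (hXP.lt_row h2)
  have r23 := hr (hρ 2 3 (by omega) (by omega)) (hXP.lt_row h3)
  have r34 := hr (hρ 3 4 (by omega) (by omega)) (hXP.lt_row h4)
  have r45 := hr (hρ 4 5 (by omega) (by omega)) (hXP.lt_row h5)
  have r56 := hr (hρ 5 6 (by omega) (by omega)) (hXP.lt_row h6)
  have c01 := hcc (hκ 0 1 (by omega) (by omega)) (hXP.lt_col h5)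
  have c12 := hcc (hκ 1 2 (by omega) (by omega)) (hXP.lt_col h6)
  have c23 := hcc (hκ 2 3 (by omega) (by omega)) (hXP.lt_col h3)
  have c34 := hcc (hκ 3 4 (by omega) (by omega)) (hXP.lt_col h0)
  have c45 := hcc (hκ 4 5 (by omega) (by omega)) (hXP.lt_col h1)
  have c56 := hcc (hκ 5 6 (by omega) (by omega)) (hXP.lt_col h2)
  rcases Nat.le_total (r (ρ 3) / g) (c (κ 3) / g) with hxy | hxy
  · exact hν.no_three_upper (l0.upper hν (by omega)) (l1.upper hν (by omega))
      (l2.upper hν (by omega)) r01 r12 r23 hxy c34 c45 c56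
  · choose! μ hμ using fun u (hu : u < n) => hν.surj hu
    exact (hν.inverse hμ).no_three_upper (l4.lower hν hμ (by omega)) (l5.lower hν hμ (by omega))
      (l6.lower hν hμ (by omega)) c01 c12 c23 hxy r34 r45 r56

theorem consecutive_layoutMatrix (hA : ∀ s, A s ∈ alphabet g)
    (hν : Pairing (fun t => Γ.label (γ t)) n ν) (hn : 0 < n) :
    Consecutive g (One (layoutMatrix A γ ν n)) := by
  intro X hX r c hO i hi
  obtain ⟨u, v, s, -, h⟩ := occ_layoutMatrix hA hν hn hX hO
  have h0 := h 0 (by omega)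
  have h1 := h i hi
  omega

theorem blk_layoutMatrix_iff (hA : ∀ s, A s ∈ alphabet g) (hinj : Function.Injective A)
    (hν : Pairing (fun t => Γ.label (γ t)) n ν) (hn : 0 < n) {a b : ℕ} {s : Block V Γ.Letter} :
    Blk (One (layoutMatrix A γ ν n)) a b (A s) ↔
      ∃ u v, a = u * g ∧ b = v * g ∧ Layout Γ γ ν n u v s := by
  have hg := seven_le_of_mem_alphabet (hA s)
  constructor
  · intro h
    obtain ⟨u, v, s', hs', h'⟩ := occ_layoutMatrix hA hν hn (hA s) h.occ
    have := h' 0 (by omega)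
    simp only [add_zero] at this
    refine ⟨u, v, this.1, this.2, ?_⟩
    rw [this.1, this.2] at h
    rwa [hinj (h.matrix_eq (blk_layoutMatrix hν hn hs'))]
  · rintro ⟨u, v, rfl, rfl, h⟩
    exact blk_layoutMatrix hν hn h

theorem erased_layoutMatrix_iff (hA : ∀ s, A s ∈ alphabet g) (hinj : Function.Injective A)
    (hν : Pairing (fun t => Γ.label (γ t)) n ν) (hn : 0 < n) {a b : ℕ} {s : Block V Γ.Letter} :
    Erased A (One (layoutMatrix A γ ν n)) a b s ↔
      ∃ u v, a = u * g ∧ b = v * g ∧ Layout Γ γ ν n u v s := by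
  have herase {s : Block V Γ.Letter} (h : s ≠ .B') : s.erase = s := by
    cases s <;> simp_all [Block.erase]
  constructor
  · rintro ⟨t, rfl, ht⟩
    obtain ⟨u, v, h1, h2, h3⟩ := (blk_layoutMatrix_iff hA hinj hν hn).1 ht
    exact ⟨u, v, h1, h2, by rwa [herase h3.name_ne]⟩
  · rintro ⟨u, v, h1, h2, h3⟩
    exact ⟨s, herase h3.name_ne, (blk_layoutMatrix_iff hA hinj hν hn).2 ⟨u, v, h1, h2, h3⟩⟩

/-- The blocks of a layout, in matrix coordinates. -/
def LayoutBlocks (Γ : TwoStackAutomaton V) (γ : ℕ → V) (ν : ℕ → ℕ) (n g : ℕ) (a b : ℕ)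
    (s : Block V Γ.Letter) : Prop :=
  ∃ u v, a = u * g ∧ b = v * g ∧ Layout Γ γ ν n u v s

theorem Layout.eq_B {u v : ℕ} (h : Layout Γ γ ν n u v .B) : ∃ t < n, u = 3 * t + 4 ∧ v = 3 * t := by
  cases h with
  | B t ht => exact ⟨t, ht, rfl, rfl⟩
  | slot t s ht hs => generalize Γ.label (γ t) = l at hs; cases hs

theorem Layout.eq_T {u v : ℕ} {w : V} (h : Layout Γ γ ν n u v (.T w)) :
    ∃ t < n, u = 3 * t ∧ v = 3 * t + 4 ∧ w = γ t := by
  cases h with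
  | T t ht => exact ⟨t, ht, rfl, rfl, rfl⟩
  | slot t s ht hs => generalize Γ.label (γ t) = l at hs; cases hs

theorem Layout.eq_P {u v : ℕ} (h : Layout Γ γ ν n u v .P) : u = 1 ∧ v = 1 := by
  cases h with
  | P => exact ⟨rfl, rfl⟩
  | slot t s ht hs => generalize Γ.label (γ t) = l at hs; cases hs

theorem Layout.eq_Q {u v : ℕ} (h : Layout Γ γ ν n u v .Q) : u = 3 * n ∧ v = 3 * n := by
  cases h with
  | Q => exact ⟨rfl, rfl⟩
  | slot t s ht hs => generalize Γ.label (γ t) = l at hs; cases hs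

theorem Layout.eq_Z {u v : ℕ} {p : Γ.Letter} (h : Layout Γ γ ν n u v (.Z p)) :
    ∃ t < n, u = 3 * t + 2 ∧ v = 3 * ν t + 2 ∧
      (Γ.label (γ t) = .push p.1.1 p.1.2 ∨ Γ.label (γ t) = .pop p.1.1 p.1.2) := by
  cases h with
  | slot t s ht hs =>
    refine ⟨t, ht, rfl, rfl, ?_⟩
    generalize Γ.label (γ t) = l at hs
    cases hs with
    | push => exact Or.inl rfl
    | pop => exact Or.inr rfl

/-- The pairing has no crossings, hence neither do the blocks that encode letters. -/
theorem admissible_layoutBlocks (hν : Pairing (fun t => Γ.label (γ t)) n ν) (hg : 0 < g) :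
    Admissible (LayoutBlocks Γ γ ν n g) g ((3 * n + 2) * g) := by
  have hle {u v : ℕ} : u * g ≤ v * g ↔ u ≤ v := Nat.mul_le_mul_right_iff hg
  have hadd {u v k : ℕ} : u * g + k * g ≤ v * g ↔ u + k ≤ v := by rw [← add_mul, hle]
  have hadd1 {u v : ℕ} (h : u * g + g ≤ v * g) : u + 1 ≤ v := by
    rwa [← Nat.succ_mul, hle] at h
  refine ⟨?_, ⟨?_, ?_⟩, ⟨?_, ?_⟩⟩
  · rintro a b a' b' w ⟨u, v, rfl, rfl, h⟩ ⟨u', v', rfl, rfl, h'⟩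
    obtain ⟨t, ht, rfl, rfl⟩ := h.eq_B
    obtain ⟨t', ht', rfl, rfl, -⟩ := h'.eq_T
    have far {u v : ℕ} (h : u * g + 4 * g < v * g) : u + 4 < v :=
      Nat.lt_of_mul_lt_mul_right (a := g) (by rwa [add_mul])
    have near {u v : ℕ} (h : u * g + g < v * g) : u + 1 < v :=
      Nat.lt_of_mul_lt_mul_right (a := g) (by rwa [Nat.succ_mul])
    constructor
    · rintro ⟨h1, h2⟩
      have e1 := near (u := 3 * t') (v := 3 * t + 4) (by omega)
      have e2 := far (u := 3 * t) (v := 3 * t' + 4) (by omega)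
      omega
    · rintro ⟨h1, h2⟩
      have e1 := near (u := 3 * t) (v := 3 * t' + 4) (by omega)
      have e2 := far (u := 3 * t') (v := 3 * t + 4) (by omega)
      omega
  · rintro a b ⟨u, v, rfl, rfl, h⟩
    obtain ⟨rfl, rfl⟩ := h.eq_P
    omega
  · rintro a b ⟨u, v, rfl, rfl, h⟩
    obtain ⟨rfl, rfl⟩ := h.eq_Q
    rw [add_mul]
    omega
  · rintro p q a1 b1 a2 b2 a3 b3 hpq ⟨u1, v1, rfl, rfl, h1⟩ ⟨u2, v2, rfl, rfl, h2⟩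
      ⟨u3, v3, rfl, rfl, h3⟩ e1 e2 e3 e4
    have e1 := hadd1 e1
    have e2 := hadd1 e2
    have e3 := hadd1 e3
    have e4 := hadd1 e4
    obtain ⟨t1, ht1, rfl, rfl, l1⟩ := h1.eq_Z
    obtain ⟨t2, ht2, rfl, rfl, l2⟩ := h2.eq_Z
    obtain ⟨t3, ht3, rfl, rfl⟩ := h3.eq_B
    rcases l1 with l1 | l1
    swap
    · have := hν.pop ht1 l1; omega
    rcases l2 with l2 | l2
    swap
    · have := hν.pop ht2 l2; omega
    rw [hpq] at l1
    have := hν.above (by omega) ht2 l1 l2 (by omega)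
    omega
  · rintro p q w a1 b1 a2 b2 a3 b3 hpq ⟨u1, v1, rfl, rfl, h1⟩ ⟨u2, v2, rfl, rfl, h2⟩
      ⟨u3, v3, rfl, rfl, h3⟩ e1 e2 e3 e4
    have e1 := hadd1 e1
    have e2 := hadd1 e2
    have e3 := hadd1 e3
    have e4 := hadd1 e4
    obtain ⟨t1, ht1, rfl, rfl, l1⟩ := h1.eq_Z
    obtain ⟨t2, ht2, rfl, rfl, l2⟩ := h2.eq_Z
    obtain ⟨t3, ht3, rfl, rfl, -⟩ := h3.eq_T
    rcases l1 with l1 | l1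
    · have := hν.push ht1 l1; omega
    rcases l2 with l2 | l2
    · have := hν.push ht2 l2; omega
    rw [hpq] at l1
    have := hν.below (by omega) ht2 l1 l2 (by omega)
    omega

theorem arranged_layoutBlocks {k : ℕ} {σ : Fin k → Fin k} {s : Fin k → Block V Γ.Letter}
    {x y : Fin k → ℕ} (hx : StrictMono x) (hy : StrictMono y)
    (h : ∀ i, Layout Γ γ ν n (x i) (y (σ i)) (s i)) :
    Arranged (LayoutBlocks Γ γ ν n g) g σ s (fun i => x i * g) (fun i => y i * g) := by
  refine ⟨fun i j hij => ?_, fun i j hij => ?_, fun i => ⟨_, _, rfl, rfl, h i⟩⟩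
  · rw [← Nat.succ_mul]; exact Nat.mul_le_mul_right _ (hx hij)
  · rw [← Nat.succ_mul]; exact Nat.mul_le_mul_right _ (hy hij)

/-- Every block `B` in the layout of an accepting path is the center of a configuration from `F₄`:
the type of the configuration is given by the label of the vertex, and for a push or a pop the
two blocks that encode the letter do not belong to a neighbouring step because adjacent
vertices have dissimilar labels. -/
theorem blocked_layoutBlocks (hν : Pairing (fun t => Γ.label (γ t)) n ν)
    (hs : γ 0 = Γ.start) (ha : γ (n - 1) = Γ.accept)
    (hadj : ∀ t, t + 1 < n → Γ.Adj (γ t) (γ (t + 1))) {t : ℕ} (ht : t < n) :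
    Blocked (LayoutBlocks Γ γ ν n g) g ((3 * t + 4) * g) (3 * t * g) := by
  have hn : 2 ≤ n := by
    by_contra hn
    obtain rfl : n = 1 := by omega
    exact Γ.start_ne_accept (hs.symm.trans ha)
  have hT {t : ℕ} (ht : t < n) := Layout.T (Γ := Γ) (γ := γ) (ν := ν) t ht
  have hB {t : ℕ} (ht : t < n) := Layout.B (Γ := Γ) (γ := γ) (ν := ν) t ht
  have hE {t : ℕ} (ht : t < n) (hl : Γ.label (γ t) = .eps) :
      Layout Γ γ ν n (3 * t + 2) (3 * t + 2) .E := by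
    have := Layout.slot (Γ := Γ) (γ := γ) (ν := ν) t .E ht (by rw [hl]; exact .eps)
    rwa [hν.eps ht hl] at this
  rcases Nat.eq_zero_or_pos t with rfl | ht0
  · have hx : StrictMono ![0, 1, 2, 3, 4, 7] := by decide
    have h0 := hT ht
    rw [hs] at h0
    refine ⟨6, _, _, 4, _, _, .first (γ 1) (hs ▸ hadj 0 (by omega)),
      arranged_layoutBlocks (x := ![0, 1, 2, 3, 4, 7]) (y := ![0, 1, 2, 3, 4, 7]) hx hx ?_,
      rfl, rfl⟩
    intro i
    fin_cases i
    · exact h0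
    · exact .P
    · exact hE ht (hs ▸ Γ.label_start)
    · exact hT (t := 1) (by omega)
    · exact hB ht
    · exact hB (t := 1) (by omega)
  obtain ⟨t, rfl⟩ : ∃ t', t = t' + 1 := ⟨t - 1, by omega⟩
  have hprev := hadj t ht
  by_cases hlast : t + 2 = n
  · have e : γ (t + 1) = Γ.accept := by rw [← ha]; congr 1; omega
    have h1 := hT ht
    rw [e] at h1
    have hx : StrictMono ![3 * t, 3 * t + 3, 3 * t + 4, 3 * t + 5, 3 * t + 6, 3 * t + 7] :=
      Fin.strictMono_iff_lt_succ.2 (by intro i; fin_cases i <;> simp)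
    refine ⟨6, _, _, 5, _, _, .last (γ t) (e ▸ hprev), arranged_layoutBlocks hx hx ?_, rfl, rfl⟩
    intro i
    fin_cases i
    · exact hT (by omega)
    · exact h1
    · exact hB (by omega)
    · exact hE ht (e ▸ Γ.label_accept)
    · have := Layout.Q (Γ := Γ) (γ := γ) (ν := ν) (n := n)
      rw [show 3 * n = 3 * t + 6 by omega] at this
      exact this
    · exact hB ht
  have hnext := hadj (t + 1) (by omega)
  rcases hl : Γ.label (γ (t + 1)) with _ | ⟨s, i⟩ | ⟨s, i⟩
  · have hx : StrictMono
        ![3 * t, 3 * t + 3, 3 * t + 4, 3 * t + 5, 3 * t + 6, 3 * t + 7, 3 * t + 10] :=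
      Fin.strictMono_iff_lt_succ.2 (by intro i; fin_cases i <;> simp)
    refine ⟨7, _, _, 5, _, _, .eps (γ t) (γ (t + 1)) (γ (t + 2)) hprev hnext hl,
      arranged_layoutBlocks hx hx ?_, rfl, rfl⟩
    intro i
    fin_cases i
    · exact hT (by omega)
    · exact hT ht
    · exact hB (by omega)
    · exact hE ht hl
    · exact hT (t := t + 2) (by omega)
    · exact hB ht
    · exact hB (t := t + 2) (by omega)
  · obtain ⟨h1, h2⟩ := hν.push ht hl
    obtain ⟨μ, hμ, e⟩ := hν.surj ht
    have hμl : Γ.label (γ μ) = .pop s i := by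
      choose! μ' hμ' using fun u (hu : u < n) => hν.surj hu
      have := ((hν.inverse hμ').push ht hl).2
      rwa [← hν.inj (hμ' _ ht).1 hμ ((hμ' _ ht).2.trans e.symm)]
    have hμt : t + 1 < μ := e ▸ (hν.pop hμ hμl).1
    have hne {u : ℕ} (hu : Γ.label (γ u) = .pop s i) : u ≠ t + 2 := by
      rintro rfl
      exact Γ.not_similar_of_adj _ _ hnext ⟨s, by rw [hl]; rfl, by rw [hu]; rfl⟩
    have k1 := hne h2
    have k2 := hne hμl
    let p : Γ.Letter := ⟨(s, i), _, hl⟩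
    have hZ := Layout.slot (Γ := Γ) (γ := γ) (ν := ν) (t + 1) (.Z p) ht (by rw [hl]; exact .push p)
    have hZ' := Layout.slot (Γ := Γ) (γ := γ) (ν := ν) μ (.Z p) hμ (by rw [hμl]; exact .pop p)
    rw [e] at hZ'
    have hx : StrictMono ![3 * t, 3 * t + 3, 3 * t + 4, 3 * t + 5, 3 * t + 6, 3 * t + 7,
        3 * t + 10, 3 * μ + 2] :=
      Fin.strictMono_iff_lt_succ.2 (by intro i; fin_cases i <;> simp; omega)
    have hy : StrictMono ![3 * t, 3 * t + 3, 3 * t + 4, 3 * t + 5, 3 * t + 6, 3 * t + 7,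
        3 * t + 10, 3 * ν (t + 1) + 2] :=
      Fin.strictMono_iff_lt_succ.2 (by intro i; fin_cases i <;> simp; omega)
    refine ⟨8, _, _, 5, _, _, .push (γ t) (γ (t + 1)) (γ (t + 2)) p hprev hnext hl,
      arranged_layoutBlocks hx hy ?_, rfl, rfl⟩
    intro i
    fin_cases i
    · exact hT (by omega)
    · exact hT ht
    · exact hB (by omega)
    · exact hZ
    · exact hT (t := t + 2) (by omega)
    · exact hB ht
    · exact hB (t := t + 2) (by omega)
    · exact hZ'
  · obtain ⟨h1, h2⟩ := hν.pop ht hl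
    obtain ⟨μ, hμ, e⟩ := hν.surj ht
    have hμl : Γ.label (γ μ) = .push s i := by
      choose! μ' hμ' using fun u (hu : u < n) => hν.surj hu
      have := ((hν.inverse hμ').pop ht hl).2
      rwa [← hν.inj (hμ' _ ht).1 hμ ((hμ' _ ht).2.trans e.symm)]
    have hμt : μ < t + 1 := e ▸ (hν.push hμ hμl).1
    have hne {u : ℕ} (hu : Γ.label (γ u) = .push s i) : u ≠ t := by
      rintro rfl
      exact Γ.not_similar_of_adj _ _ hprev ⟨s, by rw [hu]; rfl, by rw [hl]; rfl⟩
    have k1 := hne h2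
    have k2 := hne hμl
    let p : Γ.Letter := ⟨(s, i), _, hμl⟩
    have hZ := Layout.slot (Γ := Γ) (γ := γ) (ν := ν) (t + 1) (.Z p) ht (by rw [hl]; exact .pop p)
    have hZ' := Layout.slot (Γ := Γ) (γ := γ) (ν := ν) μ (.Z p) hμ (by rw [hμl]; exact .push p)
    rw [e] at hZ'
    have hx : StrictMono ![3 * μ + 2, 3 * t, 3 * t + 3, 3 * t + 4, 3 * t + 5, 3 * t + 6,
        3 * t + 7, 3 * t + 10] :=
      Fin.strictMono_iff_lt_succ.2 (by intro i; fin_cases i <;> simp; omega)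
    have hy : StrictMono ![3 * ν (t + 1) + 2, 3 * t, 3 * t + 3, 3 * t + 4, 3 * t + 5, 3 * t + 6,
        3 * t + 7, 3 * t + 10] :=
      Fin.strictMono_iff_lt_succ.2 (by intro i; fin_cases i <;> simp; omega)
    refine ⟨8, _, _, 6, _, _, .pop (γ t) (γ (t + 1)) (γ (t + 2)) p hprev hnext hl,
      arranged_layoutBlocks hx hy ?_, rfl, rfl⟩
    intro i
    fin_cases i
    · exact hZ'
    · exact hT (by omega)
    · exact hT ht
    · exact hB (by omega)
    · exact hZ
    · exact hT (t := t + 2) (by omega)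
    · exact hB ht
    · exact hB (t := t + 2) (by omega)

/-- The matrix of a balanced path from `v₁` to `v₂` is one of the matrices that count modulo 2. -/
theorem valid_layoutMatrix (hA : ∀ s, A s ∈ alphabet g) (hinj : Function.Injective A)
    (hν : Pairing (fun t => Γ.label (γ t)) n ν)
    (hs : γ 0 = Γ.start) (ha : γ (n - 1) = Γ.accept) (hn : 0 < n)
    (hadj : ∀ t, t + 1 < n → Γ.Adj (γ t) (γ (t + 1))) :
    (Valid A (layoutMatrix A γ ν n) ∧ ∃ a b, Erased A (One (layoutMatrix A γ ν n)) a b .B) ∧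
      free A (One (layoutMatrix A γ ν n)) = ∅ := by
  have hg : 0 < g := by have := seven_le_of_mem_alphabet (hA .P); omega
  have hE : Erased A (One (layoutMatrix A γ ν n)) = LayoutBlocks Γ γ ν n g := by
    ext a b s
    exact erased_layoutMatrix_iff hA hinj hν hn
  refine ⟨⟨⟨isPermRel_layoutMatrix (fun s => (hA s).1.permRel) hν hn hg,
    consecutive_layoutMatrix hA hν hn, ?_, fun a b _ hB => ?_⟩, ?_⟩, ?_⟩
  · rw [hE]
    exact admissible_layoutBlocks hν hg
  · obtain ⟨u, v, -, -, h⟩ := (blk_layoutMatrix_iff hA hinj hν hn).1 hB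
    exact h.name_ne rfl
  · rw [hE]
    exact ⟨_, _, _, _, rfl, rfl, .B 0 hn⟩
  · ext ⟨a, b⟩
    simp only [free, hE, Set.mem_ofPred_eq, Set.mem_empty_iff_false, iff_false, not_and, not_not]
    rintro ⟨u, v, rfl, rfl, h⟩
    obtain ⟨t, ht, rfl, rfl⟩ := h.eq_B
    exact blocked_layoutBlocks hν hs ha hadj ht

end

section

variable {V : Type*} {Γ : TwoStackAutomaton V} {g N : ℕ}
  {A : Block V Γ.Letter → Matrix (Fin g) (Fin g) Bool}

/-! ### Counting matrices and paths -/

theorem Valid.blockSystem (hA : ∀ s, A s ∈ alphabet g) (hinj : Function.Injective A)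
    {M : Matrix (Fin N) (Fin N) Bool} (h : Valid A M) :
    BlockSystem (Erased A (One M)) g N := by
  have hg := seven_le_of_mem_alphabet (hA .P)
  have same {a b a' b' : ℕ} {t t' : Block V Γ.Letter} (hb : Blk (One M) a b (A t))
      (hb' : Blk (One M) a' b' (A t')) (e : a = a' ∧ b = b') : t = t' := by
    obtain ⟨rfl, rfl⟩ := e
    exact hinj (hb.matrix_eq hb')
  refine ⟨by omega, ?_, ?_, ?_, h.admissible⟩
  · rintro a b s ⟨t, -, hb⟩
    exact hb.bounds h.perm (hA t).1.permRel (by omega)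
  · rintro a b s a' b' s' ⟨t, rfl, hb⟩ ⟨t', rfl, hb'⟩ h1 h2
    have e := hb.eq_of_row h.perm (hA t).1 (hA t').1 (by omega) hb' h1 h2
    exact ⟨e.1, e.2, by rw [same hb hb' e]⟩
  · rintro a b s a' b' s' ⟨t, rfl, hb⟩ ⟨t', rfl, hb'⟩ h1 h2
    have e := hb.eq_of_col h.perm (hA t).1 (hA t').1 (by omega) hb' h1 h2
    exact ⟨e.1, e.2, by rw [same hb hb' e]⟩

theorem Pairing.congr {ℓ ℓ' : ℕ → Label} {n : ℕ} {ν : ℕ → ℕ} (h : Pairing ℓ n ν)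
    (hl : ∀ t < n, ℓ t = ℓ' t) : Pairing ℓ' n ν := by
  refine ⟨h.lt, h.inj, fun ht h1 => h.eps ht ((hl _ ht).trans h1), fun ht h1 => ?_,
    fun ht h1 => ?_, fun htt ht h1 h2 => ?_, fun htt ht h1 h2 => ?_⟩
  · rw [← hl _ (h.lt ht)]; exact h.push ht ((hl _ ht).trans h1)
  · rw [← hl _ (h.lt ht)]; exact h.pop ht ((hl _ ht).trans h1)
  · exact h.above htt ht ((hl _ (by omega)).trans h1) ((hl _ ht).trans h2)
  · exact h.below htt ht ((hl _ (by omega)).trans h1) ((hl _ ht).trans h2)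

theorem Layout.congr {γ γ' : ℕ → V} {n : ℕ} {ν ν' : ℕ → ℕ} (hγ : ∀ t < n, γ t = γ' t)
    (h : ∀ t < n, ν t = ν' t) {u v : ℕ}
    {s : Block V Γ.Letter} (hL : Layout Γ γ ν n u v s) : Layout Γ γ' ν' n u v s := by
  cases hL with
  | P => exact .P
  | Q => exact .Q
  | T t ht => rw [hγ t ht]; exact .T t ht
  | B t ht => exact .B t ht
  | slot t s ht hs => rw [h t ht]; exact .slot t s ht (hγ t ht ▸ hs)

/-- A permutation matrix is determined by the blocks of a layout. -/
theorem eq_layoutMatrix (hA : ∀ s, A s ∈ alphabet g) {γ : ℕ → V} {n : ℕ} {ν : ℕ → ℕ}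
    {M : Matrix (Fin ((3 * n + 2) * g)) (Fin ((3 * n + 2) * g)) Bool}
    (hM : IsPermRel ((3 * n + 2) * g) (One M))
    (hν : Pairing (fun t => Γ.label (γ t)) n ν) (hn : 0 < n)
    (h : ∀ u v s, Layout Γ γ ν n u v s → Blk (One M) (u * g) (v * g) (A s)) :
    layoutMatrix A γ ν n = M := by
  have hg : 0 < g := by have := seven_le_of_mem_alphabet (hA .P); omega
  have hL := isPermRel_layoutMatrix (A := A) (fun s => (hA s).1.permRel) hν hn hg
  have key {a b} (hab : One (layoutMatrix A γ ν n) a b) : One M a b := by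
    obtain ⟨s, hs, h1⟩ := (one_layoutMatrix hν hn hg a b).1 hab
    have := (h _ _ s hs _ (Nat.mod_lt a hg) _ (Nat.mod_lt b hg)).2 h1
    rwa [Nat.div_add_mod', Nat.div_add_mod'] at this
  refine matrix_ext_one fun a b => ⟨key, fun hab => ?_⟩
  obtain ⟨c, hc⟩ := hL.exists_col (hM.lt_row hab)
  rwa [← hM.col_unique (key hc) hab]

/-- Without free blocks, a matrix that contains `B` or `B'` is the matrix of a path. -/
theorem Valid.exists_layout (hA : ∀ s, A s ∈ alphabet g) (hinj : Function.Injective A) {m : ℕ}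
    {M : Matrix (Fin ((3 * m + 2) * g)) (Fin ((3 * m + 2) * g)) Bool} (h : Valid A M)
    (hB : ∃ a b, Erased A (One M) a b .B) (hfree : free A (One M) = ∅) :
    ∃ (γ : ℕ → V) (ν : ℕ → ℕ), 0 < m ∧ γ 0 = Γ.start ∧ γ (m - 1) = Γ.accept ∧
      (∀ t, t + 1 < m → Γ.Adj (γ t) (γ (t + 1))) ∧ Pairing (fun t => Γ.label (γ t)) m ν ∧
      layoutMatrix A γ ν m = M := by
  have hblocked (a b : ℕ) (hab : Erased A (One M) a b .B) :
      Blocked (Erased A (One M)) g a b := by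
    by_contra hc
    have : (a, b) ∈ free A (One M) := ⟨hab, hc⟩
    rw [hfree] at this
    exact this
  have hS := h.blockSystem hA hinj
  obtain ⟨n, γ, ν, hN, h0, h1, hadj, hν, hL⟩ := hS.exists_layout hblocked hB
  obtain rfl : m = n + 1 := by
    have := Nat.eq_of_mul_eq_mul_right hS.pos hN
    omega
  refine ⟨γ, ν, by omega, h0, h1, fun t ht => hadj t (by omega), hν,
    eq_layoutMatrix hA h.perm hν (by omega) fun u v s hs => ?_⟩
  have hE := hL u v s hs
  by_cases hsB : s = .B
  · subst hsB
    exact (erased_B_iff.1 hE).resolve_right (h.blocked _ _ (hblocked _ _ hE))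
  · exact (erased_iff hsB hs.name_ne).1 hE

/-- The balanced paths that `TwoStackAutomaton.balancedCount` counts. -/
def TwoStackAutomaton.balancedPaths (Γ : TwoStackAutomaton V) (n : ℕ) : Set (List V) :=
  {γ : List V |
    γ.length = n ∧ γ.IsChain Γ.Adj ∧ γ.head? = some Γ.start ∧ γ.getLast? = some Γ.accept ∧
      IsBalanced (γ.map Γ.label)}

theorem map_range_mem_balancedPaths {γ : ℕ → V} {n : ℕ} :
    (List.range n).map γ ∈ Γ.balancedPaths n ↔ 0 < n ∧ γ 0 = Γ.start ∧ γ (n - 1) = Γ.accept ∧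
      (∀ t, t + 1 < n → Γ.Adj (γ t) (γ (t + 1))) ∧
      ∃ ν, Pairing (fun t => Γ.label (γ t)) n ν := by
  rw [← isBalanced_iff, TwoStackAutomaton.balancedPaths, Set.mem_ofPred_eq, List.isChain_map,
    List.isChain_range, List.map_map, List.head?_map, List.getLast?_map, List.head?_range,
    List.getLast?_range]
  rcases Nat.eq_zero_or_pos n with rfl | hn
  · simp
  · simp only [hn, hn.ne', List.length_map, List.length_range, if_false, Option.map_some,
      Option.some.injEq, true_and]
    constructor
    · rintro ⟨h1, h2, h3, h4⟩
      exact ⟨h2, h3, fun t ht => h1 t (by omega), h4⟩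
    · rintro ⟨h1, h2, h3, h4⟩
      exact ⟨fun t ht => h3 t (by omega), h1, h2, h4⟩

theorem eq_map_range {l : List V} {n : ℕ} (hl : l.length = n) (v : V) :
    l = (List.range n).map (fun t => l.getD t v) := by
  subst hl
  refine List.ext_getElem (by simp) fun i h1 h2 => ?_
  simp [h1]

/-- The map that sends a balanced path to its matrix is a bijection: the path can be read off from
the blocks `T v`. -/
theorem ncard_valid_eq_balancedCount (hA : ∀ s, A s ∈ alphabet g) (hinj : Function.Injective A)
    (n : ℕ) :
    Set.ncard {M : Matrix (Fin ((3 * n + 2) * g)) (Fin ((3 * n + 2) * g)) Bool |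
      (Valid A M ∧ ∃ a b, Erased A (One M) a b .B) ∧ free A (One M) = ∅} = Γ.balancedCount n := by
  classical
  have hg : 0 < g := by have := seven_le_of_mem_alphabet (hA .P); omega
  let path (l : List V) (t : ℕ) : V := l.getD t Γ.start
  let pair (l : List V) : ℕ → ℕ :=
    if h : ∃ ν, Pairing (fun t => Γ.label (path l t)) n ν then h.choose else id
  have hpath {l : List V} (hl : l ∈ Γ.balancedPaths n) : l = (List.range n).map (path l) :=
    eq_map_range hl.1 _
  have hmem {l : List V} (hl : l ∈ Γ.balancedPaths n) :=
    map_range_mem_balancedPaths.1 (hpath hl ▸ hl)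
  have hpair {l : List V} (h : ∃ ν, Pairing (fun t => Γ.label (path l t)) n ν) :
      Pairing (fun t => Γ.label (path l t)) n (pair l) := by
    simp only [pair, dif_pos h]
    exact h.choose_spec
  refine (Set.BijOn.ncard_eq (f := fun l => layoutMatrix A (path l) (pair l) n)
    (s := Γ.balancedPaths n) ⟨fun l hl => ?_, fun l hl l' hl' he => ?_, ?_⟩).symm
  · obtain ⟨hn, hs, ha, hadj, hν⟩ := hmem hl
    exact valid_layoutMatrix hA hinj (hpair hν) hs ha hn hadj
  · obtain ⟨hn, -, -, -, hν⟩ := hmem hl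
    obtain ⟨-, -, -, -, hν'⟩ := hmem hl'
    rw [hpath hl, hpath hl']
    refine List.map_congr_left fun t ht => ?_
    have ht := List.mem_range.1 ht
    have h1 := blk_layoutMatrix (A := A) (hpair hν) hn (.T t ht)
    have h2 := blk_layoutMatrix (A := A) (hpair hν') hn (.T t ht)
    have he : layoutMatrix A (path l) (pair l) n = layoutMatrix A (path l') (pair l') n := he
    rw [← he] at h2
    exact Block.T.inj (hinj (h1.matrix_eq h2))
  · rintro M ⟨⟨hM, hB⟩, hfree⟩
    obtain ⟨γ, ν, hn, h0, h1, hadj, hν, rfl⟩ := hM.exists_layout hA hinj hB hfree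
    have hl := map_range_mem_balancedPaths.2 ⟨hn, h0, h1, hadj, ν, hν⟩
    refine ⟨_, hl, ?_⟩
    have hp {t : ℕ} (ht : t < n) : path ((List.range n).map γ) t = γ t := by
      simp [path, ht]
    have hν' := hpair (hmem hl).2.2.2.2
    have hν'' := hν.congr (ℓ' := fun t => Γ.label (path ((List.range n).map γ) t))
      fun t ht => by rw [hp ht]
    exact eq_layoutMatrix hA hM.perm hν' hn fun u v s hs => blk_layoutMatrix hν hn
      (hs.congr (fun t ht => hp ht) fun t ht => hν'.unique hν'' ht)

theorem avoidCount_sub_modEq (hA : ∀ s, A s ∈ alphabet g) (hinj : Function.Injective A) (n : ℕ) :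
    (avoidCount (forbidden Γ A) ((3 * n + 2) * g) : ℤ)
        - avoidCount (forbidden' Γ A) ((3 * n + 2) * g) ≡ Γ.balancedCount n [ZMOD 2] := by
  set N := (3 * n + 2) * g
  have hvalid {M : Matrix (Fin N) (Fin N) Bool} :
      (IsPermutationMatrix M ∧ ∀ K ∈ forbidden Γ A, ¬ Contains M K) ↔ Valid A M := by
    rw [isPermutationMatrix_iff]
    constructor
    · rintro ⟨h1, h2⟩
      obtain ⟨h3, h4, h5⟩ := (avoids_forbidden_iff hA h1).1 h2
      exact ⟨h1, h3, h4, h5⟩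
    · exact fun h => ⟨h.perm, (avoids_forbidden_iff hA h.perm).2
        ⟨h.consecutive, h.admissible, h.blocked⟩⟩
  have hB {M : Matrix (Fin N) (Fin N) Bool} (h : Valid A M) :
      (Contains M ⟨g, g, A .B⟩ ∨ Contains M ⟨g, g, A .B'⟩) ↔ ∃ a b, Erased A (One M) a b .B := by
    simp only [erased_B_iff, exists_or]
    rw [contains_alphabet_iff h.perm h.consecutive (hA _), contains_alphabet_iff h.perm h.consecutive (hA _)]
  have hsub : {M : Matrix (Fin N) (Fin N) Bool |
        IsPermutationMatrix M ∧ ∀ K ∈ forbidden' Γ A, ¬ Contains M K} ⊆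
      {M | IsPermutationMatrix M ∧ ∀ K ∈ forbidden Γ A, ¬ Contains M K} :=
    fun M hM => ⟨hM.1, fun K hK => hM.2 K (Or.inl hK)⟩
  have hdiff : {M : Matrix (Fin N) (Fin N) Bool |
        IsPermutationMatrix M ∧ ∀ K ∈ forbidden Γ A, ¬ Contains M K} \
      {M | IsPermutationMatrix M ∧ ∀ K ∈ forbidden' Γ A, ¬ Contains M K} =
      {M | Valid A M ∧ ∃ a b, Erased A (One M) a b .B} := by
    ext M
    simp only [Set.mem_sdiff, Set.mem_ofPred_eq, hvalid]
    refine and_congr_right fun h => ?_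
    rw [← hB h]
    have h' := hvalid.2 h
    constructor
    · intro hc
      by_contra hb
      rw [not_or] at hb
      refine hc ⟨h'.1, fun K hK => ?_⟩
      rcases hK with hK | rfl | rfl
      exacts [h'.2 K hK, hb.1, hb.2]
    · rintro hb ⟨-, hc⟩
      rcases hb with hb | hb
      · exact hc _ (Or.inr (Or.inl rfl)) hb
      · exact hc _ (Or.inr (Or.inr rfl)) hb
  have hcard := Set.ncard_sdiff_add_ncard_of_subset hsub (Set.toFinite _)
  rw [hdiff] at hcard
  have h1 := ncard_valid_modEq hA hinj N
  rw [ncard_valid_eq_balancedCount hA hinj n, ← Int.natCast_modEq_iff] at h1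
  rw [avoidCount, avoidCount, ← hcard, Nat.cast_add, add_sub_cancel_right]
  exact h1

end

section

variable {V : Type*} {Γ : TwoStackAutomaton V} {g : ℕ}
  {A : Block V Γ.Letter → Matrix (Fin g) (Fin g) Bool}

/-! ### The forbidden sets are finite sets of partial patterns -/

theorem isPartialPattern_iff_one {m n : ℕ} {X : Matrix (Fin m) (Fin n) Bool} :
    ZeroOneMatrix.IsPartialPattern ⟨m, n, X⟩ ↔ (∀ i j j', One X i j → One X i j' → j = j') ∧
      ∀ i i' j, One X i j → One X i' j → i = i' := by
  constructor
  · rintro ⟨h1, h2⟩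
    refine ⟨?_, ?_⟩
    · rintro i j j' ⟨hi, hj, h⟩ ⟨_, hj', h'⟩
      exact congrArg Fin.val (h1 _ _ _ h h')
    · rintro i i' j ⟨hi, hj, h⟩ ⟨hi', _, h'⟩
      exact congrArg Fin.val (h2 _ _ _ h h')
  · rintro ⟨h1, h2⟩
    exact ⟨fun i j j' h h' => Fin.ext (h1 i j j' (one_fin.2 h) (one_fin.2 h')),
      fun i i' j h h' => Fin.ext (h2 i i' j (one_fin.2 h) (one_fin.2 h'))⟩

theorem isPartialPattern_permPattern (hA : ∀ s, A s ∈ alphabet g) {k : ℕ} {σ : Fin k → Fin k}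
    (hσ : Function.Injective σ) (s : Fin k → Block V Γ.Letter) :
    (permPattern A σ s).IsPartialPattern := by
  have hdm {i i' : Fin (k * g)} (h1 : i.divNat = i'.divNat) (h2 : i.modNat = i'.modNat) :
      i = i' := finProdFinEquiv.symm.injective (Prod.ext h1 h2)
  constructor
  · intro i j j' h h'
    have h := (permPattern_entry i j).1 h
    have h' := (permPattern_entry i j').1 h'
    refine hdm (h.1.symm.trans h'.1) (Fin.ext ?_)
    exact (hA _).1.permRel.col_unique (one_fin.2 h.2) (one_fin.2 h'.2)
  · intro i i' j h h'
    have h := (permPattern_entry i j).1 h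
    have h' := (permPattern_entry i' j).1 h'
    have e := hσ (h.1.trans h'.1.symm)
    rw [← e] at h'
    refine hdm e (Fin.ext ?_)
    exact (hA _).1.permRel.row_unique (one_fin.2 h.2) (one_fin.2 h'.2)

theorem isPartialPattern_of_mem_alphabet {X : Matrix (Fin g) (Fin g) Bool} (h : X ∈ alphabet g) :
    ZeroOneMatrix.IsPartialPattern ⟨g, g, X⟩ :=
  isPartialPattern_iff_one.2 ⟨fun _ _ _ => h.1.permRel.col_unique,
    fun _ _ _ => h.1.permRel.row_unique⟩

theorem isPartialPattern_of_mem_F1 {K : ZeroOneMatrix} (hK : K ∈ F1 g) : K.IsPartialPattern := by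
  obtain ⟨X, hX, ⟨a, ha⟩, -, -, rfl | rfl⟩ := hK <;>
    obtain ⟨h1, h2⟩ := isPartialPattern_iff_one.1 (isPartialPattern_of_mem_alphabet hX)
  · have e := one_insertNth_row ha X
    refine isPartialPattern_iff_one.2 ⟨fun i j j' h h' => ?_, fun i i' j h h' => ?_⟩
    · exact h1 _ _ _ ((e _ _).1 h).2 ((e _ _).1 h').2
    · have k := (e _ _).1 h
      have k' := (e _ _).1 h'
      have := h2 _ _ _ k.2 k'.2
      split_ifs at this <;> omega
  · have e := one_insertNth_col ha X
    refine isPartialPattern_iff_one.2 ⟨fun i j j' h h' => ?_, fun i i' j h h' => ?_⟩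
    · have k := (e _ _).1 h
      have k' := (e _ _).1 h'
      have := h1 _ _ _ k.2 k'.2
      split_ifs at this <;> omega
    · exact h2 _ _ _ ((e _ _).1 h).2 ((e _ _).1 h').2

theorem isPartialPattern_of_mem_F3 (hA : ∀ s, A s ∈ alphabet g) {K : ZeroOneMatrix}
    (hK : K ∈ F3 Γ A) : K.IsPartialPattern := by
  have hP := isPartialPattern_iff_one.1 (isPartialPattern_of_mem_alphabet (hA .P))
  have hQ := isPartialPattern_iff_one.1 (isPartialPattern_of_mem_alphabet (hA .Q))
  rcases hK with rfl | rfl | rfl | rfl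
  · have e := one_append_row_right (k := g + 1) (A .Q)
    exact isPartialPattern_iff_one.2 ⟨fun i j j' h h' => hQ.1 _ _ _ ((e _ _).1 h) ((e _ _).1 h'),
      fun i i' j h h' => hQ.2 _ _ _ ((e _ _).1 h) ((e _ _).1 h')⟩
  · have e := one_append_row_left (k := g + 1) (A .P)
    refine isPartialPattern_iff_one.2 ⟨fun i j j' h h' => ?_, fun i i' j h h' => ?_⟩
    · exact hP.1 _ _ _ ((e _ _).1 h).2 ((e _ _).1 h').2
    · have k := (e _ _).1 h
      have k' := (e _ _).1 h'
      have := hP.2 _ _ _ k.2 k'.2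
      omega
  · have e := one_append_col_right (k := g + 1) (A .Q)
    exact isPartialPattern_iff_one.2 ⟨fun i j j' h h' => hQ.1 _ _ _ ((e _ _).1 h) ((e _ _).1 h'),
      fun i i' j h h' => hQ.2 _ _ _ ((e _ _).1 h) ((e _ _).1 h')⟩
  · have e := one_append_col_left (k := g + 1) (A .P)
    refine isPartialPattern_iff_one.2 ⟨fun i j j' h h' => ?_, fun i i' j h h' => ?_⟩
    · have k := (e _ _).1 h
      have k' := (e _ _).1 h'
      have := hP.1 _ _ _ k.2 k'.2
      omega
    · exact hP.2 _ _ _ ((e _ _).1 h).2 ((e _ _).1 h').2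

theorem isPartialPattern_of_mem_forbidden (hA : ∀ s, A s ∈ alphabet g) {K : ZeroOneMatrix}
    (hK : K ∈ forbidden Γ A) : K.IsPartialPattern := by
  rcases hK with (((hK | hK) | hK) | hK) | hK
  · exact isPartialPattern_of_mem_F1 hK
  · exact hK.1
  · exact isPartialPattern_of_mem_F3 hA hK
  · obtain ⟨k, σ, s, c, ht, -, rfl⟩ := mem_F4_iff.1 hK
    exact isPartialPattern_permPattern hA ht.injective s
  · obtain ⟨p, q, -, ⟨s, -, rfl⟩ | ⟨j, rfl⟩⟩ := mem_F5_iff.1 hK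
    · exact isPartialPattern_permPattern hA (by decide) _
    · exact isPartialPattern_permPattern hA (by decide) _

theorem isPartialPattern_of_mem_forbidden' (hA : ∀ s, A s ∈ alphabet g) {K : ZeroOneMatrix}
    (hK : K ∈ forbidden' Γ A) : K.IsPartialPattern := by
  rcases hK with hK | rfl | rfl
  · exact isPartialPattern_of_mem_forbidden hA hK
  · exact isPartialPattern_of_mem_alphabet (hA _)
  · exact isPartialPattern_of_mem_alphabet (hA _)

theorem finite_size_le (b : ℕ) : {K : ZeroOneMatrix | K.rows ≤ b ∧ K.cols ≤ b}.Finite := by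
  refine (Set.finite_range fun p : Σ i : Fin (b + 1) × Fin (b + 1), Matrix (Fin i.1) (Fin i.2) Bool =>
    (⟨p.1.1, p.1.2, p.2⟩ : ZeroOneMatrix)).subset ?_
  rintro ⟨m, n, K⟩ ⟨h1, h2⟩
  exact ⟨⟨(⟨m, Nat.lt_succ_of_le h1⟩, ⟨n, Nat.lt_succ_of_le h2⟩), K⟩, rfl⟩

theorem finite_forbidden (hA : ∀ s, A s ∈ alphabet g) : (forbidden Γ A).Finite := by
  have hg := seven_le_of_mem_alphabet (hA .P)
  refine (finite_size_le (8 * g)).subset fun K hK => ?_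
  rw [Set.mem_ofPred_eq]
  rcases hK with (((hK | hK) | hK) | hK) | hK
  · obtain ⟨X, hX, a, -, -, rfl | rfl⟩ := hK <;> simp only <;> omega
  · rcases hK.2.1 with h | h <;> omega
  · rcases hK with rfl | rfl | rfl | rfl <;> simp only <;> omega
  · obtain ⟨k, σ, s, c, ht, -, rfl⟩ := mem_F4_iff.1 hK
    have := Nat.mul_le_mul_right g ht.size_le
    exact ⟨this, this⟩
  · obtain ⟨p, q, -, ⟨s, -, rfl⟩ | ⟨j, rfl⟩⟩ := mem_F5_iff.1 hK
    · exact ⟨Nat.mul_le_mul_right g (by omega), Nat.mul_le_mul_right g (by omega)⟩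
    · exact ⟨Nat.mul_le_mul_right g (by omega), Nat.mul_le_mul_right g (by omega)⟩

theorem finite_forbidden' (hA : ∀ s, A s ∈ alphabet g) : (forbidden' Γ A).Finite :=
  (finite_forbidden hA).union (Set.toFinite _)

end

/-! ### The alphabet is large -/

theorem isSimple_iff {g : ℕ} {X : Matrix (Fin g) (Fin g) Bool} :
    IsSimple X ↔ IsPermRel g (One X) ∧ ∀ p q k, p + k ≤ g → q + k ≤ g → 1 < k → k < g →
      ¬ ∀ i j, One X i j → (p ≤ i ∧ i < p + k ↔ q ≤ j ∧ j < q + k) := by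
  constructor
  · intro h
    refine ⟨h.permRel, fun p q k hp hq hk hk' hX => ?_⟩
    rcases h.interval hp hq hX with h | h <;> omega
  · rintro ⟨hP, h⟩
    refine ⟨isPermutationMatrix_iff.2 hP, fun k p q hp hq hk hk' hX => h p q k hp hq hk hk' ?_⟩
    intro i j hij
    constructor
    · rintro ⟨h1, h2⟩
      obtain ⟨⟨b, hb⟩, hb', -⟩ := hX.1 ⟨i - p, by omega⟩
      have : One X (p + (i - p)) (q + b) := ⟨_, _, hb'⟩
      rw [show p + (i - p) = i by omega] at this
      have := hP.col_unique hij this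
      omega
    · rintro ⟨h1, h2⟩
      obtain ⟨⟨b, hb⟩, hb', -⟩ := hX.2 ⟨j - q, by omega⟩
      have : One X (p + b) (q + (j - q)) := ⟨_, _, hb'⟩
      rw [show q + (j - q) = j by omega] at this
      have := hP.row_unique hij this
      omega

open Classical in
/-- The matrix that arises from `X` when a first column and a new row `k` are inserted, with a
one in their common entry. -/
noncomputable def insertFirst {g : ℕ} (X : Matrix (Fin g) (Fin g) Bool) (k : ℕ) :
    Matrix (Fin (g + 1)) (Fin (g + 1)) Bool :=
  fun i j => decide (((i : ℕ) = k ∧ (j : ℕ) = 0) ∨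
    ((i : ℕ) ≠ k ∧ (j : ℕ) ≠ 0 ∧ One X (if (i : ℕ) < k then i else i - 1) (j - 1)))

theorem one_insertFirst {g : ℕ} {X : Matrix (Fin g) (Fin g) Bool} {k i j : ℕ} (hk : k ≤ g) :
    One (insertFirst X k) i j ↔ (i = k ∧ j = 0) ∨
      (i ≠ k ∧ j ≠ 0 ∧ One X (if i < k then i else i - 1) (j - 1)) := by
  constructor
  · rintro ⟨hi, hj, h⟩
    simpa [insertFirst] using h
  · intro h
    have hij : i < g + 1 ∧ j < g + 1 := by
      rcases h with h | ⟨h1, h2, h3, h4, -⟩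
      · omega
      · split_ifs at h3 <;> omega
    exact ⟨hij.1, hij.2, by simpa [insertFirst] using h⟩

theorem one_insertFirst_lift {g : ℕ} {X : Matrix (Fin g) (Fin g) Bool} {k i j : ℕ} (hk : k ≤ g) :
    One (insertFirst X k) (if i < k then i else i + 1) (j + 1) ↔ One X i j := by
  rw [one_insertFirst hk]
  by_cases h : i < k
  · simp [h, h.ne]
  · have h1 : i + 1 ≠ k := by omega
    have h2 : ¬ i + 1 < k := by omega
    simp [h, h1, h2]

theorem isPermRel_insertFirst {g : ℕ} {X : Matrix (Fin g) (Fin g) Bool}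
    (hX : IsPermRel g (One X)) {k : ℕ} (hk : k ≤ g) :
    IsPermRel (g + 1) (One (insertFirst X k)) := by
  refine ⟨fun ⟨h, _, _⟩ => h, fun ⟨_, h, _⟩ => h, fun {a} ha => ?_, fun {b} hb => ?_,
    fun {a b b'} h h' => ?_, fun {a a' b} h h' => ?_⟩
  · by_cases e : a = k
    · exact ⟨0, (one_insertFirst hk).2 (Or.inl ⟨e, rfl⟩)⟩
    · obtain ⟨j, hj⟩ := hX.exists_col (a := if a < k then a else a - 1) (by split_ifs <;> omega)
      exact ⟨j + 1, (one_insertFirst hk).2 (Or.inr ⟨e, by omega, hj⟩)⟩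
  · by_cases e : b = 0
    · exact ⟨k, (one_insertFirst hk).2 (Or.inl ⟨rfl, e⟩)⟩
    · obtain ⟨i, hi⟩ := hX.exists_row (b := b - 1) (by omega)
      refine ⟨if i < k then i else i + 1, ?_⟩
      rw [show b = b - 1 + 1 by omega]
      exact (one_insertFirst_lift hk).2 hi
  · rw [one_insertFirst hk] at h h'
    rcases h with h | ⟨h1, h2, h3⟩ <;> rcases h' with h' | ⟨h1', h2', h3'⟩ <;> try omega
    have := hX.col_unique h3 h3'
    omega
  · rw [one_insertFirst hk] at h h'
    rcases h with h | ⟨h1, h2, h3⟩ <;> rcases h' with h' | ⟨h1', h2', h3'⟩ <;> try omega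
    have := hX.row_unique h3 h3'
    split_ifs at this <;> omega

/-- An interval of the enlarged matrix gives an interval of `X`, which has to be trivial; the
remaining possibilities are excluded by the choice of `k`. -/
theorem IsSimple.insertFirst {g : ℕ} {X : Matrix (Fin g) (Fin g) Bool} (hX : IsSimple X) {k : ℕ}
    (hk0 : 0 < k) (hkg : k < g) (h0 : ¬ One X k 0) (h1 : ¬ One X (k - 1) 0) :
    IsSimple (PatAvoid.insertFirst X k) := by
  have hP := hX.permRel
  refine isSimple_iff.2 ⟨isPermRel_insertFirst hP hkg.le, fun p q m hp hq hm hmg hI => ?_⟩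
  have hk := (hI k 0 ((one_insertFirst hkg.le).2 (Or.inl ⟨rfl, rfl⟩)))
  have key (i j : ℕ) (hij : One X i j) := hI _ _ ((one_insertFirst_lift hkg.le).2 hij)
  by_cases hc : p ≤ k ∧ k < p + m
  · obtain rfl : q = 0 := by omega
    have := hX.interval (p := p) (q := 0) (k := m - 1) (by omega) (by omega) fun i j hij => by
      have := key i j hij
      split_ifs at this <;> omega
    obtain rfl : m = 2 := by omega
    obtain ⟨i, hi⟩ := hP.exists_row (b := 0) (by omega)
    have hi' : i = p := by
      have := key i 0 hi
      split_ifs at this <;> omega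
    subst hi'
    obtain rfl | rfl : k = i ∨ k = i + 1 := by omega
    · exact h0 hi
    · exact h1 hi
  · have := hX.interval (p := if p < k then p else p - 1) (q := q - 1) (k := m)
      (by split_ifs <;> omega) (by omega) fun i j hij => by
        have := key i j hij
        split_ifs at this ⊢ <;> omega
    omega

theorem insertFirst_mem_alphabet {g : ℕ} {X : Matrix (Fin g) (Fin g) Bool} (hX : X ∈ alphabet g)
    {k : ℕ} (hk0 : 0 < k) (hkg : k < g) (h0 : ¬ One X k 0) (h1 : ¬ One X (k - 1) 0) :
    insertFirst X k ∈ alphabet (g + 1) := by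
  refine ⟨hX.1.insertFirst hk0 hkg h0 h1, contains_iff.2 ?_⟩
  obtain ⟨r, c, hO, hr, hc⟩ := contains_iff.1 hX.2
  refine ⟨fun i => if r i < k then r i else r i + 1, fun j => c j + 1, ⟨fun i j hij hj => ?_,
    fun i j hij hj => ?_, fun i hi j hj => ?_⟩, fun i hi => ?_, fun j hj => ?_⟩
  · have := hO.incr_row i j hij hj
    split_ifs <;> omega
  · have := hO.incr_col i j hij hj
    omega
  · rw [one_insertFirst_lift hkg.le]
    exact hO.iff i hi j hj
  · have := hr i hi
    dsimp only
    split_ifs <;> omega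
  · have := hc j hj
    dsimp only
    omega

/-- The new row can be any one except for the first, the last and the two next to the one in the
first column of the old matrix. -/
theorem le_ncard_alphabet_succ {g : ℕ} (h : (alphabet g).Nonempty) :
    g - 3 ≤ (alphabet (g + 1)).ncard := by
  obtain ⟨X, hX⟩ := h
  have hg := seven_le_of_mem_alphabet hX
  obtain ⟨k0, hk0⟩ := hX.1.permRel.exists_row (b := 0) (by omega)
  let S : Finset ℕ := ((Finset.Ioo 0 g).erase k0).erase (k0 + 1)
  have hS : g - 3 ≤ S.card := by
    have h1 := Finset.pred_card_le_card_erase (s := (Finset.Ioo 0 g).erase k0) (a := k0 + 1)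
    have h2 := Finset.pred_card_le_card_erase (s := Finset.Ioo 0 g) (a := k0)
    rw [Nat.card_Ioo] at h2
    simp only [S]
    omega
  have hinj : Set.InjOn (insertFirst X) (S : Set ℕ) := by
    intro k hk k' hk' he
    simp only [S, Finset.coe_erase, Set.mem_sdiff, Finset.coe_Ioo, Set.mem_Ioo] at hk hk'
    have h1 : One (insertFirst X k) k 0 := (one_insertFirst (by omega)).2 (Or.inl ⟨rfl, rfl⟩)
    rw [he, one_insertFirst (by omega)] at h1
    omega
  rw [← Set.ncard_coe_finset, ← hinj.ncard_image] at hS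
  refine hS.trans (Set.ncard_le_ncard ?_ (Set.toFinite _))
  rintro _ ⟨k, hk, rfl⟩
  simp only [S, Finset.coe_erase, Set.mem_sdiff, Finset.coe_Ioo, Set.mem_Ioo,
    Set.mem_singleton_iff] at hk
  refine insertFirst_mem_alphabet hX hk.1.1.1 hk.1.1.2 (fun h => ?_) fun h => ?_
  · exact hk.1.2 (hX.1.permRel.row_unique h hk0)
  · have := hX.1.permRel.row_unique h hk0
    omega

/-- The columns of the ones in a simple `9 × 9` permutation matrix that contains `matrixL`. -/
def simpleNine : Fin 9 → Fin 9 := ![5, 2, 6, 8, 4, 0, 7, 1, 3]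

theorem simpleNine_not_interval (k p q : Fin 9) : ¬ (1 < k.val ∧ p.val + k.val ≤ 9 ∧
    q.val + k.val ≤ 9 ∧ ∀ i : Fin 9, (p.val ≤ i.val ∧ i.val < p.val + k.val ↔
      q.val ≤ (simpleNine i).val ∧ (simpleNine i).val < q.val + k.val)) := by
  revert k p q
  decide

theorem alphabet_nine_nonempty : (alphabet 9).Nonempty := by
  have hf : Function.Bijective simpleNine := by decide
  let X : Matrix (Fin 9) (Fin 9) Bool := fun i j => decide (j = simpleNine i)
  have hX {i j : Fin 9} : X i j = true ↔ j = simpleNine i := decide_eq_true_iff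
  refine ⟨X, isSimple_iff.2 ⟨isPermutationMatrix_iff.1 ⟨fun i => ?_, fun j => ?_⟩,
    fun p q k hp hq hk hk' h => ?_⟩, ?_⟩
  · simp only [hX]
    exact ⟨simpleNine i, rfl, fun j h => h⟩
  · simp only [hX]
    obtain ⟨i, hi⟩ := hf.2 j
    exact ⟨i, hi.symm, fun i' h => hf.1 (h.symm.trans hi.symm)⟩
  · exact simpleNine_not_interval ⟨k, hk'⟩ ⟨p, by omega⟩ ⟨q, by omega⟩
      ⟨hk, hp, hq, fun i => h i (simpleNine i) (one_fin.2 (hX.2 rfl))⟩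
  · have hr : StrictMono (![0, 2, 3, 4, 5, 7, 8] : Fin 7 → Fin 9) := by decide
    have hc : StrictMono (![0, 1, 3, 4, 5, 6, 8] : Fin 7 → Fin 9) := by decide
    have h : ∀ i j : Fin 7, decide ((![0, 1, 3, 4, 5, 6, 8] : Fin 7 → Fin 9) j =
        simpleNine ((![0, 2, 3, 4, 5, 7, 8] : Fin 7 → Fin 9) i)) =
        decide (j = (![4, 5, 6, 3, 0, 1, 2] : Fin 7 → Fin 7) i) := by
      decide
    exact ⟨OrderEmbedding.ofStrictMono _ hr, OrderEmbedding.ofStrictMono _ hc,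
      funext fun i => funext fun j => h i j⟩

theorem alphabet_nonempty {g : ℕ} (hg : 9 ≤ g) : (alphabet g).Nonempty := by
  induction g, hg using Nat.le_induction with
  | base => exact alphabet_nine_nonempty
  | succ g hg ih =>
    have := le_ncard_alphabet_succ ih
    exact Set.nonempty_of_ncard_ne_zero (by omega)

theorem exists_lt_ncard_alphabet (m : ℕ) : ∃ g, m < (alphabet g).ncard := by
  refine ⟨m + 9 + 1, ?_⟩
  have := le_ncard_alphabet_succ (alphabet_nonempty (g := m + 9) (by omega))
  omega

/-! ### The choice of the blocks -/

theorem TwoStackAutomaton.finite_letter {V : Type*} [Finite V] (Γ : TwoStackAutomaton V) :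
    Finite Γ.Letter := by
  have hv (a : Γ.Letter) : ∃ v, Γ.label v = .push a.1.1 a.1.2 := a.2
  choose f hf using hv
  refine Finite.of_injective f fun a b hab => Subtype.ext ?_
  have := (hf a).symm.trans ((congrArg Γ.label hab).trans (hf b))
  obtain ⟨h1, h2⟩ := Label.push.inj this
  exact Prod.ext h1 h2

/-- The blocks have the names `P, Q, B, B', E`, `T v` and `Z p`, so there are `5 + m + r` of them. -/
theorem card_block (V ι : Type*) [Finite V] [Finite ι] :
    Finite (Block V ι) ∧ Nat.card (Block V ι) = 5 + Nat.card V + Nat.card ι := by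
  let e : Block V ι ≃ (Fin 5 ⊕ V) ⊕ ι :=
    { toFun := fun s => match s with
        | .P => .inl (.inl 0)
        | .Q => .inl (.inl 1)
        | .B => .inl (.inl 2)
        | .B' => .inl (.inl 3)
        | .E => .inl (.inl 4)
        | .T v => .inl (.inr v)
        | .Z p => .inr p
      invFun := fun s => match s with
        | .inl (.inl 0) => .P
        | .inl (.inl 1) => .Q
        | .inl (.inl 2) => .B
        | .inl (.inl 3) => .B'
        | .inl (.inl 4) => .E
        | .inl (.inr v) => .T v
        | .inr p => .Z p
      left_inv := fun s => by cases s <;> rfl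
      right_inv := fun s => by
        rcases s with (i | v) | p
        · fin_cases i <;> rfl
        · rfl
        · rfl }
  refine ⟨Finite.of_equiv _ e.symm, ?_⟩
  rw [Nat.card_congr e, Nat.card_sum, Nat.card_sum, Nat.card_fin]

theorem exists_injective_alphabet {V : Type*} [Finite V] (Γ : TwoStackAutomaton V) {g : ℕ}
    (hg : 5 + Nat.card V + Nat.card Γ.Letter < (alphabet g).ncard) :
    ∃ A : Block V Γ.Letter → Matrix (Fin g) (Fin g) Bool,
      (∀ s, A s ∈ alphabet g) ∧ Function.Injective A := by
  have := Γ.finite_letter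
  obtain ⟨hfin, hcard⟩ := card_block V Γ.Letter
  have := Fintype.ofFinite (Block V Γ.Letter)
  have := Fintype.ofFinite (alphabet g)
  have h : Fintype.card (Block V Γ.Letter) ≤ Fintype.card (alphabet g) := by
    rw [← Nat.card_eq_fintype_card, ← Nat.card_eq_fintype_card, hcard, Nat.card_coe_set_eq]
    exact hg.le
  obtain ⟨f⟩ := Function.Embedding.nonempty_of_card_le h
  exact ⟨fun s => f s, fun s => (f s).2, fun s t h => f.injective (Subtype.ext h)⟩

end PatAvoid

theorem lemma3p2 {V : Type*} [Finite V] (Γ : PatAvoid.TwoStackAutomaton V) :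
    -- the Main Lemma
    (∃ (F F' : Set PatAvoid.ZeroOneMatrix) (c d : ℕ),
      F.Finite ∧ F'.Finite ∧
      (∀ K ∈ F, K.IsPartialPattern) ∧ (∀ K ∈ F', K.IsPartialPattern) ∧
      1 ≤ c ∧ 1 ≤ d ∧
      ∀ n : ℕ, (PatAvoid.avoidCount F (c * n + d) : ℤ) - PatAvoid.avoidCount F' (c * n + d)
        ≡ Γ.balancedCount n [ZMOD 2]) ∧
    -- the alphabet is large enough for the choices below when `g` is suitable
    (∃ g : ℕ, 5 + Nat.card V + Nat.card Γ.Letter < (PatAvoid.alphabet g).ncard) ∧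
    -- the explicit construction, for every choice of distinct matrices from the alphabet
    (∀ (g : ℕ) (A : PatAvoid.Block V Γ.Letter → Matrix (Fin g) (Fin g) Bool),
      (∀ s, A s ∈ PatAvoid.alphabet g) → Function.Injective A →
      (PatAvoid.forbidden Γ A).Finite ∧ (PatAvoid.forbidden' Γ A).Finite ∧
      (∀ K ∈ PatAvoid.forbidden Γ A, K.IsPartialPattern) ∧
      (∀ K ∈ PatAvoid.forbidden' Γ A, K.IsPartialPattern) ∧
      ∀ n : ℕ, (PatAvoid.avoidCount (PatAvoid.forbidden Γ A) ((3 * n + 2) * g) : ℤ)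
          - PatAvoid.avoidCount (PatAvoid.forbidden' Γ A) ((3 * n + 2) * g)
        ≡ Γ.balancedCount n [ZMOD 2]) := by
  obtain ⟨g, hg⟩ := PatAvoid.exists_lt_ncard_alphabet (5 + Nat.card V + Nat.card Γ.Letter)
  refine ⟨?_, ⟨g, hg⟩, fun g A hA hinj => ⟨PatAvoid.finite_forbidden hA,
    PatAvoid.finite_forbidden' hA, fun K => PatAvoid.isPartialPattern_of_mem_forbidden hA,
    fun K => PatAvoid.isPartialPattern_of_mem_forbidden' hA,
    PatAvoid.avoidCount_sub_modEq hA hinj⟩⟩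
  obtain ⟨A, hA, hinj⟩ := PatAvoid.exists_injective_alphabet Γ hg
  have hg7 := PatAvoid.seven_le_of_mem_alphabet (hA .P)
  refine ⟨_, _, 3 * g, 2 * g, PatAvoid.finite_forbidden hA, PatAvoid.finite_forbidden' hA,
    fun K => PatAvoid.isPartialPattern_of_mem_forbidden hA,
    fun K => PatAvoid.isPartialPattern_of_mem_forbidden' hA, by omega, by omega, fun n => ?_⟩
  rw [show 3 * g * n + 2 * g = (3 * n + 2) * g by ring]
  exact PatAvoid.avoidCount_sub_modEq hA hinj n
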